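/- Let $g,\lambda,\alpha,\beta,R,P>0$ and $0<\varepsilon\le 1$ be constants, and let $\mathbb T$ be the one-dimensional torus of length $L>0$. Consider the dissipative Gross–Pitaevskii/reservoir system for $\psi(t,x)\in\mathbb C$ and $n(t,x)\in\mathbb R$, $$i\partial_t\psi=-\tfrac12\partial_x^2\psi+g|\psi|^2\psi+\lambda n\psi+\tfrac i2(Rn-\alpha)\psi,\qquad \varepsilon\,\partial_t n=P-(R|\psi|^2+\beta)n,\qquad x\in\mathbb T,\ t\ge 0,$$ with initial data $\psi|_{t=0}=\psi_0$, $n|_{t=0}=n_0$. Let $\mathcal H^1(\mathbb T)=H^1(\mathbb T;\mathbb C)\oplus H^1(\mathbb T;\mathbb R)$. A global solution is a pair $(\psi,n)\in C([0,\infty);\mathcal H^1(\mathbb T))$ that attains the initial data and satisfies both equations in the sense of distributions on $\mathbb T$ at every time $t\ge 0$: for each smooth $\varphi$ on $\mathbb T$ the functions $t\mapsto\int_{\mathbb T}\psi\varphi\,dx$ and $t\mapsto\int_{\mathbb T}n\varphi\,dx$ are differentiable on $[0,\infty)$ (from the right at $t=0$), with the derivatives that the equations prescribe, where $-\frac12\partial_x^2\psi$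 acts on $\varphi$ as $\frac12\int_{\mathbb T}\partial_x\psi\,\partial_x\varphi\,dx$. **Theorem 2.5.** Let $(\psi_0,n_0)\in\mathcal H^1(\mathbb T)$ with $n_0>0$ (almost everywhere). Then there exists a unique global solution $(\psi,n)\in C([0,\infty);\mathcal H^1(\mathbb T))$ of the system with initial data $(\psi_0,n_0)$. In addition, its total mass $$M(t)=\int_{\mathbb T}|\psi(t,x)|^2\,dx+\varepsilon\int_{\mathbb T}n(t,x)\,dx$$ is uniformly bounded for all $t\ge0$: there is a constant $C$ with $|M(t)|\le C$ for all $t\ge 0$. -/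

import Mathlib

open MeasureTheory Set
open scoped ContDiff ENNReal

noncomputable section

namespace Polariton

/-- The one-dimensional torus of length `L`; it carries the Haar measure `volume` of total mass
`L`. -/
abbrev Torus (L : ℝ) : Type := AddCircle L

/-- Smooth functions on the torus: those whose periodic lift to the line is smooth. -/
def IsSmooth {L : ℝ} {𝕜 : Type} [RCLike 𝕜] (φ : Torus L → 𝕜) : Prop :=
  ContDiff ℝ ∞ (fun s : ℝ => φ (s : Torus L))

/-- The classical derivative of a function on the torus, the derivative at `0` of
`s ↦ φ (x + s)`. -/
def torusDeriv {L : ℝ} {𝕜 : Type} [RCLike 𝕜] (φ : Torus L → 𝕜) (x : Torus L) : 𝕜 :=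
  deriv (fun s : ℝ => φ (x + (s : Torus L))) 0

/-- `v` is the weak (distributional) derivative of `u` on the torus. -/
def HasWeakDeriv {L : ℝ} [Fact (0 < L)] {𝕜 : Type} [RCLike 𝕜] (u v : Torus L → 𝕜) : Prop :=
  ∀ φ : Torus L → 𝕜, IsSmooth φ → ∫ x, u x * torusDeriv φ x = -∫ x, v x * φ x

theorem IsSmooth.continuous {L : ℝ} {𝕜 : Type} [RCLike 𝕜] {φ : Torus L → 𝕜}
    (h : IsSmooth φ) : Continuous φ :=
  isQuotientMap_quotient_mk'.continuous_iff.2 (ContDiff.continuous h)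

theorem torusDeriv_coe {L : ℝ} {𝕜 : Type} [RCLike 𝕜] (φ : Torus L → 𝕜) (s : ℝ) :
    torusDeriv φ (s : Torus L) = deriv (fun r : ℝ => φ (r : Torus L)) s := by
  have h := deriv_comp_const_add (f := fun r : ℝ => φ (r : Torus L)) s 0
  simpa [torusDeriv] using h

theorem IsSmooth.deriv_smooth {L : ℝ} {𝕜 : Type} [RCLike 𝕜] {φ : Torus L → 𝕜}
    (h : IsSmooth φ) : IsSmooth (torusDeriv φ) := by
  have h2 : (fun s : ℝ => torusDeriv φ (s : Torus L))
      = deriv (fun r : ℝ => φ (r : Torus L)) := funext (torusDeriv_coe φ)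
  unfold IsSmooth
  rw [h2]
  exact (contDiff_infty_iff_deriv.1 h).2

theorem integrable_mul_smooth {L : ℝ} [Fact (0 < L)] {𝕜 : Type} [RCLike 𝕜]
    (u : Lp 𝕜 2 (volume : Measure (Torus L))) {φ : Torus L → 𝕜} (h : IsSmooth φ) :
    Integrable (fun x => u x * φ x) := by
  have hφ : MemLp φ 2 (volume : Measure (Torus L)) :=
    (ContinuousMap.mk φ h.continuous).memLp (p := 2) (μ := volume) ℝ
  exact (Lp.memLp u).integrable_mul hφ

/-- The Sobolev space `H¹` of the torus. An element is the pair of a square integrable function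
and its square integrable weak derivative; the norm is
`‖u‖² = ∫ |u|² + ∫ |∂ₓ u|²`. -/
def H1 (L : ℝ) [Fact (0 < L)] (𝕜 : Type) [RCLike 𝕜] :
    Submodule 𝕜 (WithLp 2 (Lp 𝕜 2 (volume : Measure (Torus L)) ×
      Lp 𝕜 2 (volume : Measure (Torus L)))) where
  carrier := {w | HasWeakDeriv (w.fst : Torus L → 𝕜) (w.snd : Torus L → 𝕜)}
  zero_mem' := by
    intro φ hφ
    have h : ∀ (u : Lp 𝕜 2 (volume : Measure (Torus L))) (χ : Torus L → 𝕜), u = 0 →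
        ∫ x, u x * χ x = 0 := by
      intro u χ hu
      refine integral_eq_zero_of_ae ?_
      filter_upwards [(Lp.eq_zero_iff_ae_eq_zero).1 hu] with x hx
      rw [hx, Pi.zero_apply, zero_mul]
    exact (h _ _ rfl).trans ((congrArg Neg.neg (h _ φ rfl)).trans neg_zero).symm
  add_mem' := by
    intro a b ha hb φ hφ
    have h : ∀ (u v : Lp 𝕜 2 (volume : Measure (Torus L))) (χ : Torus L → 𝕜), IsSmooth χ →
        ∫ x, (u + v : Lp 𝕜 2 (volume : Measure (Torus L))) x * χ x
          = (∫ x, u x * χ x) + ∫ x, v x * χ x := by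
      intro u v χ hχ
      rw [← integral_add (integrable_mul_smooth u hχ) (integrable_mul_smooth v hχ)]
      refine integral_congr_ae ?_
      filter_upwards [Lp.coeFn_add u v] with x hx
      rw [hx, Pi.add_apply, add_mul]
    refine (h a.fst b.fst _ hφ.deriv_smooth).trans ?_
    refine Eq.trans ?_ (congrArg Neg.neg (h a.snd b.snd _ hφ)).symm
    rw [ha φ hφ, hb φ hφ, neg_add]
  smul_mem' := by
    intro c a ha φ hφ
    have h : ∀ (u : Lp 𝕜 2 (volume : Measure (Torus L))) (χ : Torus L → 𝕜),
        ∫ x, (c • u : Lp 𝕜 2 (volume : Measure (Torus L))) x * χ x = c * ∫ x, u x * χ x := by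
      intro u χ
      rw [← integral_const_mul]
      refine integral_congr_ae ?_
      filter_upwards [Lp.coeFn_smul c u] with x hx
      rw [hx, Pi.smul_apply, smul_eq_mul, mul_assoc]
    refine (h a.fst _).trans ?_
    refine Eq.trans ?_ (congrArg Neg.neg (h a.snd _)).symm
    rw [ha φ hφ, mul_neg]

/-- The function underlying an element of `H¹`, defined almost everywhere. -/
def fn {L : ℝ} [Fact (0 < L)] {𝕜 : Type} [RCLike 𝕜] (u : H1 L 𝕜) : Torus L → 𝕜 :=
  (u : WithLp 2 (Lp 𝕜 2 (volume : Measure (Torus L)) ×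
    Lp 𝕜 2 (volume : Measure (Torus L)))).fst

/-- The weak derivative `∂ₓ u` of an element of `H¹`. -/
def weakDx {L : ℝ} [Fact (0 < L)] {𝕜 : Type} [RCLike 𝕜] (u : H1 L 𝕜) : Torus L → 𝕜 :=
  (u : WithLp 2 (Lp 𝕜 2 (volume : Measure (Torus L)) ×
    Lp 𝕜 2 (volume : Measure (Torus L)))).snd

/-- The physical parameters of the model. -/
structure Params where
  g : ℝ
  lam : ℝ
  α : ℝ
  β : ℝ
  R : ℝ
  P : ℝ
  ε : ℝ
  g_pos : 0 < g
  lam_pos : 0 < lam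
  α_pos : 0 < α
  β_pos : 0 < β
  R_pos : 0 < R
  P_pos : 0 < P
  ε_pos : 0 < ε
  ε_le_one : ε ≤ 1

/-- `(ψ, n) ∈ C([0,∞); H¹ ⊕ H¹)` is a global solution, with initial data `(ψ₀, n₀)`, of
`i ∂ₜψ = -½ ∂ₓ²ψ + g|ψ|²ψ + λ n ψ + (i/2)(R n - α)ψ`,
`ε ∂ₜn = P - (R|ψ|² + β) n`.
The values at negative times are irrelevant. Both equations hold at every time `t ≥ 0` in the
sense of distributions on the torus: for every smooth `φ` the pairing with `φ` is differentiable
in time (one-sidedly at `t = 0`) and has the derivative that the equation prescribes. The term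
`-½ ∂ₓ²ψ` tested with `φ` is `½ ∫ ∂ₓψ ∂ₓφ`. -/
structure IsGlobalSolution {L : ℝ} [Fact (0 < L)] (p : Params) (ψ₀ : H1 L ℂ) (n₀ : H1 L ℝ)
    (ψ : ℝ → H1 L ℂ) (n : ℝ → H1 L ℝ) : Prop where
  continuousOn_ψ : ContinuousOn ψ (Ici 0)
  continuousOn_n : ContinuousOn n (Ici 0)
  initial_ψ : ψ 0 = ψ₀
  initial_n : n 0 = n₀
  eq_ψ : ∀ φ : Torus L → ℂ, IsSmooth φ → ∀ t : ℝ, 0 ≤ t →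
    HasDerivWithinAt (fun s : ℝ => Complex.I * ∫ x, fn (ψ s) x * φ x)
      ((1 / 2 : ℂ) * (∫ x, weakDx (ψ t) x * torusDeriv φ x)
        + ∫ x, ((p.g : ℂ) * (‖fn (ψ t) x‖ : ℂ) ^ 2 * fn (ψ t) x
            + (p.lam : ℂ) * ((fn (n t) x : ℝ) : ℂ) * fn (ψ t) x
            + Complex.I / 2 * ((p.R : ℂ) * ((fn (n t) x : ℝ) : ℂ) - (p.α : ℂ)) * fn (ψ t) x) * φ x)
      (Ici 0) t
  eq_n : ∀ φ : Torus L → ℝ, IsSmooth φ → ∀ t : ℝ, 0 ≤ t →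
    HasDerivWithinAt (fun s : ℝ => p.ε * ∫ x, fn (n s) x * φ x)
      (∫ x, (p.P - (p.R * ‖fn (ψ t) x‖ ^ 2 + p.β) * fn (n t) x) * φ x)
      (Ici 0) t

/-- The total mass `∫ |ψ|² + ε ∫ n`. -/
def totalMass {L : ℝ} [Fact (0 < L)] (p : Params) (ψ : H1 L ℂ) (n : H1 L ℝ) : ℝ :=
  (∫ x, ‖fn ψ x‖ ^ 2) + p.ε * ∫ x, fn n x

end Polariton

end

/-!
# Global well-posedness of a dissipative Gross–Pitaevskii/reservoir system on the torus

**Reduction to an ordinary differential equation.** The Fourier modes, once normalised, are a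
Hilbert basis of `H¹`, so the free group `exp (i t ∂ₓ² / 2)` (`schrod`) acts on `H¹` by unitary
diagonal maps. In the interaction picture, `ψ = exp (i t ∂ₓ² / 2) v`, the unbounded term disappears
and `(v, n)` solves an ordinary differential equation in `H¹(𝕋; ℂ) × H¹(𝕋; ℝ)` (`field`). Its right
side is Lipschitz on bounded sets, uniformly in time, because `H¹` of the torus is an algebra
(`mulH1`). Continuous curves that satisfy the system in the sense of distributions are the same as
solutions of this equation: in one direction the product rule is read in the dual of `H¹`
(`isGlobalSolution_of_solvesOn`), in the other it is enough to test with the Fourier modes, and a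
curve whose components are differentiable with the components of a continuous curve as derivatives
is itself differentiable (`solvesOn_of_isGlobalSolution`). Uniqueness follows from the one for
ordinary differential equations, and global existence from an a priori bound on each `[0, T]`
(`exists_solvesOn_Ici`).

**The a priori bound** (`exists_bound`). Pointwise in `x` the reservoir solves a scalar linear
equation, and comparison gives `0 ≤ n ≤ N` with `N = max (sup n₀) (P / β)` (`reservoir_bounds`).
The energy is `‖ψ‖² + ‖∂ₓψ‖² + g ∫ |ψ|⁴ + ‖∂ₓn‖²`. In its time derivative the contributions of the
self-interaction cancel; the products of `∂ₓn ψ` with `∂ₓψ`, which come from the coupling and from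
the reservoir equation, are absorbed by the damping `-(2R/ε) ∫ |ψ|² |∂ₓn|²`; what is left is at
most a multiple of the energy, and Grönwall's inequality applies. The squared norms are
differentiated in the interaction picture, where `v` is differentiable in `H¹` and the group is an
isometry. The quartic term is not invariant under the group and is differentiated through the dual
of `H¹`: its increments are the values of the increments of `ψ`, which is differentiable there, at
elements of `H¹` that depend continuously on time (`hasDerivWithinAt_quartic`).

**The mass** (`totalMass_bounds`). The stimulated terms `R n |ψ|²` cancel in
`M' = P L - α ∫ |ψ|² - β ∫ n`, and `n ≥ 0`, so `M' ≤ P L - min α (β / ε) M`, which keeps `M` below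
the larger of `M 0` and `P L / min α (β / ε)`.
-/

noncomputable section

namespace Polariton

/-! ### Smooth functions on the torus -/

section Smooth

variable {L : ℝ}

theorem IsSmooth.mul {𝕜 : Type} [RCLike 𝕜] {φ χ : Torus L → 𝕜} (hφ : IsSmooth φ) (hχ : IsSmooth χ) :
    IsSmooth (φ * χ) := ContDiff.mul hφ hχ

theorem torusDeriv_mul {𝕜 : Type} [RCLike 𝕜] {φ χ : Torus L → 𝕜} (hφ : IsSmooth φ)
    (hχ : IsSmooth χ) (x : Torus L) :
    torusDeriv (φ * χ) x = torusDeriv φ x * χ x + φ x * torusDeriv χ x := by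
  obtain ⟨s, rfl⟩ := QuotientAddGroup.mk_surjective x
  simp only [torusDeriv_coe]
  exact deriv_fun_mul (ContDiff.differentiable hφ (by simp)).differentiableAt
    (ContDiff.differentiable hχ (by simp)).differentiableAt

/-- The wave number of the `k`-th mode. -/
def wave (L : ℝ) (k : ℤ) : ℝ := 2 * Real.pi * k / L

theorem isSmooth_fourier (k : ℤ) : IsSmooth (fourier k : Torus L → ℂ) := by
  unfold IsSmooth
  simp only [fourier_coe_apply]
  refine ContDiff.cexp ?_
  exact ((contDiff_const.mul Complex.ofRealCLM.contDiff).div_const _)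

theorem torusDeriv_fourier (k : ℤ) (x : Torus L) :
    torusDeriv (fourier k : Torus L → ℂ) x = Complex.I * wave L k * fourier k x := by
  obtain ⟨s, rfl⟩ := QuotientAddGroup.mk_surjective x
  rw [torusDeriv_coe]
  refine (hasDerivAt_fourier L k s).deriv.trans ?_
  simp only [wave]
  push_cast
  congr 1
  ring

end Smooth

variable {L : ℝ} [Fact (0 < L)]

/-! ### The space `H¹` as a Hilbert space -/

/-- The space `L²` of the torus. -/
abbrev L2 (L : ℝ) [Fact (0 < L)] (𝕜 : Type) [RCLike 𝕜] : Type :=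
  Lp 𝕜 2 (volume : Measure (Torus L))

section Instances

variable (L : ℝ) [Fact (0 < L)] (𝕜 : Type) [RCLike 𝕜]

-- Shortcuts: they keep instance search from unfolding `Lp` and the submodule `H¹`.

instance L2.normedAddCommGroup : NormedAddCommGroup (L2 L 𝕜) := inferInstance
instance L2.innerProductSpace : InnerProductSpace 𝕜 (L2 L 𝕜) := inferInstance
instance L2.normedSpace : NormedSpace 𝕜 (L2 L 𝕜) := InnerProductSpace.toNormedSpace
instance L2.addCommGroup : AddCommGroup (L2 L 𝕜) := NormedAddCommGroup.toAddCommGroup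
instance L2.module : Module 𝕜 (L2 L 𝕜) := NormedSpace.toModule
instance L2.topologicalSpace : TopologicalSpace (L2 L 𝕜) := UniformSpace.toTopologicalSpace
instance H1.normedAddCommGroup : NormedAddCommGroup (H1 L 𝕜) := inferInstance
instance H1.seminormedAddCommGroup : SeminormedAddCommGroup (H1 L 𝕜) :=
  NormedAddCommGroup.toSeminormedAddCommGroup
instance H1.innerProductSpace : InnerProductSpace 𝕜 (H1 L 𝕜) := inferInstance
instance H1.normedSpace : NormedSpace 𝕜 (H1 L 𝕜) := InnerProductSpace.toNormedSpace
instance H1.normedSpaceReal : NormedSpace ℝ (H1 L 𝕜) := inferInstance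
instance H1.addCommGroup : AddCommGroup (H1 L 𝕜) := NormedAddCommGroup.toAddCommGroup
instance H1.addCommMonoid : AddCommMonoid (H1 L 𝕜) := AddCommGroup.toAddCommMonoid
instance H1.module : Module 𝕜 (H1 L 𝕜) := NormedSpace.toModule
instance H1.moduleReal : Module ℝ (H1 L ℂ) := NormedSpace.toModule
instance H1.uniformSpace : UniformSpace (H1 L 𝕜) := PseudoMetricSpace.toUniformSpace
instance H1.topologicalSpace : TopologicalSpace (H1 L 𝕜) := UniformSpace.toTopologicalSpace
instance H1.continuousSMulReal : ContinuousSMul ℝ (H1 L 𝕜) := IsBoundedSMul.continuousSMul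

end Instances

/-- The bilinear pairing `(u, v) ↦ ∫ u v` of `L²`, without conjugation. -/
def pair (L : ℝ) [Fact (0 < L)] (𝕜 : Type) [RCLike 𝕜] : L2 L 𝕜 →L[𝕜] L2 L 𝕜 →L[𝕜] 𝕜 :=
  (ContinuousLinearMap.mul 𝕜 𝕜).lpPairing volume 2 2

/-- The inclusion of the continuous functions in `L²`. -/
abbrev toL2 (L : ℝ) [Fact (0 < L)] (𝕜 : Type) [RCLike 𝕜] : C(Torus L, 𝕜) →L[𝕜] L2 L 𝕜 :=
  ContinuousMap.toLp 2 volume 𝕜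

/-- The function part `H¹ → L²`. -/
def fstL (L : ℝ) [Fact (0 < L)] (𝕜 : Type) [RCLike 𝕜] : H1 L 𝕜 →L[𝕜] L2 L 𝕜 :=
  (WithLp.fstL 2 𝕜 _ _).comp (H1 L 𝕜).subtypeL

/-- The weak derivative `H¹ → L²`. -/
def sndL (L : ℝ) [Fact (0 < L)] (𝕜 : Type) [RCLike 𝕜] : H1 L 𝕜 →L[𝕜] L2 L 𝕜 :=
  (WithLp.sndL 2 𝕜 _ _).comp (H1 L 𝕜).subtypeL

section RCLike

variable {𝕜 : Type} [RCLike 𝕜]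

theorem pair_apply (u v : L2 L 𝕜) : pair L 𝕜 u v = ∫ x, u x * v x := by
  rw [pair, ContinuousLinearMap.lpPairing_eq_integral]
  rfl

theorem coeFn_fstL (u : H1 L 𝕜) : (fstL L 𝕜 u : Torus L → 𝕜) = fn u := rfl

theorem coeFn_sndL (u : H1 L 𝕜) : (sndL L 𝕜 u : Torus L → 𝕜) = weakDx u := rfl

theorem pair_toL2 (u : L2 L 𝕜) {φ : Torus L → 𝕜} (hφ : Continuous φ) :
    pair L 𝕜 u (toL2 L 𝕜 ⟨φ, hφ⟩) = ∫ x, u x * φ x := by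
  rw [pair_apply]
  refine integral_congr_ae ?_
  filter_upwards [ContinuousMap.coeFn_toLp (p := 2) (μ := volume) (𝕜 := 𝕜)
    (⟨φ, hφ⟩ : C(Torus L, 𝕜))] with x hx
  rw [hx]
  rfl

theorem pair_comm (u v : L2 L 𝕜) : pair L 𝕜 u v = pair L 𝕜 v u := by
  rw [pair_apply, pair_apply]
  simp_rw [mul_comm]

theorem hasWeakDeriv_iff (u v : L2 L 𝕜) :
    HasWeakDeriv (u : Torus L → 𝕜) v ↔ ∀ φ : Torus L → 𝕜, ∀ hφ : IsSmooth φ,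
      pair L 𝕜 u (toL2 L 𝕜 ⟨_, hφ.deriv_smooth.continuous⟩)
        = - pair L 𝕜 v (toL2 L 𝕜 ⟨φ, hφ.continuous⟩) := by
  simp only [pair_toL2]
  rfl

theorem isClosed_H1 : IsClosed ((H1 L 𝕜 : Set (WithLp 2 (L2 L 𝕜 × L2 L 𝕜)))) := by
  have : (H1 L 𝕜 : Set (WithLp 2 (L2 L 𝕜 × L2 L 𝕜))) =
      ⋂ (φ : Torus L → 𝕜) (hφ : IsSmooth φ), {w |
      pair L 𝕜 (WithLp.fstL 2 𝕜 _ _ w) (toL2 L 𝕜 ⟨_, hφ.deriv_smooth.continuous⟩)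
        = - pair L 𝕜 (WithLp.sndL 2 𝕜 _ _ w) (toL2 L 𝕜 ⟨φ, hφ.continuous⟩)} := by
    ext w
    simp only [mem_iInter, mem_ofPred_eq]
    exact hasWeakDeriv_iff w.fst w.snd
  rw [this]
  refine isClosed_iInter fun φ => isClosed_iInter fun hφ => isClosed_eq ?_ ?_ <;> fun_prop

instance : CompleteSpace (H1 L 𝕜) := isClosed_H1.completeSpace_coe

theorem H1_ext {u v : H1 L 𝕜} (h₁ : fstL L 𝕜 u = fstL L 𝕜 v) (h₂ : sndL L 𝕜 u = sndL L 𝕜 v) :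
    u = v := by
  apply Subtype.ext
  apply (WithLp.prodContinuousLinearEquiv 2 𝕜 (L2 L 𝕜) (L2 L 𝕜)).injective
  exact Prod.ext h₁ h₂

/-- An element of `H¹` from a pair of `L²` functions. -/
def mkH1 (u v : L2 L 𝕜) (h : HasWeakDeriv (u : Torus L → 𝕜) v) : H1 L 𝕜 :=
  ⟨WithLp.toLp 2 (u, v), h⟩

@[simp] theorem fstL_mkH1 (u v : L2 L 𝕜) (h : HasWeakDeriv (u : Torus L → 𝕜) v) :
    fstL L 𝕜 (mkH1 u v h) = u := rfl

@[simp] theorem sndL_mkH1 (u v : L2 L 𝕜) (h : HasWeakDeriv (u : Torus L → 𝕜) v) :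
    sndL L 𝕜 (mkH1 u v h) = v := rfl

theorem H1_inner (u v : H1 L 𝕜) :
    inner 𝕜 u v = inner 𝕜 (fstL L 𝕜 u) (fstL L 𝕜 v) + inner 𝕜 (sndL L 𝕜 u) (sndL L 𝕜 v) :=
  WithLp.prod_inner_apply _ _

theorem H1_norm_sq (u : H1 L 𝕜) : ‖u‖ ^ 2 = ‖fstL L 𝕜 u‖ ^ 2 + ‖sndL L 𝕜 u‖ ^ 2 :=
  WithLp.prod_norm_sq_eq_of_L2 _

theorem pair_sndL (u : H1 L 𝕜) {φ : Torus L → 𝕜} (hφ : IsSmooth φ) :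
    pair L 𝕜 (sndL L 𝕜 u) (toL2 L 𝕜 ⟨φ, hφ.continuous⟩) =
      - pair L 𝕜 (fstL L 𝕜 u) (toL2 L 𝕜 ⟨_, hφ.deriv_smooth.continuous⟩) := by
  exact neg_eq_iff_eq_neg.1 ((hasWeakDeriv_iff (fstL L 𝕜 u) (sndL L 𝕜 u)).1 u.2 φ hφ).symm

theorem integral_torusDeriv {φ : Torus L → 𝕜} (hφ : IsSmooth φ) : ∫ x, torusDeriv φ x = 0 := by
  rw [← AddCircle.intervalIntegral_preimage L 0]
  simp_rw [torusDeriv_coe]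
  rw [intervalIntegral.integral_deriv_eq_sub' _ rfl]
  · have h : ((0 + L : ℝ) : Torus L) = ((0 : ℝ) : Torus L) := by
      rw [zero_add, AddCircle.coe_period, AddCircle.coe_zero]
    exact sub_eq_zero.2 (congrArg φ h)
  · intro x _
    exact (ContDiff.differentiable hφ (by simp)).differentiableAt
  · exact (ContDiff.continuous_deriv hφ (by simp)).continuousOn

theorem integrable_continuous {E : Type} [NormedAddCommGroup E] [NormedSpace ℝ E]
    {φ : Torus L → E}
    (h : Continuous φ) : Integrable φ :=
  (ContinuousMap.mk φ h).memLp (p := 1) (μ := volume) ℝ |>.integrable le_rfl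

theorem hasWeakDeriv_of_isSmooth {φ : Torus L → 𝕜} (hφ : IsSmooth φ) :
    HasWeakDeriv (toL2 L 𝕜 ⟨φ, hφ.continuous⟩ : Torus L → 𝕜)
      (toL2 L 𝕜 ⟨_, hφ.deriv_smooth.continuous⟩) := by
  rw [hasWeakDeriv_iff]
  intro χ hχ
  rw [pair_comm, pair_comm _ (toL2 L 𝕜 ⟨χ, _⟩), pair_toL2, pair_toL2, eq_neg_iff_add_eq_zero]
  have h1 := integral_torusDeriv (hφ.mul hχ)
  simp_rw [torusDeriv_mul hφ hχ] at h1
  rw [integral_add] at h1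
  rotate_left
  · exact integrable_continuous (hφ.deriv_smooth.continuous.mul hχ.continuous)
  · exact integrable_continuous (hφ.continuous.mul hχ.deriv_smooth.continuous)
  rw [← h1, add_comm]
  congr 1
  · refine integral_congr_ae ?_
    filter_upwards [ContinuousMap.coeFn_toLp (p := 2) (μ := volume) (𝕜 := 𝕜)
      (⟨χ, hχ.continuous⟩ : C(Torus L, 𝕜))] with x hx
    rw [hx]
    exact mul_comm _ _
  · refine integral_congr_ae ?_
    filter_upwards [ContinuousMap.coeFn_toLp (p := 2) (μ := volume) (𝕜 := 𝕜)
      (⟨_, hχ.deriv_smooth.continuous⟩ : C(Torus L, 𝕜))] with x hx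
    rw [hx]
    exact mul_comm _ _

/-- A smooth function as an element of `H¹`. -/
def ofSmooth {φ : Torus L → 𝕜} (hφ : IsSmooth φ) : H1 L 𝕜 :=
  mkH1 _ _ (hasWeakDeriv_of_isSmooth hφ)

end RCLike

/-! ### Fourier modes -/

theorem toL2_torusDeriv_fourier (k : ℤ) :
    toL2 L ℂ ⟨_, (isSmooth_fourier (L := L) k).deriv_smooth.continuous⟩ =
      (Complex.I * wave L k) • toL2 L ℂ (fourier k) := by
  rw [← map_smul]
  congr 1
  ext x
  exact torusDeriv_fourier k x

theorem integral_fourier (k : ℤ) : ∫ x : Torus L, fourier k x = if k = 0 then (L : ℂ) else 0 := by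
  have hL : (0 : ℝ) < L := Fact.out
  split_ifs with h
  · subst h
    simp [measureReal_def, hL.le]
  · have h1 := integral_torusDeriv (isSmooth_fourier (L := L) k)
    simp_rw [torusDeriv_fourier] at h1
    rw [integral_const_mul] at h1
    refine (mul_eq_zero.1 h1).resolve_left ?_
    have : wave L k ≠ 0 := by
      unfold wave
      have := Real.pi_pos.ne'
      have : (k : ℝ) ≠ 0 := by exact_mod_cast h
      positivity
    simp [this]

theorem inner_toL2_fourier (k j : ℤ) :
    inner ℂ (toL2 L ℂ (fourier k)) (toL2 L ℂ (fourier j)) = if k = j then (L : ℂ) else 0 := by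
  rw [ContinuousMap.inner_toLp]
  have : ∀ x : Torus L, fourier j x * (starRingEnd ℂ) (fourier k x) = fourier (j - k) x := by
    intro x
    rw [sub_eq_add_neg, fourier_add, fourier_neg]
  simp_rw [this, integral_fourier, sub_eq_zero, eq_comm]

/-- A square integrable function all of whose Fourier coefficients vanish is zero. -/
theorem eq_zero_of_inner_fourier (u : L2 L ℂ)
    (h : ∀ k : ℤ, inner ℂ (toL2 L ℂ (fourier k)) u = 0) : u = 0 := by
  -- trigonometric polynomials are dense in `C(𝕋)`, and `C(𝕋)` is dense in `L²`
  have h1 : ∀ f : C(Torus L, ℂ), inner ℂ (toL2 L ℂ f) u = 0 := by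
    intro f
    have hf : f ∈ (Submodule.span ℂ (range (fourier (T := L)))).topologicalClosure := by
      rw [span_fourier_closure_eq_top]; trivial
    refine closure_minimal (t := {f : C(Torus L, ℂ) | inner ℂ (toL2 L ℂ f) u = 0}) ?_ ?_ hf
    · intro f hf
      induction hf using Submodule.span_induction with
      | mem f hf => obtain ⟨k, rfl⟩ := hf; exact h k
      | zero => simp
      | add f g _ _ hf hg =>
        simp only [mem_ofPred_eq, map_add, inner_add_left] at *
        rw [hf, hg, add_zero]
      | smul c f _ hf =>
        simp only [mem_ofPred_eq, map_smul, inner_smul_left] at *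
        rw [hf, mul_zero]
    · exact isClosed_eq (by fun_prop) continuous_const
  have h2 : ∀ w : L2 L ℂ, inner ℂ w u = 0 := by
    intro w
    have := (ContinuousMap.toLp_denseRange (p := 2) ℂ (volume : Measure (Torus L)) ℂ (by simp)) w
    refine closure_minimal (t := {w : L2 L ℂ | inner ℂ w u = 0}) ?_ ?_ this
    · rintro _ ⟨f, rfl⟩
      exact h1 f
    · exact isClosed_eq (by fun_prop) continuous_const
  exact inner_self_eq_zero.1 (h2 u)

/-- The Fourier mode `x ↦ exp (2πikx/L)` as an element of `H¹`. -/
def mode (L : ℝ) [Fact (0 < L)] (k : ℤ) : H1 L ℂ := ofSmooth (isSmooth_fourier k)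

theorem fstL_mode (k : ℤ) : fstL L ℂ (mode L k) = toL2 L ℂ (fourier k) := rfl

theorem sndL_mode (k : ℤ) :
    sndL L ℂ (mode L k) = (Complex.I * wave L k) • toL2 L ℂ (fourier k) :=
  toL2_torusDeriv_fourier k

theorem inner_fourier_eq_pair (w : L2 L ℂ) (k : ℤ) :
    inner ℂ (toL2 L ℂ (fourier k)) w = pair L ℂ w (toL2 L ℂ (fourier (-k))) := by
  rw [L2.inner_def]
  refine Eq.trans ?_ (pair_toL2 w (fourier (-k)).continuous).symm
  refine integral_congr_ae ?_
  filter_upwards [ContinuousMap.coeFn_toLp (p := 2) (μ := volume) (𝕜 := ℂ)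
    (fourier k : C(Torus L, ℂ))] with x hx
  rw [hx, RCLike.inner_apply, fourier_neg]

/-- The Fourier coefficients of the derivative. -/
theorem inner_fourier_sndL (u : H1 L ℂ) (k : ℤ) :
    inner ℂ (toL2 L ℂ (fourier k)) (sndL L ℂ u) =
      Complex.I * wave L k * inner ℂ (toL2 L ℂ (fourier k)) (fstL L ℂ u) := by
  have h := pair_sndL u (isSmooth_fourier (L := L) (-k))
  rw [toL2_torusDeriv_fourier, map_smul] at h
  rw [inner_fourier_eq_pair, inner_fourier_eq_pair]
  refine h.trans ?_
  simp [wave]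
  ring

theorem inner_mode (u : H1 L ℂ) (k : ℤ) :
    inner ℂ (mode L k) u =
      (1 + wave L k ^ 2 : ℝ) * inner ℂ (toL2 L ℂ (fourier k)) (fstL L ℂ u) := by
  rw [H1_inner, fstL_mode, sndL_mode, inner_smul_left, inner_fourier_sndL]
  simp only [map_mul, Complex.conj_I, Complex.conj_ofReal]
  push_cast
  linear_combination (-(wave L k : ℂ) ^ 2 * inner ℂ (toL2 L ℂ (fourier k)) (fstL L ℂ u)) *
    Complex.I_sq

/-- The norm of the `k`-th mode in `H¹`. -/
def modeNorm (L : ℝ) (k : ℤ) : ℝ := Real.sqrt (L * (1 + wave L k ^ 2))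

theorem modeNorm_pos (k : ℤ) : 0 < modeNorm L k := by
  have hL : (0 : ℝ) < L := Fact.out
  unfold modeNorm
  positivity

theorem modeNorm_sq (k : ℤ) : modeNorm L k ^ 2 = L * (1 + wave L k ^ 2) := by
  have hL : (0 : ℝ) < L := Fact.out
  exact Real.sq_sqrt (by positivity)

theorem inner_mode_mode (k j : ℤ) :
    inner ℂ (mode L k) (mode L j) = if k = j then ((modeNorm L k ^ 2 : ℝ) : ℂ) else 0 := by
  rw [inner_mode, fstL_mode, inner_toL2_fourier, modeNorm_sq]
  split_ifs <;> simp [mul_comm]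

/-- For unimodular factors `c`, the modes `c k • mode k`, once normalised, are orthonormal. The
factors allow the free group to be defined as a change of basis. -/
theorem orthonormal_modes (c : ℤ → ℂ) (hc : ∀ k, ‖c k‖ = 1) :
    Orthonormal ℂ (fun k => (c k / modeNorm L k) • mode L k) := by
  rw [orthonormal_iff_ite]
  intro k j
  rw [inner_smul_left (mode L k), inner_smul_right (mode L k) (mode L j), inner_mode_mode]
  split_ifs with h
  · subst h
    have h1 : (starRingEnd ℂ) (c k) * c k = 1 := by
      rw [Complex.conj_mul', hc]; simp
    have h2 : (modeNorm L k : ℂ) ≠ 0 := by exact_mod_cast (modeNorm_pos k).ne'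
    simp only [map_div₀, Complex.conj_ofReal]
    push_cast
    field_simp
    linear_combination h1
  · simp

theorem eq_zero_of_inner_mode (u : H1 L ℂ) (h : ∀ k : ℤ, inner ℂ (mode L k) u = 0) : u = 0 := by
  have h0 : ∀ k : ℤ, inner ℂ (toL2 L ℂ (fourier k)) (fstL L ℂ u) = 0 := by
    intro k
    have := h k
    rw [inner_mode] at this
    refine (mul_eq_zero.1 this).resolve_left ?_
    exact_mod_cast (by positivity : (0 : ℝ) < 1 + wave L k ^ 2).ne'
  refine H1_ext ?_ ?_
  · rw [map_zero]
    exact eq_zero_of_inner_fourier _ h0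
  · rw [map_zero]
    refine eq_zero_of_inner_fourier _ fun k => ?_
    rw [inner_fourier_sndL, h0, mul_zero]

/-- The Hilbert basis of `H¹` made of the normalised Fourier modes with phases `c`. -/
def modeBasis (L : ℝ) [Fact (0 < L)] (c : ℤ → ℂ) (hc : ∀ k, ‖c k‖ = 1) :
    HilbertBasis ℤ ℂ (H1 L ℂ) :=
  HilbertBasis.mkOfOrthogonalEqBot (orthonormal_modes c hc) <| by
    rw [Submodule.eq_bot_iff]
    intro u hu
    refine eq_zero_of_inner_mode u fun k => ?_
    have h1 := (Submodule.mem_orthogonal _ _).1 hu _ (Submodule.subset_span ⟨k, rfl⟩)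
    rw [inner_smul_left (mode L k)] at h1
    refine (mul_eq_zero.1 h1).resolve_left ?_
    have : (modeNorm L k : ℂ) ≠ 0 := by exact_mod_cast (modeNorm_pos k).ne'
    have h2 : c k ≠ 0 := by
      intro h; have := hc k; simp [h] at this
    simp [this, h2]

theorem modeBasis_apply (c : ℤ → ℂ) (hc : ∀ k, ‖c k‖ = 1) (k : ℤ) :
    modeBasis L c hc k = (c k / modeNorm L k) • mode L k := by
  rw [modeBasis, HilbertBasis.coe_mkOfOrthogonalEqBot]

/-- Induction on the density of trigonometric polynomials in `H¹`. -/
theorem modes_induction {p : H1 L ℂ → Prop} (hmode : ∀ k, p (mode L k))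
    (hadd : ∀ u v, p u → p v → p (u + v)) (hsmul : ∀ (c : ℂ) u, p u → p (c • u))
    (hclosed : IsClosed {u | p u}) (u : H1 L ℂ) : p u := by
  have hu : u ∈ (Submodule.span ℂ (range (modeBasis L (fun _ => 1)
      fun _ => norm_one))).topologicalClosure := by
    rw [HilbertBasis.dense_span]; trivial
  refine closure_minimal (t := {u | p u}) ?_ hclosed hu
  intro f hf
  induction hf using Submodule.span_induction with
  | mem f hf =>
    obtain ⟨k, rfl⟩ := hf
    rw [modeBasis_apply]
    exact hsmul _ _ (hmode k)
  | zero => simpa using hsmul 0 _ (hmode 0)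
  | add f g _ _ hf hg => exact hadd _ _ hf hg
  | smul c f _ hf => exact hsmul _ _ hf

theorem clm_ext_mode {E : Type*} [NormedAddCommGroup E] [NormedSpace ℂ E]
    {S T : H1 L ℂ →L[ℂ] E} (h : ∀ k, S (mode L k) = T (mode L k)) : S = T := by
  ext1 u
  refine modes_induction (p := fun u => S u = T u) h ?_ ?_ ?_ u
  · intro u v hu hv
    rw [map_add, map_add, hu, hv]
  · intro c u hu
    rw [map_smul, map_smul, hu]
  · exact isClosed_eq S.continuous T.continuous

end Polariton

namespace Polariton

variable {L : ℝ} [Fact (0 < L)]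

/-! ### The continuous representative -/

theorem summable_inv_modeNorm_sq : Summable fun k : ℤ => ((modeNorm L k)⁻¹) ^ 2 := by
  have hL : (0 : ℝ) < L := Fact.out
  have h1 : Summable fun k : ℤ => L / (2 * Real.pi) ^ 2 * (1 / (k : ℝ) ^ 2) :=
    (Real.summable_one_div_int_pow.2 one_lt_two).mul_left _
  refine Summable.of_norm_bounded_eventually h1 ?_
  have h2 : ∀ᶠ k : ℤ in Filter.cofinite, k ≠ 0 := by
    rw [Filter.eventually_cofinite]
    exact (finite_singleton 0).subset fun k hk => not_not.1 hk
  filter_upwards [h2] with k hk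
  have hk' : 0 < (k : ℝ) ^ 2 := by positivity
  have hp := Real.pi_pos
  rw [inv_pow, modeNorm_sq, Real.norm_of_nonneg (by positivity), div_mul_div_comm, mul_one,
    inv_eq_one_div, div_le_div_iff₀ (by positivity) (by positivity)]
  have : L * (L * (1 + wave L k ^ 2)) = L ^ 2 + (2 * Real.pi) ^ 2 * k ^ 2 := by
    unfold wave; field_simp
  rw [this]
  nlinarith [sq_nonneg L]

/-- A bounded linear map on a Hilbert space may be prescribed on a Hilbert basis, if the values are
square summable. -/
theorem exists_clm_hilbertBasis {ι H E : Type*} [Countable ι] [NormedAddCommGroup H]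
    [InnerProductSpace ℂ H] [CompleteSpace H] [NormedAddCommGroup E] [NormedSpace ℂ E]
    [CompleteSpace E] (b : HilbertBasis ι ℂ H) (F : ι → E) (hF : Summable fun k => ‖F k‖ ^ 2) :
    ∃ T : H →L[ℂ] E, ∀ k, T (b k) = F k := by
  classical
  have hsum : ∀ u : H, Summable fun k => b.repr u k • F k := by
    intro u
    refine Summable.of_norm ?_
    have h1 : Summable fun k => ‖b.repr u k‖ ^ 2 := by
      have := (lp.memℓp (b.repr u)).summable (by simp)
      simpa using this
    refine Summable.of_nonneg_of_le (fun k => norm_nonneg _) (fun k => ?_) (h1.add hF)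
    rw [norm_smul]
    nlinarith [sq_nonneg (‖b.repr u k‖ - ‖F k‖), sq_nonneg (‖b.repr u k‖ + ‖F k‖)]
  let g : Finset ι → H →L[ℂ] E := fun s => ∑ k ∈ s, (innerSL ℂ (b k)).smulRight (F k)
  have hg : Filter.Tendsto (fun s u => g s u) Filter.atTop
      (nhds fun u => ∑' k, b.repr u k • F k) := by
    rw [tendsto_pi_nhds]
    intro u
    refine (hsum u).hasSum.congr fun s => ?_
    simp only [g, sum_apply, ContinuousLinearMap.smulRight_apply,
      innerSL_apply_apply, HilbertBasis.repr_apply_apply]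
  refine ⟨continuousLinearMapOfTendsto g hg, fun k => ?_⟩
  change (∑' j, b.repr (b k) j • F j) = F k
  rw [tsum_eq_single k]
  · rw [HilbertBasis.repr_self, lp.single_apply_self, one_smul]
  · intro j hj
    rw [HilbertBasis.repr_self, lp.single_apply_ne _ _ _ hj, zero_smul]

/-- The embedding of `H¹` in the continuous functions: the norms of the modes in `H¹` are bounded
below by multiples of the frequency, so their inverses are square summable. -/
theorem exists_rep (L : ℝ) [Fact (0 < L)] :
    ∃ T : H1 L ℂ →L[ℂ] C(Torus L, ℂ), ∀ k, T (mode L k) = fourier k := by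
  obtain ⟨T, hT⟩ := exists_clm_hilbertBasis (modeBasis L (fun _ => 1) fun _ => norm_one)
    (fun k => ((modeNorm L k : ℂ)⁻¹) • (fourier k : C(Torus L, ℂ))) <| by
    refine (summable_inv_modeNorm_sq (L := L)).congr fun k => ?_
    rw [norm_smul, fourier_norm, mul_one, norm_inv, Complex.norm_real,
      Real.norm_of_nonneg (modeNorm_pos k).le]
  refine ⟨T, fun k => ?_⟩
  have hk : (modeNorm L k : ℂ) ≠ 0 := by exact_mod_cast (modeNorm_pos k).ne'
  have h := hT k
  rw [modeBasis_apply, map_smul, one_div] at h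
  exact (smul_right_injective _ (inv_ne_zero hk)) h

/-- The continuous representative of an element of `H¹`. -/
def rep (L : ℝ) [Fact (0 < L)] : H1 L ℂ →L[ℂ] C(Torus L, ℂ) := (exists_rep L).choose

theorem rep_mode (k : ℤ) : rep L (mode L k) = fourier k := (exists_rep L).choose_spec k

theorem toL2_rep (u : H1 L ℂ) : toL2 L ℂ (rep L u) = fstL L ℂ u := by
  have : (toL2 L ℂ).comp (rep L) = fstL L ℂ := clm_ext_mode fun k => by
    simp only [ContinuousLinearMap.comp_apply, rep_mode, fstL_mode]
  exact DFunLike.congr_fun this u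

theorem fn_ae (u : H1 L ℂ) : fn u =ᵐ[volume] rep L u := by
  rw [← coeFn_fstL, ← toL2_rep]
  exact ContinuousMap.coeFn_toLp _ _

/-! ### Products -/

/-- The product of a continuous and a square integrable function. -/
def mulL2 (L : ℝ) [Fact (0 < L)] : C(Torus L, ℂ) →L[ℂ] L2 L ℂ →L[ℂ] L2 L ℂ :=
  ((ContinuousLinearMap.mul ℂ ℂ).holderL volume ∞ 2 2).comp (ContinuousMap.toLp ∞ volume ℂ)

theorem coeFn_mulL2 (f : C(Torus L, ℂ)) (u : L2 L ℂ) :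
    mulL2 L f u =ᵐ[volume] fun x => f x * u x := by
  have h1 := (ContinuousLinearMap.mul ℂ ℂ).coeFn_holder (r := 2)
    (ContinuousMap.toLp ∞ (volume : Measure (Torus L)) ℂ f) u
  filter_upwards [h1, ContinuousMap.coeFn_toLp (p := ∞) (μ := volume) (𝕜 := ℂ) f] with x h1 h2
  rw [← h2]
  exact h1

theorem mulL2_toL2 (f g : C(Torus L, ℂ)) : mulL2 L f (toL2 L ℂ g) = toL2 L ℂ (f * g) := by
  refine Lp.ext ?_
  filter_upwards [coeFn_mulL2 f (toL2 L ℂ g), ContinuousMap.coeFn_toLp (p := 2) (μ := volume)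
    (𝕜 := ℂ) g, ContinuousMap.coeFn_toLp (p := 2) (μ := volume) (𝕜 := ℂ) (f * g)] with x h1 h2 h3
  rw [h1, h2, h3]
  rfl

/-- The function part of a product of elements of `H¹`. -/
def mulFst (L : ℝ) [Fact (0 < L)] : H1 L ℂ →L[ℂ] H1 L ℂ →L[ℂ] L2 L ℂ :=
  (mulL2 L).bilinearComp (rep L) (fstL L ℂ)

/-- The weak derivative of a product of elements of `H¹`, by the Leibniz rule. -/
def mulSnd (L : ℝ) [Fact (0 < L)] : H1 L ℂ →L[ℂ] H1 L ℂ →L[ℂ] L2 L ℂ :=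
  (mulL2 L).bilinearComp (rep L) (sndL L ℂ) + ((mulL2 L).bilinearComp (rep L) (sndL L ℂ)).flip

theorem mulFst_apply (u v : H1 L ℂ) : mulFst L u v = mulL2 L (rep L u) (fstL L ℂ v) := rfl

theorem mulSnd_apply (u v : H1 L ℂ) :
    mulSnd L u v = mulL2 L (rep L u) (sndL L ℂ v) + mulL2 L (rep L v) (sndL L ℂ u) := rfl

theorem isClosed_hasWeakDeriv {X : Type*} [TopologicalSpace X] {f g : X → L2 L ℂ}
    (hf : Continuous f) (hg : Continuous g) :
    IsClosed {x | HasWeakDeriv (f x : Torus L → ℂ) (g x)} :=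
  isClosed_H1.preimage
    ((WithLp.prodContinuousLinearEquiv 2 ℂ (L2 L ℂ) (L2 L ℂ)).symm.continuous.comp (hf.prodMk hg))

theorem HasWeakDeriv.add {u₁ v₁ u₂ v₂ : L2 L ℂ} (h₁ : HasWeakDeriv (u₁ : Torus L → ℂ) v₁)
    (h₂ : HasWeakDeriv (u₂ : Torus L → ℂ) v₂) :
    HasWeakDeriv ((u₁ + u₂ : L2 L ℂ) : Torus L → ℂ) ((v₁ + v₂ : L2 L ℂ)) :=
  (H1 L ℂ).add_mem (x := WithLp.toLp 2 (u₁, v₁)) (y := WithLp.toLp 2 (u₂, v₂)) h₁ h₂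

theorem HasWeakDeriv.smul (c : ℂ) {u v : L2 L ℂ} (h : HasWeakDeriv (u : Torus L → ℂ) v) :
    HasWeakDeriv ((c • u : L2 L ℂ) : Torus L → ℂ) ((c • v : L2 L ℂ)) :=
  (H1 L ℂ).smul_mem c (x := WithLp.toLp 2 (u, v)) h

/-- The Leibniz rule: it holds for the modes, hence everywhere by density. -/
theorem hasWeakDeriv_mul (u v : H1 L ℂ) :
    HasWeakDeriv (mulFst L u v : Torus L → ℂ) (mulSnd L u v) := by
  refine modes_induction (p := fun u => ∀ v,
    HasWeakDeriv (mulFst L u v : Torus L → ℂ) (mulSnd L u v)) ?_ ?_ ?_ ?_ u v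
  · intro k v
    refine modes_induction (p := fun v =>
      HasWeakDeriv (mulFst L (mode L k) v : Torus L → ℂ) (mulSnd L (mode L k) v)) ?_ ?_ ?_ ?_ v
    · intro j
      have h1 : mulFst L (mode L k) (mode L j) = fstL L ℂ (mode L (k + j)) := by
        rw [mulFst_apply, rep_mode, fstL_mode, fstL_mode, mulL2_toL2]
        congr 1
        ext x
        exact fourier_add.symm
      have h2 : mulSnd L (mode L k) (mode L j) = sndL L ℂ (mode L (k + j)) := by
        rw [mulSnd_apply, rep_mode, rep_mode, sndL_mode, sndL_mode, sndL_mode, map_smul, map_smul,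
          mulL2_toL2, mulL2_toL2, mul_comm (fourier j), ← add_smul]
        congr 1
        · simp only [wave]; push_cast; ring
        · congr 1
          ext x
          exact fourier_add.symm
      rw [h1, h2]
      exact (mode L (k + j)).2
    · intro v w hv hw
      rw [map_add, map_add]
      exact hv.add hw
    · intro c v hv
      rw [map_smul, map_smul]
      exact hv.smul c
    · exact isClosed_hasWeakDeriv (by fun_prop) (by fun_prop)
  · intro u w hu hw v
    rw [map_add, map_add]
    exact (hu v).add (hw v)
  · intro c u hu v
    rw [map_smul, map_smul]
    exact (hu v).smul c
  · simp only [ofPred_forall]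
    exact isClosed_iInter fun v => isClosed_hasWeakDeriv (by fun_prop) (by fun_prop)

theorem norm_le_add (u : H1 L ℂ) : ‖u‖ ≤ ‖fstL L ℂ u‖ + ‖sndL L ℂ u‖ := by
  refine abs_le_of_sq_le_sq' ?_ (by positivity) |>.2
  rw [H1_norm_sq]
  nlinarith [norm_nonneg (fstL L ℂ u), norm_nonneg (sndL L ℂ u)]

/-- `H¹` of the torus is an algebra: the product as a bounded bilinear map. -/
def mulH1 (L : ℝ) [Fact (0 < L)] : H1 L ℂ →L[ℂ] H1 L ℂ →L[ℂ] H1 L ℂ :=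
  LinearMap.mkContinuous₂
    (LinearMap.mk₂ ℂ (fun u v => mkH1 (mulFst L u v) (mulSnd L u v) (hasWeakDeriv_mul u v))
      (fun u v w => H1_ext (by simp) (by simp)) (fun c u v => H1_ext (by simp) (by simp))
      (fun u v w => H1_ext (by simp) (by simp)) (fun c u v => H1_ext (by simp) (by simp)))
    (‖mulFst L‖ + ‖mulSnd L‖) fun u v => by
      refine (norm_le_add _).trans ?_
      have h1 := (mulFst L).le_opNorm₂ u v
      have h2 := (mulSnd L).le_opNorm₂ u v
      simp only [LinearMap.mk₂_apply, fstL_mkH1, sndL_mkH1]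
      linarith

theorem fstL_mulH1 (u v : H1 L ℂ) : fstL L ℂ (mulH1 L u v) = mulL2 L (rep L u) (fstL L ℂ v) := rfl

theorem sndL_mulH1 (u v : H1 L ℂ) : sndL L ℂ (mulH1 L u v) =
    mulL2 L (rep L u) (sndL L ℂ v) + mulL2 L (rep L v) (sndL L ℂ u) := rfl

theorem rep_mulH1 (u v : H1 L ℂ) : rep L (mulH1 L u v) = rep L u * rep L v := by
  apply ContinuousMap.toLp_injective (p := 2) (𝕜 := ℂ) (volume : Measure (Torus L))
  change toL2 L ℂ _ = toL2 L ℂ _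
  rw [toL2_rep, fstL_mulH1, ← toL2_rep, mulL2_toL2]

theorem weakDx_mulH1 (u v : H1 L ℂ) : weakDx (mulH1 L u v) =ᵐ[volume]
    fun x => rep L u x * weakDx v x + rep L v x * weakDx u x := by
  rw [← coeFn_sndL, sndL_mulH1]
  filter_upwards [Lp.coeFn_add (mulL2 L (rep L u) (sndL L ℂ v)) (mulL2 L (rep L v) (sndL L ℂ u)),
    coeFn_mulL2 (rep L u) (sndL L ℂ v), coeFn_mulL2 (rep L v) (sndL L ℂ u)] with x h1 h2 h3
  rw [h1, Pi.add_apply, h2, h3]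
  rfl

/-! ### Real-linear maps of the values -/

section RCLike

variable {𝕜 𝕜' : Type} [RCLike 𝕜] [RCLike 𝕜']

theorem IsSmooth.ofReal {L : ℝ} {χ : Torus L → ℝ} (h : IsSmooth χ) :
    IsSmooth (fun x => (χ x : 𝕜)) :=
  (RCLike.ofRealCLM (K := 𝕜)).contDiff.comp h

theorem torusDeriv_clm {L : ℝ} (T : 𝕜 →L[ℝ] 𝕜') {φ : Torus L → 𝕜} (h : IsSmooth φ) (x : Torus L) :
    torusDeriv (fun x => T (φ x)) x = T (torusDeriv φ x) := by
  obtain ⟨s, rfl⟩ := QuotientAddGroup.mk_surjective x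
  simp only [torusDeriv_coe]
  exact (T.hasFDerivAt.comp_hasDerivAt s
    (ContDiff.differentiable h (by simp)).differentiableAt.hasDerivAt).deriv

/-- Weak differentiability may be tested with real test functions. -/
theorem hasWeakDeriv_iff_real (u v : L2 L 𝕜) :
    HasWeakDeriv (u : Torus L → 𝕜) v ↔ ∀ χ : Torus L → ℝ, IsSmooth χ →
      ∫ x, torusDeriv χ x • u x = -∫ x, χ x • v x := by
  constructor
  · intro h χ hχ
    have h1 := h _ (hχ.ofReal (𝕜 := 𝕜))
    have h2 : ∀ x, torusDeriv (fun x => (χ x : 𝕜)) x = ((torusDeriv χ x : ℝ) : 𝕜) :=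
      torusDeriv_clm (RCLike.ofRealCLM (K := 𝕜)) hχ
    simp_rw [h2] at h1
    simp_rw [RCLike.real_smul_eq_coe_mul, mul_comm (RCLike.ofReal _ : 𝕜)]
    exact h1
  · intro h φ hφ
    have hre : IsSmooth (fun x => RCLike.re (φ x)) := (RCLike.reCLM (K := 𝕜)).contDiff.comp hφ
    have him : IsSmooth (fun x => RCLike.im (φ x)) := (RCLike.imCLM (K := 𝕜)).contDiff.comp hφ
    have h1 := h _ hre
    have h2 := h _ him
    have hre' : ∀ x, torusDeriv (fun x => RCLike.re (φ x)) x = RCLike.re (torusDeriv φ x) :=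
      torusDeriv_clm (RCLike.reCLM (K := 𝕜)) hφ
    have him' : ∀ x, torusDeriv (fun x => RCLike.im (φ x)) x = RCLike.im (torusDeriv φ x) :=
      torusDeriv_clm (RCLike.imCLM (K := 𝕜)) hφ
    -- a pairing splits into the real and the imaginary part of the test function
    have key : ∀ (w : L2 L 𝕜) (χ : Torus L → 𝕜), IsSmooth χ → ∫ x, w x * χ x =
        (∫ x, RCLike.re (χ x) • w x) + RCLike.I * ∫ x, RCLike.im (χ x) • w x := by
      intro w χ hχ
      have hre : IsSmooth (fun x => ((RCLike.re (χ x) : ℝ) : 𝕜)) :=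
        (RCLike.ofRealCLM (K := 𝕜)).contDiff.comp ((RCLike.reCLM (K := 𝕜)).contDiff.comp hχ)
      have him : IsSmooth (fun x => ((RCLike.im (χ x) : ℝ) : 𝕜)) :=
        (RCLike.ofRealCLM (K := 𝕜)).contDiff.comp ((RCLike.imCLM (K := 𝕜)).contDiff.comp hχ)
      simp_rw [RCLike.real_smul_eq_coe_mul, mul_comm (RCLike.ofReal _ : 𝕜)]
      rw [← integral_const_mul, ← integral_add (integrable_mul_smooth w hre)
        ((integrable_mul_smooth w him).const_mul _)]
      refine integral_congr_ae (Filter.Eventually.of_forall fun x => ?_)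
      change w x * χ x = _
      conv_lhs => rw [← RCLike.re_add_im (χ x)]
      ring
    simp_rw [hre'] at h1
    simp_rw [him'] at h2
    rw [key u _ hφ.deriv_smooth, key v _ hφ, h1, h2]
    ring

/-- A real-linear map of the values, conjugation for instance, commutes with the weak derivative. It
need not commute with complex test functions, whence the passage to real ones. -/
theorem hasWeakDeriv_compLpL (T : 𝕜 →L[ℝ] 𝕜') {u v : L2 L 𝕜}
    (h : HasWeakDeriv (u : Torus L → 𝕜) v) :
    HasWeakDeriv (T.compLpL 2 volume u : Torus L → 𝕜') (T.compLpL 2 volume v) := by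
  rw [hasWeakDeriv_iff_real] at h ⊢
  intro χ hχ
  have key : ∀ (w : L2 L 𝕜) (χ : Torus L → ℝ), IsSmooth χ →
      ∫ x, χ x • (T.compLpL 2 volume w : Torus L → 𝕜') x = T (∫ x, χ x • w x) := by
    intro w χ hχ
    rw [← T.integral_comp_comm]
    · refine integral_congr_ae ?_
      filter_upwards [T.coeFn_compLpL (p := 2) (μ := volume) w] with x hx
      rw [hx, map_smul]
    · simp_rw [RCLike.real_smul_eq_coe_mul, mul_comm (RCLike.ofReal _ : 𝕜)]
      exact integrable_mul_smooth w hχ.ofReal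
  rw [key _ _ hχ.deriv_smooth, key _ _ hχ, h χ hχ, map_neg]

/-- The action on `H¹` of a real-linear map of the values. -/
def mapH1 (L : ℝ) [Fact (0 < L)] (T : 𝕜 →L[ℝ] 𝕜') : H1 L 𝕜 →L[ℝ] H1 L 𝕜' where
  toFun u := mkH1 _ _ (hasWeakDeriv_compLpL T (u := fstL L 𝕜 u) (v := sndL L 𝕜 u) u.2)
  map_add' u v := H1_ext (by simp) (by simp)
  map_smul' c u := by
    refine H1_ext ?_ ?_
    · exact map_smul (T.compLpL 2 volume) c (fstL L 𝕜 u)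
    · exact map_smul (T.compLpL 2 volume) c (sndL L 𝕜 u)
  cont := by
    refine Continuous.subtype_mk ?_ _
    exact (WithLp.prodContinuousLinearEquiv 2 𝕜' (L2 L 𝕜') (L2 L 𝕜')).symm.continuous.comp
      (((T.compLpL 2 volume).continuous.comp (fstL L 𝕜).continuous).prodMk
        ((T.compLpL 2 volume).continuous.comp (sndL L 𝕜).continuous))

theorem fn_mapH1 (T : 𝕜 →L[ℝ] 𝕜') (u : H1 L 𝕜) :
    fn (mapH1 L T u) =ᵐ[volume] fun x => T (fn u x) :=
  T.coeFn_compLpL (p := 2) (μ := volume) (fstL L 𝕜 u)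

theorem weakDx_mapH1 (T : 𝕜 →L[ℝ] 𝕜') (u : H1 L 𝕜) :
    weakDx (mapH1 L T u) =ᵐ[volume] fun x => T (weakDx u x) :=
  T.coeFn_compLpL (p := 2) (μ := volume) (sndL L 𝕜 u)

theorem H1_ext_fn {u v : H1 L 𝕜} (h₁ : fn u =ᵐ[volume] fn v) (h₂ : weakDx u =ᵐ[volume] weakDx v) :
    u = v := H1_ext (Lp.ext h₁) (Lp.ext h₂)

end RCLike

/-- Complex conjugation on `H¹`. -/
def conjH1 (L : ℝ) [Fact (0 < L)] : H1 L ℂ →L[ℝ] H1 L ℂ :=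
  mapH1 L (Complex.conjCLE : ℂ →L[ℝ] ℂ)

/-- The inclusion of the real in the complex `H¹`. -/
def ofRealH1 (L : ℝ) [Fact (0 < L)] : H1 L ℝ →L[ℝ] H1 L ℂ := mapH1 L Complex.ofRealCLM

/-- The real part on `H¹`. -/
def reH1 (L : ℝ) [Fact (0 < L)] : H1 L ℂ →L[ℝ] H1 L ℝ := mapH1 L Complex.reCLM

theorem eq_of_ae_eq_continuous {E : Type*} [TopologicalSpace E] [T2Space E] {f g : C(Torus L, E)}
    (h : (f : Torus L → E) =ᵐ[volume] g) : f = g :=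
  DFunLike.coe_injective ((f.continuous.ae_eq_iff_eq volume g.continuous).1 h)

theorem rep_conjH1 (u : H1 L ℂ) (x : Torus L) :
    rep L (conjH1 L u) x = (starRingEnd ℂ) (rep L u x) := by
  have h : rep L (conjH1 L u) = star (rep L u) := by
    refine eq_of_ae_eq_continuous ?_
    filter_upwards [fn_ae u, fn_ae (conjH1 L u), fn_mapH1 (Complex.conjCLE : ℂ →L[ℝ] ℂ) u]
      with x h1 h2 h3
    rw [← h2, ContinuousMap.star_apply, ← h1]
    exact h3
  rw [h]
  rfl

/-- The continuous representative of a real element of `H¹`. -/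
def repR (L : ℝ) [Fact (0 < L)] (u : H1 L ℝ) (x : Torus L) : ℝ := (rep L (ofRealH1 L u) x).re

theorem repR_ae (u : H1 L ℝ) : fn u =ᵐ[volume] repR L u := by
  filter_upwards [fn_ae (ofRealH1 L u), fn_mapH1 Complex.ofRealCLM u] with x h1 h2
  rw [repR, ← h1]
  exact (congrArg Complex.re h2).symm

theorem continuous_repR (u : H1 L ℝ) : Continuous (repR L u) :=
  Complex.continuous_re.comp (rep L (ofRealH1 L u)).continuous

theorem rep_ofRealH1 (u : H1 L ℝ) (x : Torus L) : rep L (ofRealH1 L u) x = (repR L u x : ℂ) := by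
  let f : C(Torus L, ℂ) := ⟨fun x => (repR L u x : ℂ),
    Complex.continuous_ofReal.comp (continuous_repR u)⟩
  have h : rep L (ofRealH1 L u) = f := by
    refine eq_of_ae_eq_continuous ?_
    filter_upwards [fn_ae (ofRealH1 L u), fn_mapH1 Complex.ofRealCLM u, repR_ae u] with x h1 h2 h3
    rw [← h1]
    refine Eq.trans h2 ?_
    rw [h3]
    rfl
  rw [h]
  rfl

theorem repR_reH1 (u : H1 L ℂ) (x : Torus L) : repR L (reH1 L u) x = (rep L u x).re := by
  let f : C(Torus L, ℝ) := ⟨_, continuous_repR (reH1 L u)⟩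
  let g : C(Torus L, ℝ) := ⟨_, Complex.continuous_re.comp (rep L u).continuous⟩
  have h : f = g := by
    refine eq_of_ae_eq_continuous ?_
    filter_upwards [repR_ae (reH1 L u), fn_mapH1 Complex.reCLM u, fn_ae u] with x h1 h2 h3
    refine h1.symm.trans (Eq.trans h2 ?_)
    rw [h3]
    rfl
  exact DFunLike.congr_fun h x

/-- Evaluation of the continuous representative at a point. -/
def evalR (x : Torus L) : H1 L ℝ →L[ℝ] ℝ :=
  Complex.reCLM.comp (((ContinuousMap.evalCLM ℂ x).comp (rep L)).restrictScalars ℝ |>.comp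
    (ofRealH1 L))

theorem evalR_apply (x : Torus L) (u : H1 L ℝ) : evalR x u = repR L u x := rfl

/-- The constant function `1`. -/
def oneH1 (L : ℝ) [Fact (0 < L)] : H1 L ℝ := ofSmooth (φ := fun _ => 1) contDiff_const

end Polariton

namespace Polariton

/-! ### Diagonal unitary groups -/

section Diagonal

variable {ι H D W : Type*} [NormedAddCommGroup H] [InnerProductSpace ℂ H]
  [NormedAddCommGroup D] [NormedSpace ℂ D] [NormedAddCommGroup W] [InnerProductSpace ℂ W]

/-- A closed linear condition that holds on a family with dense span holds everywhere. -/
theorem span_closure_induction {e : ι → H}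
    (he : (Submodule.span ℂ (range e)).topologicalClosure = ⊤) {p : H → Prop}
    (hmem : ∀ k, p (e k)) (hzero : p 0) (hadd : ∀ u v, p u → p v → p (u + v))
    (hsmul : ∀ (c : ℂ) u, p u → p (c • u)) (hclosed : IsClosed {u | p u}) (u : H) : p u := by
  have hu : u ∈ (Submodule.span ℂ (range e)).topologicalClosure := by rw [he]; trivial
  refine closure_minimal (t := {u | p u}) ?_ hclosed hu
  intro f hf
  induction hf using Submodule.span_induction with
  | mem f hf => obtain ⟨k, rfl⟩ := hf; exact hmem k
  | zero => exact hzero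
  | add f g _ _ hf hg => exact hadd _ _ hf hg
  | smul c f _ hf => exact hsmul _ _ hf

variable {e : ι → H} (he : (Submodule.span ℂ (range e)).topologicalClosure = ⊤)
  {S : ℝ → H ≃ₗᵢ[ℂ] H} {c : ℝ → ι → ℂ} (hS : ∀ t k, S t (e k) = c t k • e k)

include he hS

/-- Strong continuity of a diagonal unitary group. -/
theorem continuous_diagonal (hc : ∀ k, Continuous fun t => c t k) (u : H) :
    Continuous fun t => S t u := by
  refine span_closure_induction he (p := fun u => Continuous fun t => S t u) ?_ ?_ ?_ ?_ ?_ u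
  · intro k
    simp_rw [hS]
    exact (hc k).smul continuous_const
  · simp_rw [map_zero]
    exact continuous_const
  · intro u v hu hv
    simp_rw [map_add]
    exact hu.add hv
  · intro c u hu
    simp_rw [map_smul]
    exact hu.const_smul c
  · refine isClosed_of_closure_subset fun u hu => ?_
    refine continuous_of_uniform_approx_of_continuous fun V hV => ?_
    obtain ⟨ε, hε, hV⟩ := Metric.mem_uniformity_dist.1 hV
    obtain ⟨v, hv, huv⟩ := Metric.mem_closure_iff.1 hu ε hε
    refine ⟨fun t => S t v, hv, fun t => hV ?_⟩
    rwa [LinearIsometryEquiv.dist_map]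

/-- A diagonal unitary map preserves every sesquilinear form that is diagonal too. -/
theorem inner_diagonal (t : ℝ) (hc : ∀ k, ‖c t k‖ = 1) (G : H →L[ℂ] W)
    (hG : ∀ k j, k ≠ j → inner ℂ (G (e k)) (G (e j)) = 0) (u v : H) :
    inner ℂ (G (S t u)) (G (S t v)) = inner ℂ (G u) (G v) := by
  refine span_closure_induction he (p := fun u => ∀ v, inner ℂ (G (S t u)) (G (S t v))
    = inner ℂ (G u) (G v)) ?_ ?_ ?_ ?_ ?_ u v
  · intro k v
    refine span_closure_induction he (p := fun v => inner ℂ (G (S t (e k))) (G (S t v))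
      = inner ℂ (G (e k)) (G v)) ?_ ?_ ?_ ?_ ?_ v
    · intro j
      rw [hS, hS, map_smul, map_smul, inner_smul_left, inner_smul_right]
      by_cases h : k = j
      · subst h
        rw [← mul_assoc, Complex.conj_mul', hc]
        simp
      · rw [hG k j h, mul_zero, mul_zero]
    · simp
    · intro u v hu hv
      rw [map_add, map_add, map_add, inner_add_right, inner_add_right, hu, hv]
    · intro c u hu
      rw [map_smul, map_smul, map_smul, inner_smul_right, inner_smul_right, hu]
    · exact isClosed_eq (by fun_prop) (by fun_prop)
  · simp
  · intro u v hu hv w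
    rw [map_add, map_add, map_add, inner_add_left, inner_add_left, hu, hv]
  · intro c u hu w
    rw [map_smul, map_smul, map_smul, inner_smul_left, inner_smul_left, hu]
  · simp only [ofPred_forall]
    exact isClosed_iInter fun v => isClosed_eq (by fun_prop) (by fun_prop)

omit he hS

theorem continuous_uncurry_isometry (hcont : ∀ u, Continuous fun t => S t u) :
    Continuous fun q : ℝ × H => S q.1 q.2 :=
  continuous_prod_of_continuous_lipschitzWith' _ 1 (fun t => (S t).lipschitz)
    fun u => hcont u

include he hS

/-- If `M` maps the generator of a diagonal unitary group to `K`, as can be checked on the basis,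
then the group solves the evolution equation in integrated form. -/
theorem diagonal_sub_eq_integral [CompleteSpace D] [NormedSpace ℝ D] [IsScalarTower ℝ ℂ D]
    (hcont : ∀ u, Continuous fun t => S t u) (M K : H →L[ℂ] D) {c' : ℝ → ι → ℂ}
    (hc : ∀ t k, HasDerivAt (fun t => c t k) (c' t k) t)
    (hMK : ∀ t k, c' t k • M (e k) = K (S t (e k))) (u : H) (s t : ℝ) :
    M (S t u) - M (S s u) = ∫ r in s..t, K (S r u) := by
  have hK : ∀ u, Continuous fun r => K (S r u) := fun u => K.continuous.comp (hcont u)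
  refine span_closure_induction he (p := fun u => M (S t u) - M (S s u) =
    ∫ r in s..t, K (S r u)) ?_ ?_ ?_ ?_ ?_ u
  · intro k
    symm
    refine intervalIntegral.integral_eq_sub_of_hasDerivAt (f := fun r => M (S r (e k)))
      (fun r _ => ?_) ((hK _).intervalIntegrable _ _)
    rw [← hMK]
    simp_rw [hS, map_smul]
    exact (hc r k).smul_const (M (e k))
  · simp
  · intro u v hu hv
    simp_rw [map_add]
    rw [intervalIntegral.integral_add ((hK _).intervalIntegrable _ _)
      ((hK _).intervalIntegrable _ _), ← hu, ← hv]
    abel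
  · intro c u hu
    simp_rw [map_smul]
    rw [intervalIntegral.integral_smul, ← hu, smul_sub]
  · refine isClosed_eq (by fun_prop) ?_
    refine intervalIntegral.continuous_parametric_intervalIntegral_of_continuous' ?_ s t
    exact K.continuous.comp ((continuous_uncurry_isometry hcont).comp continuous_swap)

omit he hS

/-- The product rule for `S t (v t)`, as seen by `M`. The curve `S t (v t)` itself need not be
differentiable in `H`. -/
theorem hasDerivWithinAt_isometry_comp [CompleteSpace D] [NormedSpace ℝ D] [IsScalarTower ℝ ℂ D]
    [NormedSpace ℝ H] [IsScalarTower ℝ ℂ H]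
    (hcont : ∀ u, Continuous fun t => S t u) (M K : H →L[ℂ] D)
    (hMK : ∀ (u : H) (s t : ℝ), M (S t u) - M (S s u) = ∫ r in s..t, K (S r u))
    {v : ℝ → H} {v' : H} {s : Set ℝ} {t : ℝ} (h : HasDerivWithinAt v v' s t) :
    HasDerivWithinAt (fun r => M (S r (v r))) (K (S t (v t)) + M (S t v')) s t := by
  have hK : Continuous fun r => K (S r (v t)) := K.continuous.comp (hcont (v t))
  have h5 : HasDerivAt (fun r => M (S r (v t))) (K (S t (v t))) t := by
    have h1 : (fun r => M (S r (v t))) = fun r => M (S 0 (v t)) +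
        ∫ r in (0 : ℝ)..r, K (S r (v t)) := by
      funext r
      rw [← hMK, add_sub_cancel]
    rw [h1]
    exact (hK.integral_hasStrictDerivAt 0 t).hasDerivAt.const_add _
  have h1 : HasDerivWithinAt (fun r => S r (v r - v t)) (S t v') s t := by
    rw [hasDerivWithinAt_iff_tendsto_slope] at h ⊢
    have h2 : slope (fun r => S r (v r - v t)) t = fun r => S r (slope v t r) := by
      funext r
      rw [slope_def_module, slope_def_module]
      simp only [sub_self, map_zero, sub_zero]
      exact ((S r).toContinuousLinearEquiv.toContinuousLinearMap.map_smul_of_tower _ _).symm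
    rw [h2]
    have h3 : Filter.Tendsto (fun r : ℝ => r) (nhdsWithin t (s \ {t})) (nhds t) :=
      nhdsWithin_le_nhds
    exact ((continuous_uncurry_isometry hcont).tendsto (t, v')).comp (h3.prodMk_nhds h)
  have h4 := (M.restrictScalars ℝ).hasFDerivAt.comp_hasDerivWithinAt t h1
  refine (h5.hasDerivWithinAt.add h4).congr_of_eventuallyEq
    (Filter.Eventually.of_forall fun r => ?_) ?_
  · simp only [Pi.add_apply, Function.comp_apply, ContinuousLinearMap.coe_restrictScalars', map_sub]
    abel
  · simp

end Diagonal

/-! ### The free Schrödinger group -/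

section Phase

variable {L : ℝ}

/-- The factor by which the free evolution acts on the `k`-th mode. -/
def phase (L : ℝ) (t : ℝ) (k : ℤ) : ℂ := Complex.exp ((-(wave L k ^ 2 / 2 * t) : ℝ) * Complex.I)

theorem norm_phase (t : ℝ) (k : ℤ) : ‖phase L t k‖ = 1 := Complex.norm_exp_ofReal_mul_I _

theorem continuous_phase (k : ℤ) : Continuous fun t => phase L t k := by
  unfold phase
  fun_prop

theorem hasDerivAt_phase (t : ℝ) (k : ℤ) :
    HasDerivAt (fun t => phase L t k)
      (-(Complex.I / 2) * (wave L k : ℂ) ^ 2 * phase L t k) t := by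
  have h1 : HasDerivAt (fun t : ℝ => ((-(wave L k ^ 2 / 2 * t) : ℝ) : ℂ) * Complex.I)
      (((-(wave L k ^ 2 / 2 * 1) : ℝ) : ℂ) * Complex.I) t :=
    (((hasDerivAt_id t).const_mul _).neg.ofReal_comp).mul_const _
  refine h1.cexp.congr_deriv ?_
  rw [phase, mul_comm]
  congr 1
  push_cast
  ring

end Phase

variable {L : ℝ} [Fact (0 < L)]

theorem span_mode : (Submodule.span ℂ (range (mode L))).topologicalClosure = ⊤ := by
  rw [Submodule.eq_top_iff']
  refine modes_induction (fun k => ?_) (fun u v hu hv => Submodule.add_mem _ hu hv)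
    (fun c u hu => Submodule.smul_mem _ c hu) ?_
  · exact Submodule.le_topologicalClosure _ (Submodule.subset_span ⟨k, rfl⟩)
  · exact Submodule.isClosed_topologicalClosure _

/-- The free Schrödinger group `exp (i t ∂ₓ² / 2)` on `H¹`, as the change from the basis of the
normalised modes to the one with the phases of the free evolution. -/
def schrod (t : ℝ) : H1 L ℂ ≃ₗᵢ[ℂ] H1 L ℂ :=
  (modeBasis L (fun _ => 1) fun _ => norm_one).repr.trans
    (modeBasis L (phase L t) (norm_phase t)).repr.symm

theorem schrod_mode (t : ℝ) (k : ℤ) : schrod t (mode L k) = phase L t k • mode L k := by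
  classical
  have hk : (modeNorm L k : ℂ) ≠ 0 := by exact_mod_cast (modeNorm_pos k).ne'
  have h2 : mode L k = (modeNorm L k : ℂ) • modeBasis L (fun _ => 1) (fun _ => norm_one) k := by
    rw [modeBasis_apply, smul_smul, mul_one_div_cancel hk, one_smul]
  conv_lhs => rw [h2]
  rw [map_smul, schrod, LinearIsometryEquiv.trans_apply, HilbertBasis.repr_self,
    HilbertBasis.repr_symm_single, modeBasis_apply, smul_smul, mul_div_cancel₀ _ hk]

/-- The free evolution as a bounded linear map. -/
def schrodL (t : ℝ) : H1 L ℂ →L[ℂ] H1 L ℂ :=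
  (schrod (L := L) t).toContinuousLinearEquiv.toContinuousLinearMap

theorem schrodL_apply (t : ℝ) (u : H1 L ℂ) : schrodL t u = schrod t u := rfl

theorem schrod_schrod (s t : ℝ) (u : H1 L ℂ) : schrod s (schrod t u) = schrod (s + t) u := by
  have h : (schrodL s).comp (schrodL t) = schrodL (L := L) (s + t) := clm_ext_mode fun k => by
    rw [ContinuousLinearMap.comp_apply, schrodL_apply, schrodL_apply, schrodL_apply, schrod_mode,
      schrod_mode, map_smul, schrod_mode, smul_smul]
    congr 1
    rw [phase, phase, phase, ← Complex.exp_add]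
    congr 1
    push_cast
    ring
  exact DFunLike.congr_fun h u

theorem schrod_zero (u : H1 L ℂ) : schrod 0 u = u := by
  have h : schrodL (L := L) 0 = ContinuousLinearMap.id ℂ _ := clm_ext_mode fun k => by
    rw [schrodL_apply, schrod_mode]
    simp [phase]
  exact DFunLike.congr_fun h u

theorem schrod_neg_schrod (t : ℝ) (u : H1 L ℂ) : schrod (-t) (schrod t u) = u := by
  rw [schrod_schrod, neg_add_cancel, schrod_zero]

theorem schrod_schrod_neg (t : ℝ) (u : H1 L ℂ) : schrod t (schrod (-t) u) = u := by
  rw [schrod_schrod, add_neg_cancel, schrod_zero]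

theorem continuous_schrod (u : H1 L ℂ) : Continuous fun t => schrod t u :=
  continuous_diagonal span_mode schrod_mode continuous_phase u

theorem continuous_schrod_uncurry : Continuous fun q : ℝ × H1 L ℂ => schrod q.1 q.2 :=
  continuous_uncurry_isometry continuous_schrod

theorem schrod_inner_fst (t : ℝ) (u v : H1 L ℂ) :
    inner ℂ (fstL L ℂ (schrod t u)) (fstL L ℂ (schrod t v)) =
      inner ℂ (fstL L ℂ u) (fstL L ℂ v) :=
  inner_diagonal span_mode schrod_mode t (norm_phase t) (fstL L ℂ)
    (fun k j h => (inner_toL2_fourier k j).trans (if_neg h)) u v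

theorem schrod_inner_snd (t : ℝ) (u v : H1 L ℂ) :
    inner ℂ (sndL L ℂ (schrod t u)) (sndL L ℂ (schrod t v)) =
      inner ℂ (sndL L ℂ u) (sndL L ℂ v) := by
  have h := (schrod t).inner_map_map u v
  rw [H1_inner, H1_inner, schrod_inner_fst] at h
  exact add_left_cancel h

theorem inner_mode_schrod (t : ℝ) (k : ℤ) (u : H1 L ℂ) :
    inner ℂ (mode L k) (schrod t u) = phase L t k * inner ℂ (mode L k) u := by
  have h := (schrod (-t)).inner_map_map (mode L k) (schrod t u)
  rw [schrod_neg_schrod, schrod_mode, inner_smul_left (mode L k)] at h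
  rw [← h]
  congr 1
  rw [phase, phase, ← Complex.exp_conj]
  congr 1
  rw [map_mul, Complex.conj_I, Complex.conj_ofReal]
  push_cast
  ring

/-! ### The equation in the dual of `H¹` -/

/-- A function in `H¹` as a functional: `u ↦ (φ ↦ ∫ u φ)`. -/
def massForm (L : ℝ) [Fact (0 < L)] : H1 L ℂ →L[ℂ] H1 L ℂ →L[ℂ] ℂ :=
  (pair L ℂ).bilinearComp (fstL L ℂ) (fstL L ℂ)

/-- The functional `-∂ₓ² u`, that is `φ ↦ ∫ ∂ₓu ∂ₓφ`. -/
def stiffForm (L : ℝ) [Fact (0 < L)] : H1 L ℂ →L[ℂ] H1 L ℂ →L[ℂ] ℂ :=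
  (pair L ℂ).bilinearComp (sndL L ℂ) (sndL L ℂ)

theorem massForm_apply (u v : H1 L ℂ) : massForm L u v = pair L ℂ (fstL L ℂ u) (fstL L ℂ v) := rfl

theorem stiffForm_apply (u v : H1 L ℂ) :
    stiffForm L u v = pair L ℂ (sndL L ℂ u) (sndL L ℂ v) := rfl

theorem stiffForm_mode (k : ℤ) :
    stiffForm L (mode L k) = ((wave L k : ℂ) ^ 2) • massForm L (mode L k) := by
  ext φ
  rw [stiffForm_apply, smul_apply, massForm_apply, sndL_mode, fstL_mode,
    map_smul, smul_apply, pair_comm, pair_comm _ (fstL L ℂ φ)]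
  have h := pair_sndL φ (isSmooth_fourier (L := L) k)
  rw [toL2_torusDeriv_fourier, map_smul] at h
  refine (congrArg _ h).trans ?_
  simp only [smul_eq_mul]
  change _ * (-(_ * pair L ℂ (fstL L ℂ φ) (toL2 L ℂ (fourier k)))) = _
  linear_combination (-(wave L k : ℂ) ^ 2 * pair L ℂ (fstL L ℂ φ) (toL2 L ℂ (fourier k))) *
    Complex.I_sq

theorem massForm_schrod_sub (u : H1 L ℂ) (s t : ℝ) :
    massForm L (schrod t u) - massForm L (schrod s u) =
      ∫ r in s..t, ((-(Complex.I / 2)) • stiffForm L) (schrod r u) := by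
  refine diagonal_sub_eq_integral span_mode schrod_mode continuous_schrod _ _ hasDerivAt_phase
    (fun t k => ?_) u s t
  rw [smul_apply, schrod_mode, map_smul, stiffForm_mode, smul_smul, smul_smul]
  congr 1
  ring

/-- If `v` is differentiable in `H¹`, then `ψ = exp (i t ∂ₓ² / 2) v` satisfies
`∂ₜψ = (i/2) ∂ₓ²ψ + exp (i t ∂ₓ² / 2) ∂ₜv` in the dual of `H¹`. -/
theorem hasDerivWithinAt_massForm {v : ℝ → H1 L ℂ} {v' : H1 L ℂ} {s : Set ℝ} {t : ℝ}
    (h : HasDerivWithinAt v v' s t) :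
    HasDerivWithinAt (fun r => massForm L (schrod r (v r)))
      ((-(Complex.I / 2)) • stiffForm L (schrod t (v t)) + massForm L (schrod t v')) s t :=
  hasDerivWithinAt_isometry_comp continuous_schrod _ ((-(Complex.I / 2)) • stiffForm L)
    massForm_schrod_sub h

end Polariton

namespace Polariton

/-! ### Lipschitz bounds on bounded sets -/

section LipBdd

variable {X Y Z W : Type*} [NormedAddCommGroup X] [NormedAddCommGroup Y] [NormedAddCommGroup Z]
  [NormedAddCommGroup W]

/-- `f` is Lipschitz continuous on every ball about the origin. -/
def LipBdd (f : X → Y) : Prop :=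
  ∀ B : ℝ, ∃ K : ℝ, 0 ≤ K ∧ ∀ x y, ‖x‖ ≤ B → ‖y‖ ≤ B → ‖f x - f y‖ ≤ K * ‖x - y‖

theorem LipBdd.bounded {f : X → Y} (hf : LipBdd f) (B : ℝ) :
    ∃ C, 0 ≤ C ∧ ∀ x, ‖x‖ ≤ B → ‖f x‖ ≤ C := by
  obtain ⟨K, hK, h⟩ := hf (max B 0)
  refine ⟨‖f 0‖ + K * max B 0, by positivity, fun x hx => ?_⟩
  have h1 := h x 0 (hx.trans (le_max_left _ _)) (by simp)
  have h2 : ‖f x‖ ≤ ‖f 0‖ + ‖f x - f 0‖ := by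
    simpa using norm_add_le (f 0) (f x - f 0)
  rw [sub_zero] at h1
  have h3 : K * ‖x‖ ≤ K * max B 0 := by gcongr; exact hx.trans (le_max_left _ _)
  linarith

theorem LipBdd.const (c : Y) : LipBdd (fun _ : X => c) := fun _ => ⟨0, le_rfl, by simp⟩

theorem LipBdd.clm {𝕜 : Type*} [RCLike 𝕜] [NormedSpace 𝕜 X] [NormedSpace 𝕜 Y] (T : X →L[𝕜] Y) :
    LipBdd T := fun _ => ⟨‖T‖, norm_nonneg _, fun x y _ _ => by
  rw [← map_sub]; exact T.le_opNorm _⟩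

theorem LipBdd.add {f g : X → Y} (hf : LipBdd f) (hg : LipBdd g) :
    LipBdd (fun x => f x + g x) := by
  intro B
  obtain ⟨K, hK, hf⟩ := hf B
  obtain ⟨K', hK', hg⟩ := hg B
  refine ⟨K + K', by positivity, fun x y hx hy => ?_⟩
  rw [add_sub_add_comm, add_mul]
  exact (norm_add_le _ _).trans (add_le_add (hf x y hx hy) (hg x y hx hy))

theorem LipBdd.clm_comp {𝕜 : Type*} [RCLike 𝕜] [NormedSpace 𝕜 Y] [NormedSpace 𝕜 Z]
    (T : Y →L[𝕜] Z) {f : X → Y} (hf : LipBdd f) : LipBdd (fun x => T (f x)) := by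
  intro B
  obtain ⟨K, hK, hf⟩ := hf B
  refine ⟨‖T‖ * K, by positivity, fun x y hx hy => ?_⟩
  rw [← map_sub, mul_assoc]
  exact (T.le_opNorm _).trans (by gcongr; exact hf x y hx hy)

theorem LipBdd.smul {𝕜 : Type*} [RCLike 𝕜] [NormedSpace 𝕜 Y] (c : 𝕜) {f : X → Y} (hf : LipBdd f) :
    LipBdd (fun x => c • f x) :=
  LipBdd.clm_comp (c • ContinuousLinearMap.id 𝕜 Y) hf

theorem LipBdd.bilin {𝕜 : Type*} [RCLike 𝕜] [NormedSpace 𝕜 Y] [NormedSpace 𝕜 Z] [NormedSpace 𝕜 W]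
    (T : Y →L[𝕜] Z →L[𝕜] W) {f : X → Y} {g : X → Z} (hf : LipBdd f) (hg : LipBdd g) :
    LipBdd (fun x => T (f x) (g x)) := by
  intro B
  obtain ⟨C, hC, hfb⟩ := hf.bounded B
  obtain ⟨C', hC', hgb⟩ := hg.bounded B
  obtain ⟨K, hK, hf⟩ := hf B
  obtain ⟨K', hK', hg⟩ := hg B
  refine ⟨‖T‖ * K * C' + ‖T‖ * C * K', by positivity, fun x y hx hy => ?_⟩
  have h : T (f x) (g x) - T (f y) (g y) = T (f x - f y) (g x) + T (f y) (g x - g y) := by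
    rw [map_sub, map_sub, sub_apply]; abel
  rw [h]
  refine (norm_add_le _ _).trans ?_
  have h1 : ‖T (f x - f y) (g x)‖ ≤ ‖T‖ * (K * ‖x - y‖) * C' :=
    (T.le_opNorm₂ _ _).trans (by gcongr; exacts [hf x y hx hy, hgb x hx])
  have h2 : ‖T (f y) (g x - g y)‖ ≤ ‖T‖ * C * (K' * ‖x - y‖) :=
    (T.le_opNorm₂ _ _).trans (by gcongr; exacts [hfb y hy, hg x y hx hy])
  linarith

theorem LipBdd.comp {f : Y → Z} {g : X → Y} (hf : LipBdd f) (hg : LipBdd g) :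
    LipBdd (fun x => f (g x)) := by
  intro B
  obtain ⟨C, hC, hgb⟩ := hg.bounded B
  obtain ⟨K, hK, hf⟩ := hf C
  obtain ⟨K', hK', hg⟩ := hg B
  refine ⟨K * K', by positivity, fun x y hx hy => ?_⟩
  refine (hf _ _ (hgb x hx) (hgb y hy)).trans ?_
  rw [mul_assoc]
  gcongr
  exact hg x y hx hy

theorem LipBdd.prodMk {f : X → Y} {g : X → Z} (hf : LipBdd f) (hg : LipBdd g) :
    LipBdd (fun x => (f x, g x)) := by
  intro B
  obtain ⟨K, hK, hf⟩ := hf B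
  obtain ⟨K', hK', hg⟩ := hg B
  refine ⟨K + K', by positivity, fun x y hx hy => ?_⟩
  rw [Prod.mk_sub_mk, Prod.norm_mk, add_mul]
  have h1 := hf x y hx hy
  have h2 := hg x y hx hy
  have h3 := norm_nonneg (x - y)
  exact max_le (by nlinarith) (by nlinarith)

theorem LipBdd.fst : LipBdd (fun x : X × Y => x.1) := fun _ =>
  ⟨1, zero_le_one, fun x y _ _ => by rw [one_mul]; exact norm_fst_le (x - y)⟩

theorem LipBdd.snd : LipBdd (fun x : X × Y => x.2) := fun _ =>
  ⟨1, zero_le_one, fun x y _ _ => by rw [one_mul]; exact norm_snd_le (x - y)⟩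

theorem LipBdd.continuous {f : X → Y} (hf : LipBdd f) : Continuous f := by
  rw [continuous_iff_continuousAt]
  intro x
  obtain ⟨K, hK, hf⟩ := hf (‖x‖ + 1)
  have h1 : LipschitzOnWith K.toNNReal f (Metric.ball 0 (‖x‖ + 1)) := by
    refine LipschitzOnWith.of_dist_le_mul fun y hy z hz => ?_
    rw [dist_eq_norm, dist_eq_norm, Real.coe_toNNReal _ hK]
    rw [mem_ball_zero_iff] at hy hz
    exact hf y z hy.le hz.le
  exact h1.continuousOn.continuousAt (Metric.isOpen_ball.mem_nhds (by simp))

end LipBdd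

/-! ### Global solutions of ordinary differential equations -/

section ODE

variable {X : Type*} [NormedAddCommGroup X] [NormedSpace ℝ X]

/-- `x` solves `x' = f t x` on the set `s` of times. -/
def SolvesOn (f : ℝ → X → X) (s : Set ℝ) (x : ℝ → X) : Prop :=
  ∀ t ∈ s, HasDerivWithinAt x (f t (x t)) s t

theorem SolvesOn.continuousOn {f : ℝ → X → X} {s : Set ℝ} {x : ℝ → X} (h : SolvesOn f s x) :
    ContinuousOn x s := fun t ht => (h t ht).continuousWithinAt

theorem SolvesOn.mono {f : ℝ → X → X} {s s' : Set ℝ} {x : ℝ → X} (h : SolvesOn f s x)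
    (hs : s' ⊆ s) : SolvesOn f s' x := fun t ht => (h t (hs ht)).mono hs

variable {f : ℝ → X → X}

/-- Solutions are determined by their initial values. -/
theorem SolvesOn.eqOn (hf : ∀ B : ℝ, ∃ K : ℝ, 0 ≤ K ∧ ∀ t x y, ‖x‖ ≤ B → ‖y‖ ≤ B →
      ‖f t x - f t y‖ ≤ K * ‖x - y‖) {T : ℝ} {x y : ℝ → X}
    (hx : SolvesOn f (Icc 0 T) x) (hy : SolvesOn f (Icc 0 T) y) (h0 : x 0 = y 0) :
    EqOn x y (Icc 0 T) := by
  obtain ⟨B₁, hB₁⟩ := (isCompact_Icc.image_of_continuousOn hx.continuousOn).isBounded.exists_norm_le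
  obtain ⟨B₂, hB₂⟩ := (isCompact_Icc.image_of_continuousOn hy.continuousOn).isBounded.exists_norm_le
  obtain ⟨K, hK, hf⟩ := hf (max B₁ B₂)
  have hnhds : ∀ t ∈ Ico 0 T, Icc 0 T ∈ nhdsWithin t (Ici t) := fun t ht =>
    mem_nhdsWithin.2 ⟨Iio T, isOpen_Iio, ht.2, fun r hr => ⟨ht.1.trans hr.2, hr.1.le⟩⟩
  refine ODE_solution_unique_of_mem_Icc_right (v := f) (K := K.toNNReal)
    (s := fun _ => Metric.closedBall 0 (max B₁ B₂)) (fun t _ => ?_) hx.continuousOn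
    (fun t ht => (hx t (Ico_subset_Icc_self ht)).mono_of_mem_nhdsWithin (hnhds t ht))
    (fun t ht => ?_) hy.continuousOn
    (fun t ht => (hy t (Ico_subset_Icc_self ht)).mono_of_mem_nhdsWithin (hnhds t ht))
    (fun t ht => ?_) h0
  · refine LipschitzOnWith.of_dist_le_mul fun y hy z hz => ?_
    rw [dist_eq_norm, dist_eq_norm, Real.coe_toNNReal _ hK]
    rw [mem_closedBall_zero_iff] at hy hz
    exact hf t y z hy hz
  · rw [mem_closedBall_zero_iff]
    exact (hB₁ _ ⟨t, Ico_subset_Icc_self ht, rfl⟩).trans (le_max_left _ _)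
  · rw [mem_closedBall_zero_iff]
    exact (hB₂ _ ⟨t, Ico_subset_Icc_self ht, rfl⟩).trans (le_max_right _ _)

/-- A cut-off at distance `B` from the origin. -/
def cutoff (B : ℝ) (x : X) : ℝ := max 0 (min 1 (B + 1 - ‖x‖))

omit [NormedSpace ℝ X] in
theorem cutoff_nonneg (B : ℝ) (x : X) : 0 ≤ cutoff B x := le_max_left _ _

omit [NormedSpace ℝ X] in
theorem cutoff_le_one (B : ℝ) (x : X) : cutoff B x ≤ 1 :=
  max_le zero_le_one (min_le_left _ _)

omit [NormedSpace ℝ X] in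
theorem cutoff_eq_one {B : ℝ} {x : X} (hx : ‖x‖ ≤ B) : cutoff B x = 1 := by
  rw [cutoff, min_eq_left (by linarith), max_eq_right zero_le_one]

omit [NormedSpace ℝ X] in
theorem cutoff_eq_zero {B : ℝ} {x : X} (hx : B + 1 ≤ ‖x‖) : cutoff B x = 0 :=
  max_eq_left ((min_le_right _ _).trans (by linarith))

omit [NormedSpace ℝ X] in
theorem abs_cutoff_sub_le (B : ℝ) (x y : X) : |cutoff B x - cutoff B y| ≤ ‖x - y‖ := by
  rw [cutoff, cutoff, max_comm 0, max_comm 0 (min 1 (B + 1 - ‖y‖))]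
  refine (abs_max_sub_max_le_abs _ _ _).trans ?_
  rw [min_comm 1, min_comm 1]
  refine (abs_min_sub_min_le_max _ _ _ _).trans ?_
  rw [sub_self, abs_zero]
  refine max_le ?_ (norm_nonneg _)
  rw [show B + 1 - ‖x‖ - (B + 1 - ‖y‖) = ‖y‖ - ‖x‖ by ring, norm_sub_rev]
  exact abs_norm_sub_norm_le _ _

/-- A cut-off makes a locally Lipschitz field globally Lipschitz. -/
theorem norm_cutoff_smul_sub_le {g : X → X} {B K M : ℝ} (hK : 0 ≤ K) (hM : 0 ≤ M)
    (hg : ∀ x y, ‖x‖ ≤ B + 1 → ‖y‖ ≤ B + 1 → ‖g x - g y‖ ≤ K * ‖x - y‖)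
    (hgM : ∀ x, ‖x‖ ≤ B + 1 → ‖g x‖ ≤ M) (x y : X) :
    ‖cutoff B x • g x - cutoff B y • g y‖ ≤ (K + M) * ‖x - y‖ := by
  have one_side : ∀ x y : X, ‖x‖ ≤ B + 1 → B + 1 ≤ ‖y‖ →
      ‖cutoff B x • g x - cutoff B y • g y‖ ≤ (K + M) * ‖x - y‖ := by
    intro x y hx hy
    have h := abs_cutoff_sub_le B x y
    rw [cutoff_eq_zero hy, sub_zero] at h
    rw [cutoff_eq_zero hy, zero_smul, sub_zero, norm_smul, Real.norm_eq_abs]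
    calc |cutoff B x| * ‖g x‖ ≤ ‖x - y‖ * M := by gcongr; exact hgM x hx
      _ ≤ (K + M) * ‖x - y‖ := by nlinarith [norm_nonneg (x - y)]
  rcases le_total ‖x‖ (B + 1) with hx | hx
  · rcases le_total ‖y‖ (B + 1) with hy | hy
    · have h : cutoff B x • g x - cutoff B y • g y =
          cutoff B x • (g x - g y) + (cutoff B x - cutoff B y) • g y := by
        rw [smul_sub, sub_smul]; abel
      rw [h]
      refine (norm_add_le _ _).trans ?_
      rw [norm_smul, norm_smul, Real.norm_eq_abs, Real.norm_eq_abs, add_mul,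
        abs_of_nonneg (cutoff_nonneg B x)]
      refine add_le_add ?_ ?_
      · calc cutoff B x * ‖g x - g y‖ ≤ 1 * (K * ‖x - y‖) := by
              gcongr
              · exact cutoff_le_one B x
              · exact hg x y hx hy
          _ = K * ‖x - y‖ := one_mul _
      · rw [mul_comm]
        gcongr
        · exact hgM y hy
        · exact abs_cutoff_sub_le B x y
    · exact one_side x y hx hy
  · rcases le_total ‖y‖ (B + 1) with hy | hy
    · rw [norm_sub_rev, norm_sub_rev x]
      exact one_side y x hy hx
    · rw [cutoff_eq_zero hx, cutoff_eq_zero hy, zero_smul, zero_smul, sub_self, norm_zero]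
      positivity

variable [CompleteSpace X]

/-- An a priori bound gives a solution on a bounded interval of time: the field that is cut off
beyond the bound has a solution, which never reaches the cut-off. -/
theorem exists_solvesOn_Icc (hf : ∀ B : ℝ, ∃ K : ℝ, 0 ≤ K ∧ ∀ t x y, ‖x‖ ≤ B → ‖y‖ ≤ B →
      ‖f t x - f t y‖ ≤ K * ‖x - y‖) (hcont : ∀ x, Continuous fun t => f t x) (x₀ : X)
    {T B₀ : ℝ} (hT : 0 ≤ T)
    (hB₀ : ∀ τ, 0 < τ → τ ≤ T → ∀ x : ℝ → X, x 0 = x₀ → SolvesOn f (Icc 0 τ) x → ‖x τ‖ ≤ B₀) :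
    ∃ x : ℝ → X, x 0 = x₀ ∧ SolvesOn f (Icc 0 T) x := by
  -- above the bound and the initial value: to reach the norm `B` is then impossible
  set B := max B₀ ‖x₀‖ + 1 with hB
  obtain ⟨K, hK, hKf⟩ := hf (B + 1)
  obtain ⟨M₀, hM₀⟩ := (isCompact_Icc.image_of_continuousOn
    (hcont 0).continuousOn (s := Icc 0 T)).isBounded.exists_norm_le
  have hBpos : 0 < B := by
    have := norm_nonneg x₀
    have := le_max_right B₀ ‖x₀‖
    linarith
  set M := |M₀| + K * (B + 1) with hM
  have hMpos : 0 ≤ M := by positivity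
  have hMf : ∀ t ∈ Icc 0 T, ∀ x, ‖x‖ ≤ B + 1 → ‖f t x‖ ≤ M := by
    intro t ht x hx
    have h1 := hKf t x 0 hx (by rw [norm_zero]; positivity)
    have h2 : ‖f t x‖ ≤ ‖f t 0‖ + ‖f t x - f t 0‖ := by
      simpa using norm_add_le (f t 0) (f t x - f t 0)
    have h3 := (hM₀ _ ⟨t, ht, rfl⟩).trans (le_abs_self _)
    rw [sub_zero] at h1
    have h4 : K * ‖x‖ ≤ K * (B + 1) := by gcongr
    simp only at h3
    linarith
  let g : ℝ → X → X := fun t x => cutoff B x • f t x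
  have hPL : IsPicardLindelof g (⟨0, le_rfl, hT⟩ : Icc (0 : ℝ) T) x₀ (M * T).toNNReal 0
      M.toNNReal (K + M).toNNReal := by
    refine ⟨fun t ht => ?_, fun x _ => ?_, fun t ht x _ => ?_, ?_⟩
    · refine LipschitzOnWith.of_dist_le_mul fun y _ z _ => ?_
      rw [dist_eq_norm, dist_eq_norm, Real.coe_toNNReal _ (by positivity)]
      exact norm_cutoff_smul_sub_le hK hMpos (hKf t) (hMf t ht) y z
    · exact ((hcont x).const_smul _).continuousOn
    · rw [Real.coe_toNNReal _ hMpos, norm_smul, Real.norm_eq_abs,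
        abs_of_nonneg (cutoff_nonneg B x)]
      rcases le_total ‖x‖ (B + 1) with hx | hx
      · calc cutoff B x * ‖f t x‖ ≤ 1 * M := by
              gcongr
              · exact cutoff_le_one B x
              · exact hMf t ht x hx
          _ = M := one_mul _
      · rw [cutoff_eq_zero hx, zero_mul]
        exact hMpos
    · rw [Real.coe_toNNReal _ hMpos, Real.coe_toNNReal _ (by positivity)]
      simp [hT]
  obtain ⟨α, hα0, hα⟩ := hPL.exists_eq_forall_mem_Icc_hasDerivWithinAt
    (x := x₀) (Metric.mem_closedBall_self (by simp))
  have hα0 : α 0 = x₀ := hα0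
  have hαc : ContinuousOn α (Icc 0 T) := fun t ht => (hα t ht).continuousWithinAt
  have hbound : ∀ t ∈ Icc 0 T, ‖α t‖ < B := by
    by_contra! hcon
    obtain ⟨t₁, ht₁, ht₁B⟩ := hcon
    set s : Set ℝ := Icc 0 T ∩ (fun t => ‖α t‖) ⁻¹' Ici B with hs
    have hsc : IsCompact s :=
      isCompact_Icc.of_isClosed_subset (hαc.norm.preimage_isClosed_of_isClosed isClosed_Icc
        isClosed_Ici) inter_subset_left
    have hτs : sInf s ∈ s := hsc.sInf_mem ⟨t₁, ht₁, ht₁B⟩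
    -- the first time at which the norm reaches `B`
    set τ := sInf s with hτ
    have hlt : ∀ t ∈ Ico 0 τ, ‖α t‖ < B := by
      intro t ht
      by_contra! h
      have : τ ≤ t := csInf_le hsc.bddBelow ⟨⟨ht.1, ht.2.le.trans hτs.1.2⟩, h⟩
      exact absurd ht.2 (not_lt.2 this)
    have hτpos : 0 < τ := by
      refine lt_of_le_of_ne hτs.1.1 fun h => ?_
      have h2 : B ≤ ‖α τ‖ := hτs.2
      rw [← h, hα0] at h2
      have := le_max_right B₀ ‖x₀‖
      linarith
    have hle : ∀ t ∈ Icc 0 τ, ‖α t‖ ≤ B := by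
      have h1 : IsClosed (Icc 0 τ ∩ (fun t => ‖α t‖) ⁻¹' Iic B) :=
        (hαc.mono (Icc_subset_Icc_right hτs.1.2)).norm.preimage_isClosed_of_isClosed isClosed_Icc
          isClosed_Iic
      have h2 : closure (Ico 0 τ) ⊆ Icc 0 τ ∩ (fun t => ‖α t‖) ⁻¹' Iic B :=
        closure_minimal (fun t ht => ⟨Ico_subset_Icc_self ht, (hlt t ht).le⟩) h1
      rw [closure_Ico hτpos.ne] at h2
      exact fun t ht => (h2 ht).2
    have hsol : SolvesOn f (Icc 0 τ) α := by
      intro t ht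
      have h1 := (hα t ⟨ht.1, ht.2.trans hτs.1.2⟩).mono (Icc_subset_Icc_right hτs.1.2)
      simpa only [g, cutoff_eq_one (hle t ht), one_smul] using h1
    have h1 := hB₀ τ hτpos hτs.1.2 α hα0 hsol
    have h2 : B ≤ ‖α τ‖ := hτs.2
    have := le_max_left B₀ ‖x₀‖
    linarith
  refine ⟨α, hα0, fun t ht => ?_⟩
  simpa only [g, cutoff_eq_one (hbound t ht).le, one_smul] using hα t ht

/-- Global existence from a priori bounds on bounded intervals of time. -/
theorem exists_solvesOn_Ici (hf : ∀ B : ℝ, ∃ K : ℝ, 0 ≤ K ∧ ∀ t x y, ‖x‖ ≤ B → ‖y‖ ≤ B →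
      ‖f t x - f t y‖ ≤ K * ‖x - y‖) (hcont : ∀ x, Continuous fun t => f t x) (x₀ : X)
    (hbound : ∀ T : ℝ, ∃ B₀ : ℝ, ∀ τ, 0 < τ → τ ≤ T → ∀ x : ℝ → X, x 0 = x₀ →
      SolvesOn f (Icc 0 τ) x → ‖x τ‖ ≤ B₀) :
    ∃ x : ℝ → X, x 0 = x₀ ∧ SolvesOn f (Ici 0) x := by
  have h1 : ∀ N : ℕ, ∃ x : ℝ → X, x 0 = x₀ ∧ SolvesOn f (Icc 0 (N + 1)) x := fun N =>
    exists_solvesOn_Icc hf hcont x₀ (by positivity) (hbound (N + 1)).choose_spec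
  choose y hy0 hy using h1
  -- by uniqueness the solutions agree on their common intervals and can be glued
  have key : ∀ (N : ℕ) (t : ℝ), 0 ≤ t → t ≤ N + 1 → y ⌊t⌋₊ t = y N t := by
    intro N t ht htN
    have h2 : t ≤ ⌊t⌋₊ + 1 := (Nat.lt_floor_add_one t).le
    exact SolvesOn.eqOn hf ((hy ⌊t⌋₊).mono (Icc_subset_Icc_right h2))
      ((hy N).mono (Icc_subset_Icc_right htN)) ((hy0 _).trans (hy0 _).symm) ⟨ht, le_rfl⟩
  refine ⟨fun t => y ⌊t⌋₊ t, by simp [hy0], fun t ht => ?_⟩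
  have ht : 0 ≤ t := ht
  set N := ⌊t⌋₊ with hN
  have h2 : t < N + 1 := Nat.lt_floor_add_one t
  have hmem : Icc (0 : ℝ) (N + 1) ∈ nhdsWithin t (Ici 0) :=
    mem_nhdsWithin.2 ⟨Iio (N + 1), isOpen_Iio, h2, fun r hr => ⟨hr.2, hr.1.le⟩⟩
  have h3 := ((hy N) t ⟨ht, h2.le⟩).mono_of_mem_nhdsWithin hmem
  refine h3.congr_of_eventuallyEq ?_ rfl
  filter_upwards [hmem] with r hr
  exact key N r hr.1 hr.2

end ODE

end Polariton

namespace Polariton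

variable {L : ℝ} [Fact (0 < L)]

/-! ### The nonlinearity -/

/-- The phase space `H¹(𝕋; ℂ) × H¹(𝕋; ℝ)`. -/
abbrev Phase (L : ℝ) [Fact (0 < L)] : Type := H1 L ℂ × H1 L ℝ

/-- The density `|u|²`. -/
def absSq (u : H1 L ℂ) : H1 L ℂ := mulH1 L u (conjH1 L u)

/-- The forcing term of the wave equation,
`-i g |ψ|² ψ - i λ n ψ + ½ (R n - α) ψ`. -/
def waveForce (p : Params) (x : Phase L) : H1 L ℂ :=
  (-(Complex.I * p.g)) • mulH1 L (absSq x.1) x.1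
    + ((-(Complex.I * p.lam) + p.R / 2 : ℂ)) • mulH1 L (ofRealH1 L x.2) x.1
    + (-(p.α / 2) : ℂ) • x.1

/-- The rate of change of the reservoir, `(P - (R |ψ|² + β) n) / ε`. -/
def reservoirForce (p : Params) (x : Phase L) : H1 L ℝ :=
  (p.P / p.ε) • oneH1 L + (-(p.R / p.ε)) • reH1 L (mulH1 L (absSq x.1) (ofRealH1 L x.2))
    + (-(p.β / p.ε)) • x.2

/-- The system in the interaction picture: with `ψ = exp (i t ∂ₓ² / 2) v`, the pair `(v, n)`
solves an ordinary differential equation in the phase space. -/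
def field (p : Params) (t : ℝ) (x : Phase L) : Phase L :=
  (schrod (-t) (waveForce p (schrod t x.1, x.2)), reservoirForce p (schrod t x.1, x.2))

theorem lipBdd_absSq : LipBdd (absSq : H1 L ℂ → H1 L ℂ) :=
  LipBdd.bilin (mulH1 L) (LipBdd.clm (ContinuousLinearMap.id ℂ _)) (LipBdd.clm (conjH1 L))

theorem lipBdd_waveForce (p : Params) : LipBdd (waveForce p : Phase L → H1 L ℂ) := by
  have h1 : LipBdd fun x : Phase L => absSq x.1 := lipBdd_absSq.comp LipBdd.fst
  have h2 : LipBdd fun x : Phase L => ofRealH1 L x.2 := LipBdd.clm_comp _ LipBdd.snd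
  exact (((LipBdd.bilin (mulH1 L) h1 LipBdd.fst).smul _).add
    ((LipBdd.bilin (mulH1 L) h2 LipBdd.fst).smul _)).add (LipBdd.fst.smul _)

theorem lipBdd_reservoirForce (p : Params) : LipBdd (reservoirForce p : Phase L → H1 L ℝ) := by
  have h1 : LipBdd fun x : Phase L => absSq x.1 := lipBdd_absSq.comp LipBdd.fst
  have h2 : LipBdd fun x : Phase L => ofRealH1 L x.2 := LipBdd.clm_comp _ LipBdd.snd
  exact ((LipBdd.const _).add ((LipBdd.clm_comp (reH1 L)
    (LipBdd.bilin (mulH1 L) h1 h2)).smul _)).add (LipBdd.snd.smul _)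

theorem norm_schrod_prod (t : ℝ) (u : H1 L ℂ) (w : H1 L ℝ) :
    ‖((schrod t u, w) : Phase L)‖ = ‖((u, w) : Phase L)‖ := by
  rw [Prod.norm_mk, Prod.norm_mk, LinearIsometryEquiv.norm_map]

theorem field_lipschitz (p : Params) (B : ℝ) : ∃ K : ℝ, 0 ≤ K ∧ ∀ (t : ℝ) (x y : Phase L),
    ‖x‖ ≤ B → ‖y‖ ≤ B → ‖field p t x - field p t y‖ ≤ K * ‖x - y‖ := by
  obtain ⟨K, hK, h⟩ := ((lipBdd_waveForce p).prodMk (lipBdd_reservoirForce (L := L) p)) B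
  refine ⟨K, hK, fun t x y hx hy => ?_⟩
  have h1 := h (schrod t x.1, x.2) (schrod t y.1, y.2) ((norm_schrod_prod t _ _).trans_le hx)
    ((norm_schrod_prod t _ _).trans_le hy)
  rw [Prod.mk_sub_mk, Prod.mk_sub_mk, ← map_sub, norm_schrod_prod] at h1
  rw [field, field, Prod.mk_sub_mk, ← map_sub, norm_schrod_prod]
  exact h1

theorem continuous_field (p : Params) : Continuous fun q : ℝ × Phase L => field p q.1 q.2 := by
  have h1 : Continuous fun q : ℝ × Phase L => ((schrod q.1 q.2.1, q.2.2) : Phase L) :=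
    (continuous_schrod_uncurry.comp (continuous_fst.prodMk (continuous_fst.comp
      continuous_snd))).prodMk (continuous_snd.comp continuous_snd)
  exact (continuous_schrod_uncurry.comp ((continuous_neg.comp continuous_fst).prodMk
    ((lipBdd_waveForce p).continuous.comp h1))).prodMk
    ((lipBdd_reservoirForce p).continuous.comp h1)

/-! ### Pointwise formulas -/

theorem rep_absSq (u : H1 L ℂ) (y : Torus L) : rep L (absSq u) y = ((‖rep L u y‖ ^ 2 : ℝ) : ℂ) := by
  rw [absSq, rep_mulH1, ContinuousMap.mul_apply, rep_conjH1, Complex.mul_conj']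
  push_cast
  rfl

theorem rep_waveForce (p : Params) (x : Phase L) (y : Torus L) :
    rep L (waveForce p x) y = -(Complex.I * p.g) * (((‖rep L x.1 y‖ ^ 2 : ℝ) : ℂ) * rep L x.1 y)
      + (-(Complex.I * p.lam) + p.R / 2) * ((repR L x.2 y : ℂ) * rep L x.1 y)
      + -(p.α / 2) * rep L x.1 y := by
  rw [waveForce, map_add, map_add, map_smul, map_smul, map_smul, rep_mulH1, rep_mulH1]
  simp only [ContinuousMap.add_apply, ContinuousMap.smul_apply, ContinuousMap.mul_apply,
    smul_eq_mul, rep_absSq, rep_ofRealH1]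

theorem repR_oneH1 (y : Torus L) : repR L (oneH1 L) y = 1 := by
  let f : C(Torus L, ℝ) := ⟨_, continuous_repR (oneH1 L)⟩
  have h : f = 1 := by
    refine eq_of_ae_eq_continuous ?_
    filter_upwards [repR_ae (oneH1 L), ContinuousMap.coeFn_toLp (p := 2) (μ := volume) (𝕜 := ℝ)
      (1 : C(Torus L, ℝ))] with y h1 h2
    exact h1.symm.trans h2
  exact DFunLike.congr_fun h y

theorem repR_reservoirForce (p : Params) (x : Phase L) (y : Torus L) :
    repR L (reservoirForce p x) y =
      (p.P - (p.R * ‖rep L x.1 y‖ ^ 2 + p.β) * repR L x.2 y) / p.ε := by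
  have h : repR L (reH1 L (mulH1 L (absSq x.1) (ofRealH1 L x.2))) y =
      ‖rep L x.1 y‖ ^ 2 * repR L x.2 y := by
    rw [repR_reH1, rep_mulH1, ContinuousMap.mul_apply, rep_absSq, rep_ofRealH1,
      ← Complex.ofReal_mul, Complex.ofReal_re]
  rw [← evalR_apply, reservoirForce, map_add, map_add, map_smul, map_smul, map_smul]
  simp only [evalR_apply, repR_oneH1, h, smul_eq_mul]
  ring

theorem weakDx_add {𝕜 : Type} [RCLike 𝕜] (u v : H1 L 𝕜) :
    weakDx (u + v) =ᵐ[volume] fun y => weakDx u y + weakDx v y := by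
  rw [← coeFn_sndL, map_add]
  exact Lp.coeFn_add _ _

theorem weakDx_smul {𝕜 : Type} [RCLike 𝕜] (c : 𝕜) (u : H1 L 𝕜) :
    weakDx (c • u) =ᵐ[volume] fun y => c * weakDx u y := by
  rw [← coeFn_sndL, map_smul]
  exact Lp.coeFn_smul _ _

theorem weakDx_absSq (u : H1 L ℂ) : weakDx (absSq u) =ᵐ[volume]
    fun y => rep L u y * (starRingEnd ℂ) (weakDx u y) +
      (starRingEnd ℂ) (rep L u y) * weakDx u y := by
  filter_upwards [weakDx_mulH1 u (conjH1 L u),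
    weakDx_mapH1 (Complex.conjCLE : ℂ →L[ℝ] ℂ) u] with y h1 h2
  rw [absSq, h1, rep_conjH1]
  congr 2

/-- The derivative of the cubic term `|u|² u`. -/
theorem weakDx_cubic (u : H1 L ℂ) : weakDx (mulH1 L (absSq u) u) =ᵐ[volume]
    fun y => 2 * ((‖rep L u y‖ ^ 2 : ℝ) : ℂ) * weakDx u y +
      rep L u y ^ 2 * (starRingEnd ℂ) (weakDx u y) := by
  filter_upwards [weakDx_mulH1 (absSq u) u, weakDx_absSq u] with y h1 h2
  rw [h1, h2, rep_absSq]
  push_cast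
  rw [← Complex.mul_conj']
  ring

theorem weakDx_waveForce (p : Params) (x : Phase L) : weakDx (waveForce p x) =ᵐ[volume]
    fun y => -(Complex.I * p.g) * (2 * ((‖rep L x.1 y‖ ^ 2 : ℝ) : ℂ) * weakDx x.1 y +
        rep L x.1 y ^ 2 * (starRingEnd ℂ) (weakDx x.1 y))
      + (-(Complex.I * p.lam) + p.R / 2) * ((repR L x.2 y : ℂ) * weakDx x.1 y +
          ((weakDx x.2 y : ℝ) : ℂ) * rep L x.1 y)
      + -(p.α / 2) * weakDx x.1 y := by
  set a := mulH1 L (absSq x.1) x.1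
  set b := mulH1 L (ofRealH1 L x.2) x.1 with hb
  filter_upwards [weakDx_add ((-(Complex.I * p.g)) • a +
      ((-(Complex.I * p.lam) + p.R / 2 : ℂ)) • b) ((-(p.α / 2) : ℂ) • x.1),
    weakDx_add ((-(Complex.I * p.g)) • a) ((-(Complex.I * p.lam) + p.R / 2 : ℂ) • b),
    weakDx_smul (-(Complex.I * p.g)) a, weakDx_smul (-(Complex.I * p.lam) + p.R / 2 : ℂ) b,
    weakDx_smul (-(p.α / 2) : ℂ) x.1, weakDx_cubic x.1, weakDx_mulH1 (ofRealH1 L x.2) x.1,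
    weakDx_mapH1 Complex.ofRealCLM x.2] with y h1 h2 h3 h4 h5 h6 h7 h8
  have h8' : weakDx (ofRealH1 L x.2) y = ((weakDx x.2 y : ℝ) : ℂ) := h8
  refine h1.trans ?_
  rw [h2, h3, h4, h5, h6, hb, h7, h8', rep_ofRealH1]
  ring

theorem weakDx_oneH1 : weakDx (oneH1 L) =ᵐ[volume] fun _ => 0 := by
  filter_upwards [ContinuousMap.coeFn_toLp (p := 2) (μ := volume) (𝕜 := ℝ)
    (⟨_, (IsSmooth.deriv_smooth (L := L) (φ := fun _ => (1 : ℝ)) contDiff_const).continuous⟩ :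
      C(Torus L, ℝ))] with y h
  refine h.trans ?_
  simp [torusDeriv]

theorem weakDx_reservoirForce (p : Params) (x : Phase L) :
    weakDx (reservoirForce p x) =ᵐ[volume] fun y =>
      -((2 * p.R * ((starRingEnd ℂ) (rep L x.1 y) * weakDx x.1 y).re * repR L x.2 y +
        (p.R * ‖rep L x.1 y‖ ^ 2 + p.β) * weakDx x.2 y) / p.ε) := by
  set a := mulH1 L (absSq x.1) (ofRealH1 L x.2) with ha
  filter_upwards [weakDx_add ((p.P / p.ε) • oneH1 L + (-(p.R / p.ε)) • reH1 L a)
      ((-(p.β / p.ε)) • x.2),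
    weakDx_add ((p.P / p.ε) • oneH1 L) ((-(p.R / p.ε)) • reH1 L a),
    weakDx_smul (p.P / p.ε) (oneH1 L), weakDx_smul (-(p.R / p.ε)) (reH1 L a),
    weakDx_smul (-(p.β / p.ε)) x.2, weakDx_oneH1 (L := L), weakDx_mapH1 Complex.reCLM a,
    weakDx_mulH1 (absSq x.1) (ofRealH1 L x.2), weakDx_absSq x.1,
    weakDx_mapH1 Complex.ofRealCLM x.2] with y h1 h2 h3 h4 h5 h6 h7 h8 h9 h10
  have h7' : weakDx (reH1 L a) y = (weakDx a y).re := h7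
  have h10' : weakDx (ofRealH1 L x.2) y = ((weakDx x.2 y : ℝ) : ℂ) := h10
  refine h1.trans ?_
  rw [h2, h3, h4, h5, h6, h7', ha, h8, h9, h10', rep_absSq, rep_ofRealH1]
  simp only [Complex.add_re, Complex.mul_re, Complex.mul_im, Complex.add_im, Complex.ofReal_re,
    Complex.ofReal_im, Complex.conj_re, Complex.conj_im]
  ring

end Polariton

namespace Polariton

/-! ### Differential inequalities -/

/-- A function that starts nonpositive and does not increase where it is positive stays
nonpositive. -/
theorem nonpos_of_hasDerivWithinAt {T : ℝ} {y y' : ℝ → ℝ}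
    (hy : ∀ t ∈ Icc 0 T, HasDerivWithinAt y (y' t) (Icc 0 T) t) (h0 : y 0 ≤ 0)
    (h : ∀ t ∈ Icc 0 T, 0 < y t → y' t ≤ 0) : ∀ t ∈ Icc 0 T, y t ≤ 0 := by
  by_contra! hcon
  obtain ⟨t₁, ht₁, hpos⟩ := hcon
  have hyc : ContinuousOn y (Icc 0 t₁) := fun t ht =>
    ((hy t ⟨ht.1, ht.2.trans ht₁.2⟩).continuousWithinAt).mono (Icc_subset_Icc_right ht₁.2)
  -- `t₀` is the last time before `t₁` at which `y ≤ 0`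
  set s := Icc 0 t₁ ∩ y ⁻¹' Iic 0 with hs
  have hsc : IsCompact s := isCompact_Icc.of_isClosed_subset
    (hyc.preimage_isClosed_of_isClosed isClosed_Icc isClosed_Iic) inter_subset_left
  have ht₀ : sSup s ∈ s := hsc.sSup_mem ⟨0, ⟨le_rfl, ht₁.1⟩, h0⟩
  set t₀ := sSup s with ht₀_def
  have hsub : Icc t₀ t₁ ⊆ Icc 0 T := Icc_subset_Icc ht₀.1.1 ht₁.2
  have hanti : AntitoneOn y (Icc t₀ t₁) := by
    have hd : ∀ t ∈ Ioo t₀ t₁, HasDerivAt y (y' t) t := fun t ht =>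
      (hy t (hsub (Ioo_subset_Icc_self ht))).hasDerivAt
        (Icc_mem_nhds (ht₀.1.1.trans_lt ht.1) (ht.2.trans_le ht₁.2))
    refine antitoneOn_of_deriv_nonpos (convex_Icc _ _)
      (hyc.mono (Icc_subset_Icc_left ht₀.1.1)) ?_ ?_
    · rw [interior_Icc]
      exact fun t ht => (hd t ht).differentiableAt.differentiableWithinAt
    · rw [interior_Icc]
      intro t ht
      rw [(hd t ht).deriv]
      refine h t (hsub (Ioo_subset_Icc_self ht)) ?_
      by_contra! hle
      have : t ≤ t₀ := le_csSup hsc.bddAbove ⟨⟨ht₀.1.1.trans ht.1.le, ht.2.le⟩, hle⟩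
      exact absurd ht.1 (not_lt.2 this)
  have h1 := hanti ⟨le_rfl, ht₀.1.2⟩ ⟨ht₀.1.2, le_rfl⟩ ht₀.1.2
  have h2 : y t₀ ≤ 0 := ht₀.2
  linarith

/-- Grönwall's inequality in differential form. -/
theorem le_mul_exp_of_hasDerivWithinAt {T C : ℝ} {y y' : ℝ → ℝ}
    (hy : ∀ t ∈ Icc 0 T, HasDerivWithinAt y (y' t) (Icc 0 T) t)
    (h : ∀ t ∈ Icc 0 T, y' t ≤ C * y t) : ∀ t ∈ Icc 0 T, y t ≤ y 0 * Real.exp (C * t) := by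
  have key := nonpos_of_hasDerivWithinAt (T := T)
    (y := fun t => y t * Real.exp (-(C * t)) - y 0)
    (y' := fun t => y' t * Real.exp (-(C * t)) + y t * (Real.exp (-(C * t)) * -(C * 1)))
    (fun t ht => ((hy t ht).mul
      (((hasDerivAt_id t).const_mul C).neg.exp.hasDerivWithinAt)).sub_const _) (by simp)
    (fun t ht _ => by
      have h1 := h t ht
      have h2 := Real.exp_pos (-(C * t))
      nlinarith)
  intro t ht
  have h1 := key t ht
  have h2 : y t = y t * Real.exp (-(C * t)) * Real.exp (C * t) := by
    rw [mul_assoc, ← Real.exp_add, neg_add_cancel, Real.exp_zero, mul_one]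
  rw [h2]
  gcongr
  linarith

/-! ### Derivatives of quadratic and quartic functionals -/

section Abstract

variable {H W : Type*} [NormedAddCommGroup H] [InnerProductSpace ℂ H] [NormedSpace ℝ H]
  [IsScalarTower ℝ ℂ H] [NormedAddCommGroup W] [InnerProductSpace ℂ W]

/-- In the interaction picture the linear part of the flow does not contribute to the derivative of
a norm which it preserves. -/
theorem hasDerivWithinAt_norm_sq_isometry [NormedSpace ℝ W] [IsScalarTower ℝ ℂ W]
    {S : ℝ → H ≃ₗᵢ[ℂ] H} {G : H →L[ℂ] W}
    (hG : ∀ t u v, inner ℂ (G (S t u)) (G (S t v)) = inner ℂ (G u) (G v))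
    (hS : ∀ t u, S t (S (-t) u) = u) {v : ℝ → H} {F : H} {s : Set ℝ} {t : ℝ}
    (hv : HasDerivWithinAt v (S (-t) F) s t) :
    HasDerivWithinAt (fun r => ‖G (S r (v r))‖ ^ 2)
      (2 * (inner ℂ (G (S t (v t))) (G F)).re) s t := by
  have h1 : (fun r => ‖G (S r (v r))‖ ^ 2) = fun r => (inner ℂ (G (v r)) (G (v r))).re := by
    funext r
    rw [← hG r, inner_self_eq_norm_sq_to_K]
    norm_cast
  have h2 : HasDerivWithinAt (fun r => G (v r)) (G (S (-t) F)) s t :=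
    (G.restrictScalars ℝ).hasFDerivAt.comp_hasDerivWithinAt t hv
  have h3 := Complex.reCLM.hasFDerivAt.comp_hasDerivWithinAt t (h2.inner ℂ h2)
  rw [h1]
  refine h3.congr_deriv ?_
  rw [← hG t (v t), ← hG t (S (-t) F), hS, Complex.reCLM_apply, Complex.add_re,
    ← inner_conj_symm (G F), Complex.conj_re]
  ring

omit [NormedSpace ℝ H] [IsScalarTower ℝ ℂ H] in
/-- A functional whose increments are pairings `⟨J r - J t, Φ r⟩`, with `J` differentiable in the
dual space and `Φ` merely continuous, is differentiable. -/
theorem hasDerivWithinAt_of_dual {J : ℝ → H →L[ℂ] ℂ} {D : H →L[ℂ] ℂ} {Φ : ℝ → H} {q : ℝ → ℝ}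
    {s : Set ℝ} {t : ℝ} (hJ : HasDerivWithinAt J D s t) (hΦ : ContinuousWithinAt Φ s t)
    (hq : ∀ r, q r - q t = ((J r - J t) (Φ r)).re) :
    HasDerivWithinAt q (D (Φ t)).re s t := by
  rw [hasDerivWithinAt_iff_tendsto_slope] at hJ ⊢
  have h1 : slope q t = fun r => ((slope J t r) (Φ r)).re := by
    funext r
    rw [slope_def_module, slope_def_module, hq, smul_apply, Complex.smul_re]
  rw [h1]
  have h2 : Continuous fun z : (H →L[ℂ] ℂ) × H => (z.1 z.2).re := by fun_prop
  exact (h2.tendsto (D, Φ t)).comp (hJ.prodMk_nhds (hΦ.mono_left (nhdsWithin_mono _ sdiff_subset)))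

end Abstract

variable {L : ℝ} [Fact (0 < L)]

/-- The quartic functional `∫ |u|⁴`. -/
def quartic (u : H1 L ℂ) : ℝ := ∫ y, ‖rep L u y‖ ^ 4

theorem massForm_eq_integral (u v : H1 L ℂ) :
    massForm L u v = ∫ y, rep L u y * rep L v y := by
  rw [massForm_apply, pair_apply]
  refine integral_congr_ae ?_
  filter_upwards [fn_ae u, fn_ae v] with y h1 h2
  rw [← h1, ← h2]
  rfl

theorem rep_mul_apply (u v : H1 L ℂ) (y : Torus L) :
    rep L (mulH1 L u v) y = rep L u y * rep L v y := by
  rw [rep_mulH1, ContinuousMap.mul_apply]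

theorem rep_add_apply (u v : H1 L ℂ) (y : Torus L) :
    rep L (u + v) y = rep L u y + rep L v y := by
  rw [map_add, ContinuousMap.add_apply]

theorem rep_sub_apply (u v : H1 L ℂ) (y : Torus L) :
    rep L (u - v) y = rep L u y - rep L v y := by
  rw [map_sub, ContinuousMap.sub_apply]

theorem rep_smul_apply (c : ℂ) (u : H1 L ℂ) (y : Torus L) :
    rep L (c • u) y = c * rep L u y := by
  rw [map_smul, ContinuousMap.smul_apply, smul_eq_mul]

theorem ext_rep {u v : H1 L ℂ} (h : ∀ y, rep L u y = rep L v y) : u = v := by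
  rw [← sub_eq_zero]
  refine eq_zero_of_inner_mode _ fun k => ?_
  rw [inner_mode, ← toL2_rep, map_sub, sub_eq_zero.2 (ContinuousMap.ext h), map_zero,
    inner_zero_right, mul_zero]

theorem norm_pow_four_sub (a b : ℂ) : ‖b‖ ^ 4 - ‖a‖ ^ 4 =
    ((b - a) * ((((‖a‖ ^ 2 : ℝ) : ℂ) + ((‖b‖ ^ 2 : ℝ) : ℂ)) *
      (starRingEnd ℂ) (a + b))).re := by
  have h4 : ∀ z : ℂ, ‖z‖ ^ 2 = z.re ^ 2 + z.im ^ 2 := fun z => by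
    rw [Complex.sq_norm, Complex.normSq_apply]; ring
  rw [show ‖b‖ ^ 4 = (‖b‖ ^ 2) ^ 2 by ring, show ‖a‖ ^ 4 = (‖a‖ ^ 2) ^ 2 by ring, h4, h4]
  simp only [Complex.mul_re, Complex.mul_im, Complex.add_re,
    Complex.add_im, Complex.sub_re, Complex.sub_im, Complex.conj_re, Complex.conj_im,
    Complex.ofReal_re, Complex.ofReal_im]
  ring

/-- The factor `(|a|² + |b|²) conj (a + b)`, for which `|b|⁴ - |a|⁴` is the real part of its product
with `b - a`. -/
def quarticIncrement (a b : H1 L ℂ) : H1 L ℂ := mulH1 L (absSq a + absSq b) (conjH1 L (a + b))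

theorem rep_quarticIncrement (a b : H1 L ℂ) (y : Torus L) : rep L (quarticIncrement a b) y =
    (((‖rep L a y‖ ^ 2 : ℝ) : ℂ) + ((‖rep L b y‖ ^ 2 : ℝ) : ℂ)) *
      (starRingEnd ℂ) (rep L a y + rep L b y) := by
  rw [quarticIncrement, rep_mul_apply, rep_add_apply, rep_conjH1, rep_add_apply, rep_absSq,
    rep_absSq]

theorem continuous_quarticIncrement (a : H1 L ℂ) : Continuous (quarticIncrement a) := by
  have h1 : LipBdd fun b : H1 L ℂ => absSq a + absSq b := (LipBdd.const _).add lipBdd_absSq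
  have h2 : LipBdd fun b : H1 L ℂ => conjH1 L (a + b) :=
    LipBdd.clm_comp _ ((LipBdd.const _).add (LipBdd.clm (ContinuousLinearMap.id ℂ _)))
  exact (LipBdd.bilin (mulH1 L) h1 h2).continuous

theorem quarticIncrement_self (a : H1 L ℂ) :
    quarticIncrement a a = (4 : ℂ) • conjH1 L (mulH1 L (absSq a) a) := by
  refine ext_rep fun y => ?_
  rw [rep_quarticIncrement, rep_smul_apply, rep_conjH1, rep_mul_apply, rep_absSq, map_mul,
    Complex.conj_ofReal, map_add]
  ring

theorem quartic_sub (a b : H1 L ℂ) :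
    quartic b - quartic a = ((massForm L b - massForm L a) (quarticIncrement a b)).re := by
  have hint : ∀ u : H1 L ℂ, Integrable fun y => ‖rep L u y‖ ^ 4 := fun u =>
    integrable_continuous ((rep L u).continuous.norm.pow 4)
  have h1 : Integrable fun y => rep L (b - a) y * rep L (quarticIncrement a b) y :=
    integrable_continuous ((rep L (b - a)).continuous.mul (rep L _).continuous)
  rw [quartic, quartic, ← integral_sub (hint b) (hint a), ← map_sub, massForm_eq_integral,
    ← RCLike.re_eq_complex_re, ← integral_re h1]
  refine integral_congr_ae (Filter.Eventually.of_forall fun y => ?_)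
  simp only [rep_quarticIncrement, rep_sub_apply]
  exact norm_pow_four_sub _ _

theorem continuousWithinAt_schrod {v : ℝ → H1 L ℂ} {s : Set ℝ} {t : ℝ}
    (hv : ContinuousWithinAt v s t) : ContinuousWithinAt (fun r => schrod r (v r)) s t :=
  continuous_schrod_uncurry.continuousAt.comp_continuousWithinAt
    (f := fun r => (r, v r)) (continuousWithinAt_id.prodMk hv)

/-- The derivative of `∫ |ψ|⁴` along the flow; `ψ` need only be continuous in `H¹` and
differentiable in its dual. -/
theorem hasDerivWithinAt_quartic {v : ℝ → H1 L ℂ} {F : H1 L ℂ} {s : Set ℝ} {t : ℝ}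
    (hv : HasDerivWithinAt v (schrod (-t) F) s t) :
    HasDerivWithinAt (fun r => quartic (schrod r (v r)))
      (4 * (((-(Complex.I / 2)) • stiffForm L (schrod t (v t)) + massForm L F)
        (conjH1 L (mulH1 L (absSq (schrod t (v t))) (schrod t (v t))))).re) s t := by
  have hJ := hasDerivWithinAt_massForm hv
  rw [schrod_schrod_neg] at hJ
  have hΦ : ContinuousWithinAt
      (fun r => quarticIncrement (schrod t (v t)) (schrod r (v r))) s t :=
    (continuous_quarticIncrement _).continuousAt.comp_continuousWithinAt
      (continuousWithinAt_schrod hv.continuousWithinAt)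
  have h := hasDerivWithinAt_of_dual hJ hΦ fun r => quartic_sub _ _
  refine h.congr_deriv ?_
  rw [quarticIncrement_self, map_smul, smul_eq_mul, ← Complex.re_ofReal_mul]
  norm_num

end Polariton

namespace Polariton

/-! ### The energy inequality -/

/-- Young's inequality for a factor `τ` whose square is controlled by `u w`. -/
theorem mul_le_of_sq_le {u w q τ A B K : ℝ} (hu : 0 ≤ u) (hw : 0 ≤ w) (hA : 0 ≤ A) (hB : 0 ≤ B)
    (hK : K ≤ 4 * A * B) (hτ : τ ^ 2 ≤ K * (u * w)) : q * τ ≤ A * (u * q ^ 2) + B * w := by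
  refine abs_le_of_sq_le_sq' ?_ (by positivity) |>.2
  have h1 : (q * τ) ^ 2 ≤ q ^ 2 * (K * (u * w)) := by
    rw [mul_pow]; gcongr
  have h2 : q ^ 2 * (K * (u * w)) ≤ q ^ 2 * (4 * A * B * (u * w)) := by gcongr
  nlinarith [sq_nonneg (A * (u * q ^ 2) - B * w)]

/-- The rate of change of the energy density, with `z`, `z'` the values of `ψ`, `∂ₓψ` and `n`, `n'`
those of `n`, `∂ₓn`. The contributions of the self-interaction cancel. -/
theorem energy_density_identity (p : Params) (z z' : ℂ) (n n' : ℝ) :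
    let F := -(Complex.I * p.g) * (((‖z‖ ^ 2 : ℝ) : ℂ) * z)
      + (-(Complex.I * p.lam) + p.R / 2) * ((n : ℂ) * z) + -(p.α / 2) * z
    let C' := 2 * ((‖z‖ ^ 2 : ℝ) : ℂ) * z' + z ^ 2 * (starRingEnd ℂ) z'
    let F' := -(Complex.I * p.g) * C'
      + (-(Complex.I * p.lam) + p.R / 2) * ((n : ℂ) * z' + (n' : ℂ) * z) + -(p.α / 2) * z'
    let G' := -((2 * p.R * ((starRingEnd ℂ) z * z').re * n + (p.R * ‖z‖ ^ 2 + p.β) * n') / p.ε)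
    2 * ((starRingEnd ℂ) z * F).re + 2 * ((starRingEnd ℂ) z' * F').re
      + p.g * (4 * (-(Complex.I / 2) * (z' * (starRingEnd ℂ) C')
        + F * (starRingEnd ℂ) (((‖z‖ ^ 2 : ℝ) : ℂ) * z)).re) + 2 * (n' * G') =
    (p.R * n - p.α) * (‖z‖ ^ 2 + ‖z'‖ ^ 2 + 2 * p.g * ‖z‖ ^ 4)
      + n' * (2 * p.lam * (z.im * z'.re - z.re * z'.im)
        + (p.R - 4 * p.R * n / p.ε) * (z.re * z'.re + z.im * z'.im))
      - (2 * p.R / p.ε * (‖z‖ ^ 2 * n' ^ 2) + 2 * p.β / p.ε * n' ^ 2) := by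
  have hε := p.ε_pos.ne'
  have h4 : ∀ z : ℂ, ‖z‖ ^ 2 = z.re ^ 2 + z.im ^ 2 := fun z => by
    rw [Complex.sq_norm, Complex.normSq_apply]; ring
  have h2 : ((2 : ℂ)).re = 2 ∧ ((2 : ℂ)).im = 0 := ⟨rfl, rfl⟩
  have hdiv : ∀ w : ℂ, w / 2 = ((1 / 2 : ℝ) : ℂ) * w := fun w => by push_cast; ring
  intro F C' F' G'
  simp only [F, C', F', G']
  rw [show ‖z‖ ^ 4 = (‖z‖ ^ 2) ^ 2 by ring, h4, h4]
  simp only [hdiv, sq z, Complex.mul_re, Complex.mul_im, Complex.add_re, Complex.add_im,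
    Complex.neg_re, Complex.neg_im, Complex.conj_re, Complex.conj_im, Complex.ofReal_re,
    Complex.ofReal_im, Complex.I_re, Complex.I_im, h2.1, h2.2]
  field_simp
  ring

theorem energy_density_bound (p : Params) {N : ℝ} (hN : 0 ≤ N) (z z' : ℂ) {n : ℝ} (n' : ℝ)
    (hn : 0 ≤ n) (hnN : n ≤ N) :
    (p.R * n - p.α) * (‖z‖ ^ 2 + ‖z'‖ ^ 2 + 2 * p.g * ‖z‖ ^ 4)
      + n' * (2 * p.lam * (z.im * z'.re - z.re * z'.im)
        + (p.R - 4 * p.R * n / p.ε) * (z.re * z'.re + z.im * z'.im))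
      - (2 * p.R / p.ε * (‖z‖ ^ 2 * n' ^ 2) + 2 * p.β / p.ε * n' ^ 2) ≤
    (2 * p.R * N + (4 * p.lam ^ 2 + (p.R + 4 * p.R * N / p.ε) ^ 2) * p.ε / (8 * p.R)) *
      (‖z‖ ^ 2 + ‖z'‖ ^ 2 + p.g * ‖z‖ ^ 4 + n' ^ 2) := by
  have hε := p.ε_pos
  have hR := p.R_pos
  have hβ := p.β_pos
  have hα := p.α_pos
  have hg := p.g_pos
  have h4 : ∀ z : ℂ, ‖z‖ ^ 2 = z.re ^ 2 + z.im ^ 2 := fun z => by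
    rw [Complex.sq_norm, Complex.normSq_apply]; ring
  set κ := p.R - 4 * p.R * n / p.ε with hκ
  set K := 4 * p.lam ^ 2 + (p.R + 4 * p.R * N / p.ε) ^ 2 with hK
  have hKpos : 0 ≤ K := by positivity
  -- `K = 4 (2R / ε) B`, so that Young's inequality uses exactly the damping
  set B := K * p.ε / (8 * p.R) with hB
  have hBpos : 0 ≤ B := by positivity
  have hnn : 4 * p.R * n / p.ε ≤ 4 * p.R * N / p.ε := by gcongr
  have hn0 : 0 ≤ 4 * p.R * n / p.ε := by positivity
  have hκ2 : κ ^ 2 ≤ (p.R + 4 * p.R * N / p.ε) ^ 2 := by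
    refine sq_le_sq' ?_ ?_ <;> rw [hκ] <;> linarith
  have hτ : (2 * p.lam * (z.im * z'.re - z.re * z'.im) + κ * (z.re * z'.re + z.im * z'.im)) ^ 2
      ≤ K * (‖z‖ ^ 2 * ‖z'‖ ^ 2) := by
    have h5 : ‖z‖ ^ 2 * ‖z'‖ ^ 2 =
        (z.im * z'.re - z.re * z'.im) ^ 2 + (z.re * z'.re + z.im * z'.im) ^ 2 := by
      rw [h4, h4]; ring
    have h6 : (2 * p.lam * (z.im * z'.re - z.re * z'.im) +
        κ * (z.re * z'.re + z.im * z'.im)) ^ 2 ≤ (4 * p.lam ^ 2 + κ ^ 2) *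
        ((z.im * z'.re - z.re * z'.im) ^ 2 + (z.re * z'.re + z.im * z'.im) ^ 2) := by
      nlinarith [sq_nonneg (2 * p.lam * (z.re * z'.re + z.im * z'.im) -
        κ * (z.im * z'.re - z.re * z'.im))]
    rw [h5]
    refine h6.trans ?_
    gcongr
    linarith
  have h7 := mul_le_of_sq_le (q := n') (u := ‖z‖ ^ 2) (w := ‖z'‖ ^ 2) (A := 2 * p.R / p.ε) (B := B)
    (by positivity) (by positivity) (by positivity) hBpos
    (le_of_eq (by rw [hB]; field_simp; ring)) hτ
  have h8 : (p.R * n - p.α) * (‖z‖ ^ 2 + ‖z'‖ ^ 2 + 2 * p.g * ‖z‖ ^ 4) ≤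
      p.R * N * (‖z‖ ^ 2 + ‖z'‖ ^ 2 + 2 * p.g * ‖z‖ ^ 4) := by
    gcongr
    nlinarith
  have h9 : 0 ≤ 2 * p.β / p.ε * n' ^ 2 := by positivity
  have h10 : 0 ≤ p.R * N * (‖z‖ ^ 2 + ‖z'‖ ^ 2) := by positivity
  have h11 : 0 ≤ (2 * p.R * N) * n' ^ 2 := by positivity
  have h12 : 0 ≤ B * (‖z‖ ^ 2 + p.g * ‖z‖ ^ 4 + n' ^ 2) := by positivity
  linarith

/-- The rate of change of the energy density is at most a multiple of the energy density: the
product of `|∂ₓn| |ψ|` and `|∂ₓψ|` is absorbed by the damping of `∂ₓn`. Here `z`, `z'`, `n`, `n'`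
are the values of `ψ`, `∂ₓψ`, `n`, `∂ₓn`, and `z₀` is that of `ψ` again; `f`, `f'`, `g'` stand for
the forcing term, its derivative and the derivative of the reservoir rate, `w` and `w'` for the
conjugate of `|ψ|² ψ` and its derivative. -/
theorem energy_density_le (p : Params) {N : ℝ} (hN : 0 ≤ N) {z₀ z z' f f' w w' c' : ℂ}
    {n n' g' : ℝ} (hn : 0 ≤ n) (hnN : n ≤ N) (hz : z₀ = z)
    (hf : f = -(Complex.I * p.g) * (((‖z‖ ^ 2 : ℝ) : ℂ) * z)
      + (-(Complex.I * p.lam) + p.R / 2) * ((n : ℂ) * z) + -(p.α / 2) * z)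
    (hf' : f' = -(Complex.I * p.g) *
        (2 * ((‖z‖ ^ 2 : ℝ) : ℂ) * z' + z ^ 2 * (starRingEnd ℂ) z')
      + (-(Complex.I * p.lam) + p.R / 2) * ((n : ℂ) * z' + (n' : ℂ) * z) + -(p.α / 2) * z')
    (hg' : g' = -((2 * p.R * ((starRingEnd ℂ) z * z').re * n +
      (p.R * ‖z‖ ^ 2 + p.β) * n') / p.ε))
    (hw : w = (starRingEnd ℂ) (((‖z‖ ^ 2 : ℝ) : ℂ) * z)) (hw' : w' = (starRingEnd ℂ) c')
    (hc' : c' = 2 * ((‖z‖ ^ 2 : ℝ) : ℂ) * z' + z ^ 2 * (starRingEnd ℂ) z') :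
    2 * ((starRingEnd ℂ) z₀ * f).re + 2 * ((starRingEnd ℂ) z' * f').re
      + p.g * (4 * (-(Complex.I / 2) * (z' * w') + f * w).re) + 2 * (n' * g') ≤
    (2 * p.R * N + (4 * p.lam ^ 2 + (p.R + 4 * p.R * N / p.ε) ^ 2) * p.ε / (8 * p.R)) *
      (‖z‖ ^ 2 + ‖z'‖ ^ 2 + p.g * ‖z‖ ^ 4 + n' ^ 2) := by
  subst hz hf hf' hg' hw hw' hc'
  exact (energy_density_identity p z₀ z' n n').trans_le (energy_density_bound p hN z₀ z' n' hn hnN)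

variable {L : ℝ} [Fact (0 < L)]

/-! ### Functionals as integrals -/

theorem integrable_mul_L2 {𝕜 : Type} [RCLike 𝕜] (u v : L2 L 𝕜) :
    Integrable fun y => u y * v y :=
  (Lp.memLp u).integrable_mul (Lp.memLp v)

theorem integrable_re_inner (u v : L2 L ℂ) :
    Integrable fun y => ((starRingEnd ℂ) (u y) * v y).re := by
  have h := (L2.integrable_inner (𝕜 := ℂ) u v).re
  refine h.congr (Filter.Eventually.of_forall fun y => ?_)
  simp only [RCLike.inner_apply, RCLike.re_eq_complex_re, mul_comm]

theorem re_inner_L2 (u v : L2 L ℂ) :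
    (inner ℂ u v).re = ∫ y, ((starRingEnd ℂ) (u y) * v y).re := by
  rw [L2.inner_def, ← RCLike.re_eq_complex_re, ← integral_re (L2.integrable_inner u v)]
  refine integral_congr_ae (Filter.Eventually.of_forall fun y => ?_)
  simp only [RCLike.inner_apply, mul_comm]

theorem inner_L2_real (u v : L2 L ℝ) : inner ℝ u v = ∫ y, u y * v y := by
  rw [L2.inner_def]
  refine integral_congr_ae (Filter.Eventually.of_forall fun y => ?_)
  exact mul_comm _ _

theorem norm_sq_L2 {𝕜 : Type} [RCLike 𝕜] (u : L2 L 𝕜) : ‖u‖ ^ 2 = ∫ y, ‖u y‖ ^ 2 := by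
  have h := L2.inner_def (𝕜 := 𝕜) u u
  rw [inner_self_eq_norm_sq_to_K] at h
  simp_rw [inner_self_eq_norm_sq_to_K] at h
  have h2 : ∫ y, ((‖u y‖ : 𝕜)) ^ 2 = ((∫ y, ‖u y‖ ^ 2 : ℝ) : 𝕜) := by
    rw [← integral_ofReal]
    simp
  rw [h2] at h
  exact_mod_cast h

theorem integrable_norm_sq_L2 {𝕜 : Type} [RCLike 𝕜] (u : L2 L 𝕜) :
    Integrable fun y => ‖u y‖ ^ 2 := (Lp.memLp u).integrable_norm_pow (by norm_num)

/-- The modified energy `‖ψ‖² + ‖∂ₓψ‖² + g ∫ |ψ|⁴ + ‖∂ₓn‖²`; its quartic part makes up for the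
self-interaction. -/
def energy (p : Params) (u : H1 L ℂ) (n : H1 L ℝ) : ℝ :=
  ‖fstL L ℂ u‖ ^ 2 + ‖sndL L ℂ u‖ ^ 2 + p.g * quartic u + ‖sndL L ℝ n‖ ^ 2

theorem energy_eq_integral (p : Params) (u : H1 L ℂ) (n : H1 L ℝ) :
    Integrable (fun y => ‖rep L u y‖ ^ 2 + ‖weakDx u y‖ ^ 2 + p.g * ‖rep L u y‖ ^ 4 +
      weakDx n y ^ 2) ∧
    energy p u n = ∫ y, (‖rep L u y‖ ^ 2 + ‖weakDx u y‖ ^ 2 + p.g * ‖rep L u y‖ ^ 4 +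
      weakDx n y ^ 2) := by
  have i1 : Integrable fun y => ‖rep L u y‖ ^ 2 :=
    integrable_continuous ((rep L u).continuous.norm.pow 2)
  have i2 : Integrable fun y => ‖weakDx u y‖ ^ 2 := integrable_norm_sq_L2 (sndL L ℂ u)
  have i3 : Integrable fun y => p.g * ‖rep L u y‖ ^ 4 :=
    (integrable_continuous ((rep L u).continuous.norm.pow 4)).const_mul _
  have i4 : Integrable fun y => weakDx n y ^ 2 := by
    have h := integrable_norm_sq_L2 (sndL L ℝ n)
    simp only [Real.norm_eq_abs, sq_abs] at h
    exact h
  refine ⟨((i1.add i2).add i3).add i4, ?_⟩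
  have e1 : ‖fstL L ℂ u‖ ^ 2 = ∫ y, ‖rep L u y‖ ^ 2 := by
    rw [norm_sq_L2]
    refine integral_congr_ae ?_
    filter_upwards [fn_ae u] with y h
    rw [← h]
    rfl
  have e2 : ‖sndL L ℂ u‖ ^ 2 = ∫ y, ‖weakDx u y‖ ^ 2 := norm_sq_L2 _
  have e4 : ‖sndL L ℝ n‖ ^ 2 = ∫ y, weakDx n y ^ 2 := by
    rw [norm_sq_L2]
    simp only [Real.norm_eq_abs, sq_abs]
    rfl
  have s1 := integral_add ((i1.add i2).add i3) i4
  have s2 := integral_add (i1.add i2) i3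
  have s3 := integral_add i1 i2
  simp only [Pi.add_apply] at s1 s2 s3
  rw [s1, s2, s3, integral_const_mul, energy, e1, e2, e4, quartic]

theorem quartic_nonneg (u : H1 L ℂ) : 0 ≤ quartic u := integral_nonneg fun y => by positivity

/-- The rate of change of the energy in the state `x`. The third term is the value of `∂ₜψ`, taken
in the dual of `H¹`, at the conjugate of `4 |ψ|² ψ`. -/
def energyRate (p : Params) (x : Phase L) : ℝ :=
  2 * (inner ℂ (fstL L ℂ x.1) (fstL L ℂ (waveForce p x))).re
    + 2 * (inner ℂ (sndL L ℂ x.1) (sndL L ℂ (waveForce p x))).re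
    + p.g * (4 * (((-(Complex.I / 2)) • stiffForm L x.1 + massForm L (waveForce p x))
        (conjH1 L (mulH1 L (absSq x.1) x.1))).re)
    + 2 * inner ℝ (sndL L ℝ x.2) (sndL L ℝ (reservoirForce p x))

theorem dual_eq_integral (u w F : H1 L ℂ) :
    Integrable (fun y => (-(Complex.I / 2) * (weakDx u y * weakDx w y) + fn F y * fn w y).re) ∧
    (((-(Complex.I / 2)) • stiffForm L u + massForm L F) w).re =
      ∫ y, (-(Complex.I / 2) * (weakDx u y * weakDx w y) + fn F y * fn w y).re := by
  have i1 : Integrable fun y => -(Complex.I / 2) * (weakDx u y * weakDx w y) :=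
    (integrable_mul_L2 (sndL L ℂ u) (sndL L ℂ w)).const_mul _
  have i2 : Integrable fun y => fn F y * fn w y := integrable_mul_L2 (fstL L ℂ F) (fstL L ℂ w)
  have i3 : Integrable fun y => -(Complex.I / 2) * (weakDx u y * weakDx w y) + fn F y * fn w y :=
    i1.add i2
  refine ⟨i3.re, ?_⟩
  have h1 : ((-(Complex.I / 2)) • stiffForm L u + massForm L F) w =
      ∫ y, (-(Complex.I / 2) * (weakDx u y * weakDx w y) + fn F y * fn w y) := by
    rw [integral_add i1 i2, integral_const_mul, add_apply, smul_apply, stiffForm_apply,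
      massForm_apply, pair_apply, pair_apply]
    rfl
  rw [h1, ← RCLike.re_eq_complex_re, ← integral_re i3]

theorem energyRate_eq_integral (p : Params) (x : Phase L) :
    let w := conjH1 L (mulH1 L (absSq x.1) x.1)
    let d : Torus L → ℝ := fun y =>
      2 * ((starRingEnd ℂ) (fn x.1 y) * fn (waveForce p x) y).re
        + 2 * ((starRingEnd ℂ) (weakDx x.1 y) * weakDx (waveForce p x) y).re
        + p.g * (4 * (-(Complex.I / 2) * (weakDx x.1 y * weakDx w y)
          + fn (waveForce p x) y * fn w y).re)
        + 2 * (weakDx x.2 y * weakDx (reservoirForce p x) y)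
    Integrable d ∧ energyRate p x = ∫ y, d y := by
  intro w d
  obtain ⟨i3, e3⟩ := dual_eq_integral x.1 w (waveForce p x)
  have i1 : Integrable fun y => 2 * ((starRingEnd ℂ) (fn x.1 y) * fn (waveForce p x) y).re :=
    (integrable_re_inner (fstL L ℂ x.1) (fstL L ℂ (waveForce p x))).const_mul 2
  have i2 : Integrable fun y =>
      2 * ((starRingEnd ℂ) (weakDx x.1 y) * weakDx (waveForce p x) y).re :=
    (integrable_re_inner (sndL L ℂ x.1) (sndL L ℂ (waveForce p x))).const_mul 2
  have i3' := (i3.const_mul 4).const_mul p.g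
  have i4 : Integrable fun y => 2 * (weakDx x.2 y * weakDx (reservoirForce p x) y) :=
    (integrable_mul_L2 (sndL L ℝ x.2) (sndL L ℝ (reservoirForce p x))).const_mul 2
  refine ⟨((i1.add i2).add i3').add i4, ?_⟩
  have s1 := integral_add ((i1.add i2).add i3') i4
  have s2 := integral_add (i1.add i2) i3'
  have s3 := integral_add i1 i2
  simp only [Pi.add_apply] at s1 s2 s3
  refine Eq.trans ?_ s1.symm
  rw [s2, s3, integral_const_mul, integral_const_mul, integral_const_mul, integral_const_mul,
    integral_const_mul, energyRate, re_inner_L2, re_inner_L2, e3, inner_L2_real]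
  rfl

/-- The energy inequality. -/
theorem energyRate_le (p : Params) {N : ℝ} (hN : 0 ≤ N) (x : Phase L)
    (hn : ∀ y, 0 ≤ repR L x.2 y ∧ repR L x.2 y ≤ N) :
    energyRate p x ≤
      (2 * p.R * N + (4 * p.lam ^ 2 + (p.R + 4 * p.R * N / p.ε) ^ 2) * p.ε / (8 * p.R)) *
        energy p x.1 x.2 := by
  obtain ⟨i1, e1⟩ := energyRate_eq_integral p x
  obtain ⟨i2, e2⟩ := energy_eq_integral p x.1 x.2
  rw [e1, e2, ← integral_const_mul]
  refine integral_mono_ae i1 (i2.const_mul _) ?_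
  filter_upwards [fn_ae x.1, fn_ae (waveForce p x),
    fn_ae (conjH1 L (mulH1 L (absSq x.1) x.1)), weakDx_waveForce p x,
    weakDx_reservoirForce p x, weakDx_cubic x.1,
    weakDx_mapH1 (Complex.conjCLE : ℂ →L[ℝ] ℂ) (mulH1 L (absSq x.1) x.1)]
    with y h1 h2 h3 h4 h5 h6 h7
  exact energy_density_le p hN (hn y).1 (hn y).2 h1 (h2.trans (rep_waveForce p x y)) h4 h5
    (h3.trans ((rep_conjH1 _ y).trans (congrArg (starRingEnd ℂ) ((rep_mul_apply _ _ y).trans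
      (congrArg (· * rep L x.1 y) (rep_absSq x.1 y)))))) h7 h6

end Polariton

namespace Polariton

variable {L : ℝ} [Fact (0 < L)]

/-! ### A priori bounds -/

/-- The state `(ψ, n)` at time `t` from the interaction picture. -/
def physical (x : ℝ → Phase L) (t : ℝ) : Phase L := (schrod t (x t).1, (x t).2)

theorem SolvesOn.fst {p : Params} {s : Set ℝ} {x : ℝ → Phase L} (h : SolvesOn (field p) s x)
    {t : ℝ} (ht : t ∈ s) : HasDerivWithinAt (fun r => (x r).1)
      (schrod (-t) (waveForce p (physical x t))) s t :=
  (ContinuousLinearMap.fst ℝ (H1 L ℂ) (H1 L ℝ)).hasFDerivAt.comp_hasDerivWithinAt t (h t ht)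

theorem SolvesOn.snd {p : Params} {s : Set ℝ} {x : ℝ → Phase L} (h : SolvesOn (field p) s x)
    {t : ℝ} (ht : t ∈ s) : HasDerivWithinAt (fun r => (x r).2)
      (reservoirForce p (physical x t)) s t :=
  (ContinuousLinearMap.snd ℝ (H1 L ℂ) (H1 L ℝ)).hasFDerivAt.comp_hasDerivWithinAt t (h t ht)

theorem SolvesOn.repR {p : Params} {s : Set ℝ} {x : ℝ → Phase L} (h : SolvesOn (field p) s x)
    {t : ℝ} (ht : t ∈ s) (y : Torus L) : HasDerivWithinAt (fun r => repR L (x r).2 y)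
      ((p.P - (p.R * ‖rep L (physical x t).1 y‖ ^ 2 + p.β) * Polariton.repR L (x t).2 y) / p.ε)
      s t := by
  have h1 := (evalR y).hasFDerivAt.comp_hasDerivWithinAt t (h.snd ht)
  refine h1.congr_deriv ?_
  rw [evalR_apply, repR_reservoirForce]
  rfl

/-- The reservoir stays nonnegative and bounded, by comparison at each point of the torus. -/
theorem reservoir_bounds {p : Params} {T N : ℝ} {x : ℝ → Phase L}
    (h : SolvesOn (field p) (Icc 0 T) x) (hN : p.P / p.β ≤ N)
    (h0 : ∀ y, 0 ≤ repR L (x 0).2 y ∧ repR L (x 0).2 y ≤ N) :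
    ∀ t ∈ Icc 0 T, ∀ y, 0 ≤ repR L (x t).2 y ∧ repR L (x t).2 y ≤ N := by
  intro t ht y
  have hP := p.P_pos
  have hR := p.R_pos
  have hβ := p.β_pos
  have hε := p.ε_pos
  have hPN : p.P ≤ p.β * N := by rwa [div_le_iff₀' hβ] at hN
  have hNpos : 0 ≤ N := (div_pos hP hβ).le.trans hN
  constructor
  · have key := nonpos_of_hasDerivWithinAt (T := T) (y := fun r => -repR L (x r).2 y)
      (fun r hr => (h.repR hr y).neg) (by simpa using (h0 y).1) (fun r hr hpos => by
        rw [neg_nonpos]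
        refine div_nonneg ?_ hε.le
        have h2 : 0 ≤ p.R * ‖rep L (physical x r).1 y‖ ^ 2 + p.β := by positivity
        nlinarith) t ht
    linarith
  · have key := nonpos_of_hasDerivWithinAt (T := T) (y := fun r => repR L (x r).2 y - N)
      (fun r hr => (h.repR hr y).sub_const N) (by simpa using (h0 y).2) (fun r hr hpos => by
        refine div_nonpos_of_nonpos_of_nonneg ?_ hε.le
        have h2 : 0 ≤ p.R * ‖rep L (physical x r).1 y‖ ^ 2 := by positivity
        have h3 : 0 ≤ p.R * ‖rep L (physical x r).1 y‖ ^ 2 * Polariton.repR L (x r).2 y :=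
          mul_nonneg h2 (by linarith)
        nlinarith) t ht
    linarith

theorem hasDerivWithinAt_energy {p : Params} {s : Set ℝ} {x : ℝ → Phase L}
    (h : SolvesOn (field p) s x) {t : ℝ} (ht : t ∈ s) :
    HasDerivWithinAt (fun r => energy p (physical x r).1 (physical x r).2)
      (energyRate p (physical x t)) s t := by
  have h1 := hasDerivWithinAt_norm_sq_isometry (G := fstL L ℂ) schrod_inner_fst schrod_schrod_neg
    (h.fst ht)
  have h2 := hasDerivWithinAt_norm_sq_isometry (G := sndL L ℂ) schrod_inner_snd schrod_schrod_neg
    (h.fst ht)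
  have h3 := hasDerivWithinAt_quartic (h.fst ht)
  have h4 : HasDerivWithinAt (fun r => sndL L ℝ (x r).2)
      (sndL L ℝ (reservoirForce p (physical x t))) s t :=
    (sndL L ℝ).hasFDerivAt.comp_hasDerivWithinAt t (h.snd ht)
  exact ((h1.add h2).add (h3.const_mul p.g)).add h4.norm_sq

theorem norm_fstL_le_of_repR {N : ℝ} (u : H1 L ℝ) (hu : ∀ y, 0 ≤ repR L u y ∧ repR L u y ≤ N) :
    ‖fstL L ℝ u‖ ^ 2 ≤ N ^ 2 * L := by
  have hL : (0 : ℝ) < L := Fact.out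
  have h1 : ∫ _ : Torus L, N ^ 2 = N ^ 2 * L := by
    rw [integral_const]
    simp [measureReal_def, hL.le, mul_comm]
  rw [norm_sq_L2, ← h1]
  refine integral_mono_ae (integrable_norm_sq_L2 _) (integrable_const _) ?_
  filter_upwards [repR_ae u] with y hy
  have h2 : fstL L ℝ u y = repR L u y := hy
  rw [h2, Real.norm_eq_abs, sq_abs]
  exact pow_le_pow_left₀ (hu y).1 (hu y).2 2

/-- The a priori bound in the phase space on a bounded interval of time. -/
theorem exists_bound (p : Params) {x₀ : Phase L} (h0 : ∀ y, 0 ≤ repR L x₀.2 y) (T : ℝ) :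
    ∃ B₀ : ℝ, ∀ τ, 0 < τ → τ ≤ T → ∀ x : ℝ → Phase L, x 0 = x₀ →
      SolvesOn (field p) (Icc 0 τ) x → ‖x τ‖ ≤ B₀ := by
  obtain ⟨N₀, hN₀⟩ := (isCompact_range (continuous_repR x₀.2)).isBounded.exists_norm_le
  set N := max N₀ (p.P / p.β) with hN
  have hNpos : 0 ≤ N := (div_pos p.P_pos p.β_pos).le.trans (le_max_right _ _)
  have h0N : ∀ y, 0 ≤ repR L x₀.2 y ∧ repR L x₀.2 y ≤ N := fun y =>
    ⟨h0 y, (le_abs_self _).trans ((hN₀ _ ⟨y, rfl⟩).trans (le_max_left _ _))⟩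
  set C := 2 * p.R * N + (4 * p.lam ^ 2 + (p.R + 4 * p.R * N / p.ε) ^ 2) * p.ε / (8 * p.R) with hC
  have hCpos : 0 ≤ C := by
    have := p.R_pos
    have := p.ε_pos
    positivity
  have energy_nonneg : ∀ u : H1 L ℂ, ∀ n : H1 L ℝ, 0 ≤ energy p u n := fun u n => by
    have := p.g_pos
    have := quartic_nonneg u
    unfold energy
    positivity
  set E := energy p x₀.1 x₀.2 * Real.exp (C * T) with hE
  refine ⟨Real.sqrt (N ^ 2 * L + E), fun τ hτ hτT x hx0 hx => ?_⟩
  have hbd := reservoir_bounds hx (le_max_right _ _) (fun y => by rw [hx0]; exact h0N y)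
  have hgr := le_mul_exp_of_hasDerivWithinAt (fun t ht => hasDerivWithinAt_energy hx ht)
    (fun t ht => energyRate_le p hNpos (physical x t) (hbd t ht)) τ ⟨hτ.le, le_rfl⟩
  have hx0' : physical x 0 = x₀ := by rw [physical, schrod_zero, hx0]
  rw [hx0'] at hgr
  have hE' : energy p (physical x τ).1 (physical x τ).2 ≤ E := by
    refine hgr.trans ?_
    rw [hE]
    have := energy_nonneg x₀.1 x₀.2
    gcongr
  have hq : 0 ≤ p.g * quartic (physical x τ).1 := mul_nonneg p.g_pos.le (quartic_nonneg _)
  have hn := norm_fstL_le_of_repR (x τ).2 (hbd τ ⟨hτ.le, le_rfl⟩)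
  have hL : (0 : ℝ) < L := Fact.out
  have hNL : 0 ≤ N ^ 2 * L := by positivity
  have e1 := H1_norm_sq (physical x τ).1
  have e2 := H1_norm_sq (x τ).2
  have e3 : ‖(physical x τ).1‖ = ‖(x τ).1‖ := LinearIsometryEquiv.norm_map _ _
  have e4 : (physical x τ).2 = (x τ).2 := rfl
  rw [energy, e4] at hE'
  rw [e3] at e1
  rw [Prod.norm_def]
  refine max_le (Real.le_sqrt_of_sq_le ?_) (Real.le_sqrt_of_sq_le ?_)
  · rw [e1]
    nlinarith [sq_nonneg ‖sndL L ℝ (x τ).2‖]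
  · rw [e2]
    nlinarith [sq_nonneg ‖sndL L ℂ (physical x τ).1‖, sq_nonneg ‖fstL L ℂ (physical x τ).1‖]

/-! ### Boundedness of the total mass -/

theorem integral_fn_eq (n : H1 L ℝ) : ∫ y, fn n y = ∫ y, repR L n y := integral_congr_ae (repR_ae n)

/-- The integral over the torus as a functional on `H¹`. -/
def integralH1 (L : ℝ) [Fact (0 < L)] : H1 L ℝ →L[ℝ] ℝ :=
  ((pair L ℝ).flip (toL2 L ℝ 1)).comp (fstL L ℝ)

theorem integralH1_apply (n : H1 L ℝ) : integralH1 L n = ∫ y, repR L n y := by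
  rw [← integral_fn_eq]
  refine (pair_toL2 (fstL L ℝ n) (φ := fun _ => (1 : ℝ)) continuous_const).trans ?_
  simp only [mul_one]
  rfl

theorem norm_sq_fstL (u : H1 L ℂ) : ‖fstL L ℂ u‖ ^ 2 = ∫ y, ‖rep L u y‖ ^ 2 := by
  rw [norm_sq_L2]
  refine integral_congr_ae ?_
  filter_upwards [fn_ae u] with y h
  rw [← h]
  rfl

theorem totalMass_eq (p : Params) (u : H1 L ℂ) (n : H1 L ℝ) :
    totalMass p u n = ‖fstL L ℂ u‖ ^ 2 + p.ε * integralH1 L n := by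
  rw [totalMass, integralH1_apply, integral_fn_eq, norm_sq_L2]
  rfl

/-- The mass balance: the gain `R n |ψ|²` of the condensate is the loss of the reservoir. -/
theorem mass_balance (p : Params) (x : Phase L) :
    2 * (inner ℂ (fstL L ℂ x.1) (fstL L ℂ (waveForce p x))).re
      + p.ε * integralH1 L (reservoirForce p x) =
    p.P * L - p.α * ‖fstL L ℂ x.1‖ ^ 2 - p.β * integralH1 L x.2 := by
  have hL : (0 : ℝ) < L := Fact.out
  have hε := p.ε_pos.ne'
  have e1 : (inner ℂ (fstL L ℂ x.1) (fstL L ℂ (waveForce p x))).re =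
      ∫ y, (p.R * repR L x.2 y - p.α) / 2 * ‖rep L x.1 y‖ ^ 2 := by
    rw [re_inner_L2]
    refine integral_congr_ae ?_
    filter_upwards [fn_ae x.1, fn_ae (waveForce p x)] with y h1 h2
    have h1' : fstL L ℂ x.1 y = rep L x.1 y := h1
    have h2' : fstL L ℂ (waveForce p x) y = rep L (waveForce p x) y := h2
    have hdiv : ∀ w : ℂ, w / 2 = ((1 / 2 : ℝ) : ℂ) * w := fun w => by push_cast; ring
    have h4 : ∀ z : ℂ, ‖z‖ ^ 2 = z.re ^ 2 + z.im ^ 2 := fun z => by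
      rw [Complex.sq_norm, Complex.normSq_apply]; ring
    rw [h1', h2', rep_waveForce, h4]
    simp only [hdiv, Complex.mul_re, Complex.mul_im, Complex.add_re, Complex.add_im,
      Complex.neg_re, Complex.neg_im, Complex.conj_re, Complex.conj_im, Complex.ofReal_re,
      Complex.ofReal_im, Complex.I_re, Complex.I_im]
    ring
  have cr : Continuous (repR L x.2) := continuous_repR x.2
  have cψ : Continuous fun y => ‖rep L x.1 y‖ ^ 2 := (rep L x.1).continuous.norm.pow 2
  rw [e1, integralH1_apply, integralH1_apply, norm_sq_fstL]
  simp_rw [repR_reservoirForce]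
  have e2 : ∫ _ : Torus L, p.P = p.P * L := by
    rw [integral_const]
    simp [measureReal_def, hL.le, mul_comm]
  rw [← e2, ← integral_const_mul, ← integral_const_mul, ← integral_const_mul, ← integral_const_mul,
    ← integral_add, ← integral_sub, ← integral_sub]
  · refine integral_congr_ae (Filter.Eventually.of_forall fun y => ?_)
    simp only
    field_simp
    ring
  all_goals exact integrable_continuous (by fun_prop)

/-- The total mass is bounded along solutions with a nonnegative reservoir. -/
theorem totalMass_bounds {p : Params} {T : ℝ} {x : ℝ → Phase L}
    (h : SolvesOn (field p) (Icc 0 T) x) (hn : ∀ t ∈ Icc 0 T, ∀ y, 0 ≤ repR L (x t).2 y) :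
    ∀ t ∈ Icc 0 T, 0 ≤ totalMass p (physical x t).1 (physical x t).2 ∧
      totalMass p (physical x t).1 (physical x t).2 ≤
        max (totalMass p (physical x 0).1 (physical x 0).2) (p.P * L / min p.α (p.β / p.ε)) := by
  have hε := p.ε_pos
  have hγ : 0 < min p.α (p.β / p.ε) := lt_min p.α_pos (div_pos p.β_pos hε)
  have hint : ∀ t ∈ Icc 0 T, 0 ≤ integralH1 L (x t).2 := fun t ht => by
    rw [integralH1_apply]
    exact integral_nonneg (hn t ht)
  have hd : ∀ t ∈ Icc 0 T, HasDerivWithinAt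
      (fun r => totalMass p (physical x r).1 (physical x r).2)
      (p.P * L - p.α * ‖fstL L ℂ (physical x t).1‖ ^ 2 - p.β * integralH1 L (x t).2)
      (Icc 0 T) t := by
    intro t ht
    have h1 := hasDerivWithinAt_norm_sq_isometry (G := fstL L ℂ) schrod_inner_fst
      schrod_schrod_neg (h.fst ht)
    have h2 : HasDerivWithinAt (fun r => integralH1 L (x r).2)
        (integralH1 L (reservoirForce p (physical x t))) (Icc 0 T) t :=
      (integralH1 L).hasFDerivAt.comp_hasDerivWithinAt t (h.snd ht)
    simp_rw [totalMass_eq]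
    exact (h1.add (h2.const_mul p.ε)).congr_deriv (mass_balance p (physical x t))
  intro t ht
  constructor
  · rw [totalMass_eq]
    have : 0 ≤ p.ε * integralH1 L (physical x t).2 := mul_nonneg hε.le (hint t ht)
    positivity
  · rw [← sub_nonpos]
    refine nonpos_of_hasDerivWithinAt (fun r hr => (hd r hr).sub_const _) ?_ ?_ t ht
    · exact sub_nonpos.2 (le_max_left _ _)
    · intro r hr hpos
      have h1 : p.P * L / min p.α (p.β / p.ε) < totalMass p (physical x r).1 (physical x r).2 :=
        (le_max_right _ _).trans_lt (sub_pos.1 hpos)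
      rw [div_lt_iff₀ hγ, totalMass_eq] at h1
      have h2 : min p.α (p.β / p.ε) * ‖fstL L ℂ (physical x r).1‖ ^ 2 ≤
          p.α * ‖fstL L ℂ (physical x r).1‖ ^ 2 := by
        gcongr
        exact min_le_left _ _
      have h3 : min p.α (p.β / p.ε) * (p.ε * integralH1 L (x r).2) ≤
          p.β / p.ε * (p.ε * integralH1 L (x r).2) :=
        mul_le_mul_of_nonneg_right (min_le_right _ _) (mul_nonneg hε.le (hint r hr))
      have h4 : p.β / p.ε * (p.ε * integralH1 L (x r).2) = p.β * integralH1 L (x r).2 := by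
        field_simp
      have e4 : (physical x r).2 = (x r).2 := rfl
      rw [e4] at h1
      nlinarith

end Polariton

namespace Polariton

/-! ### The weak formulation -/

section Abstract

theorem continuousOn_isometry_neg {H : Type*} [NormedAddCommGroup H] [InnerProductSpace ℂ H]
    {S : ℝ → H ≃ₗᵢ[ℂ] H} (hS : ∀ u, Continuous fun t => S t u) {w : ℝ → H} {s : Set ℝ}
    (hw : ContinuousOn w s) : ContinuousOn (fun t => S (-t) (w t)) s :=
  (continuous_uncurry_isometry hS).comp_continuousOn (continuous_neg.continuousOn.prodMk hw)

variable {X : Type*} [NormedAddCommGroup X] [NormedSpace ℝ X] [CompleteSpace X]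

/-- A continuous curve is differentiable with a given continuous derivative if this holds after
composition with each member of a separating family of functionals. -/
theorem hasDerivWithinAt_of_functionals {ι E : Type*} [NormedAddCommGroup E] [NormedSpace ℝ E]
    (ℓ : ι → X →L[ℝ] E) (hℓ : ∀ u, (∀ i, ℓ i u = 0) → u = 0) {x G : ℝ → X}
    (hG : ContinuousOn G (Ici 0))
    (h : ∀ i, ∀ t, 0 ≤ t → HasDerivWithinAt (fun r => ℓ i (x r)) (ℓ i (G t)) (Ici 0) t) :
    ∀ t, 0 ≤ t → HasDerivWithinAt x (G t) (Ici 0) t := by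
  -- `G` extended continuously to negative times, for the fundamental theorem of calculus
  let G₁ : ℝ → X := fun t => G (max t 0)
  have hG₁ : Continuous G₁ :=
    hG.comp_continuous (continuous_id.max continuous_const) fun t => mem_Ici.2 (le_max_right _ _)
  let z : ℝ → X := fun t => x 0 + ∫ r in (0 : ℝ)..t, G₁ r
  have hz : ∀ t, 0 ≤ t → HasDerivAt z (G t) t := fun t ht => by
    have h1 := (hG₁.integral_hasStrictDerivAt 0 t).hasDerivAt.const_add (x 0)
    rwa [show G₁ t = G t by simp only [G₁, max_eq_left ht]] at h1
  have hxz : ∀ t, 0 ≤ t → x t = z t := by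
    intro t ht
    rw [← sub_eq_zero]
    refine hℓ _ fun i => ?_
    have hd : ∀ r, 0 ≤ r → HasDerivWithinAt (fun r => ℓ i (x r) - ℓ i (z r)) 0 (Ici 0) r := by
      intro r hr
      have h1 := (ℓ i).hasFDerivAt.comp_hasDerivWithinAt r (hz r hr).hasDerivWithinAt (s := Ici 0)
      exact ((h i r hr).sub h1).congr_deriv (sub_self _)
    have h2 := constant_of_has_deriv_right_zero (f := fun r => ℓ i (x r) - ℓ i (z r)) (a := 0)
      (b := t) (fun r hr => (hd r hr.1).continuousWithinAt.mono Icc_subset_Ici_self)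
      (fun r hr => (hd r hr.1).mono (Ici_subset_Ici.2 hr.1)) t ⟨ht, le_rfl⟩
    rw [map_sub, h2]
    simp [z]
  intro t ht
  exact (hz t ht).hasDerivWithinAt.congr_of_mem (fun r hr => hxz r hr) ht

end Abstract

variable {L : ℝ} [Fact (0 < L)]

theorem integral_waveForce (p : Params) (x : Phase L) (φ : Torus L → ℂ) :
    ∫ y, ((p.g : ℂ) * (‖fn x.1 y‖ : ℂ) ^ 2 * fn x.1 y
        + (p.lam : ℂ) * ((fn x.2 y : ℝ) : ℂ) * fn x.1 y
        + Complex.I / 2 * ((p.R : ℂ) * ((fn x.2 y : ℝ) : ℂ) - (p.α : ℂ)) * fn x.1 y) * φ y =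
      Complex.I * ∫ y, fn (waveForce p x) y * φ y := by
  rw [← integral_const_mul]
  refine integral_congr_ae ?_
  filter_upwards [fn_ae x.1, repR_ae x.2, fn_ae (waveForce p x)] with y h1 h2 h3
  rw [h3.trans (rep_waveForce p x y), h1, h2]
  generalize rep L x.1 y = z
  push_cast
  linear_combination (((p.g : ℂ) * ‖z‖ ^ 2 * z + p.lam * repR L x.2 y * z) * φ y) * Complex.I_sq

theorem integral_reservoirForce (p : Params) (x : Phase L) (φ : Torus L → ℝ) :
    ∫ y, (p.P - (p.R * ‖fn x.1 y‖ ^ 2 + p.β) * fn x.2 y) * φ y =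
      p.ε * ∫ y, fn (reservoirForce p x) y * φ y := by
  have hε := p.ε_pos.ne'
  rw [← integral_const_mul]
  refine integral_congr_ae ?_
  filter_upwards [fn_ae x.1, repR_ae x.2, repR_ae (reservoirForce p x)] with y h1 h2 h3
  rw [h3.trans (repR_reservoirForce p x y), h1, h2]
  field_simp

theorem massForm_ofSmooth (u : H1 L ℂ) {φ : Torus L → ℂ} (hφ : IsSmooth φ) :
    massForm L u (ofSmooth hφ) = ∫ y, fn u y * φ y := pair_toL2 (fstL L ℂ u) hφ.continuous

theorem stiffForm_ofSmooth (u : H1 L ℂ) {φ : Torus L → ℂ} (hφ : IsSmooth φ) :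
    stiffForm L u (ofSmooth hφ) = ∫ y, weakDx u y * torusDeriv φ y :=
  pair_toL2 (sndL L ℂ u) hφ.deriv_smooth.continuous

/-- The pairing with a continuous test function, as a functional on the real `H¹`. -/
def testR {φ : Torus L → ℝ} (hφ : Continuous φ) : H1 L ℝ →L[ℝ] ℝ :=
  ((pair L ℝ).flip (toL2 L ℝ ⟨φ, hφ⟩)).comp (fstL L ℝ)

theorem testR_apply {φ : Torus L → ℝ} (hφ : Continuous φ) (u : H1 L ℝ) :
    testR hφ u = ∫ y, fn u y * φ y := pair_toL2 (fstL L ℝ u) hφ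

/-- Solutions in the interaction picture are solutions in the sense of distributions. -/
theorem isGlobalSolution_of_solvesOn {p : Params} {x : ℝ → Phase L}
    (h : SolvesOn (field p) (Ici 0) x) :
    IsGlobalSolution p (x 0).1 (x 0).2 (fun t => (physical x t).1) (fun t => (physical x t).2) where
  continuousOn_ψ t ht := continuousWithinAt_schrod (h.fst ht).continuousWithinAt
  continuousOn_n t ht := (h.snd ht).continuousWithinAt
  initial_ψ := schrod_zero _
  initial_n := rfl
  eq_ψ φ hφ t ht := by
    have h1 := hasDerivWithinAt_massForm (h.fst ht)
    rw [schrod_schrod_neg] at h1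
    have h2 : HasDerivWithinAt (fun r => massForm L (physical x r).1 (ofSmooth hφ))
        (((-(Complex.I / 2)) • stiffForm L (physical x t).1 +
          massForm L (waveForce p (physical x t))) (ofSmooth hφ)) (Ici 0) t :=
      (((ContinuousLinearMap.apply ℂ ℂ (ofSmooth hφ)).restrictScalars
        ℝ).hasFDerivAt.comp_hasDerivWithinAt t h1)
    have h3 := h2.const_mul Complex.I
    simp_rw [massForm_ofSmooth] at h3
    refine h3.congr_deriv ?_
    rw [integral_waveForce, add_apply, smul_apply, massForm_ofSmooth, stiffForm_ofSmooth,
      smul_eq_mul]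
    generalize ∫ y, weakDx (physical x t).1 y * torusDeriv φ y = a
    linear_combination (-(1 / 2 : ℂ) * a) * Complex.I_sq
  eq_n φ hφ t ht := by
    have h1 : HasDerivWithinAt (fun r => testR hφ.continuous (x r).2)
        (testR hφ.continuous (reservoirForce p (physical x t))) (Ici 0) t :=
      (testR hφ.continuous).hasFDerivAt.comp_hasDerivWithinAt t (h.snd ht)
    have h2 := h1.const_mul p.ε
    simp_rw [testR_apply] at h2
    rw [integral_reservoirForce]
    exact h2

theorem inner_mode_eq_integral (u : H1 L ℂ) (k : ℤ) :
    inner ℂ (mode L k) u = (1 + wave L k ^ 2 : ℝ) * ∫ y, fn u y * fourier (-k) y := by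
  rw [inner_mode, inner_fourier_eq_pair]
  exact congrArg _ (pair_toL2 (fstL L ℂ u) (fourier (-k)).continuous)

theorem integral_weakDx_fourier (u : H1 L ℂ) (k : ℤ) :
    ∫ y, weakDx u y * torusDeriv (fourier (-k) : Torus L → ℂ) y =
      (wave L k : ℂ) ^ 2 * ∫ y, fn u y * fourier (-k) y := by
  have h1 := congrArg (fun T => T u) (stiffForm_mode (L := L) (-k))
  have h2 : stiffForm L (mode L (-k)) u = stiffForm L u (mode L (-k)) := pair_comm _ _
  have h3 : massForm L (mode L (-k)) u = massForm L u (mode L (-k)) := pair_comm _ _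
  have h4 : wave L (-k) = -wave L k := by simp [wave]; ring
  simp only [smul_apply, h2, h3, h4] at h1
  refine (stiffForm_ofSmooth u (isSmooth_fourier (-k))).symm.trans (h1.trans ?_)
  rw [smul_eq_mul, mode, massForm_ofSmooth]
  push_cast
  ring

/-- The Fourier modes of a distributional solution satisfy the equation in the interaction
picture. -/
theorem hasDerivWithinAt_inner_mode {p : Params} {ψ₀ : H1 L ℂ} {n₀ : H1 L ℝ} {ψ : ℝ → H1 L ℂ}
    {n : ℝ → H1 L ℝ} (h : IsGlobalSolution p ψ₀ n₀ ψ n) (k : ℤ) {t : ℝ} (ht : 0 ≤ t) :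
    HasDerivWithinAt (fun r => inner ℂ (mode L k) (schrod (-r) (ψ r)))
      (inner ℂ (mode L k) (schrod (-t) (waveForce p (ψ t, n t)))) (Ici 0) t := by
  have h1 := (h.eq_ψ _ (isSmooth_fourier (-k)) t ht).const_mul (-Complex.I)
  have e1 := integral_waveForce p (ψ t, n t) (fourier (-k) : Torus L → ℂ)
  simp only at e1
  rw [e1, integral_weakDx_fourier] at h1
  have h2 : HasDerivWithinAt (fun r => ∫ y, fn (ψ r) y * fourier (-k) y)
      (-(Complex.I / 2) * (wave L k : ℂ) ^ 2 * (∫ y, fn (ψ t) y * fourier (-k) y) +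
        ∫ y, fn (waveForce p (ψ t, n t)) y * fourier (-k) y) (Ici 0) t := by
    have e2 : (fun r => ∫ y, fn (ψ r) y * fourier (-k) y) =
        fun r => -Complex.I * (Complex.I * ∫ y, fn (ψ r) y * fourier (-k) y) := by
      funext r
      linear_combination (∫ y, fn (ψ r) y * fourier (-k) y) * Complex.I_sq
    rw [e2]
    refine h1.congr_deriv ?_
    linear_combination (-∫ y, fn (waveForce p (ψ t, n t)) y * fourier (-k) y) * Complex.I_sq
  have h3 : HasDerivWithinAt (fun r => phase L (-r) k)
      (Complex.I / 2 * (wave L k : ℂ) ^ 2 * phase L (-t) k) (Ici 0) t := by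
    have := ((hasDerivAt_phase (L := L) (-t) k).scomp t (hasDerivAt_neg t)).hasDerivWithinAt
      (s := Ici 0)
    refine this.congr_deriv ?_
    rw [neg_smul, one_smul]
    ring
  have h4 := (h3.mul h2).const_mul ((1 + wave L k ^ 2 : ℝ) : ℂ)
  simp_rw [inner_mode_schrod, inner_mode_eq_integral]
  refine (h4.congr_deriv ?_).congr_of_eventuallyEq (Filter.Eventually.of_forall fun r => ?_) ?_
  · ring
  · simp only [Pi.mul_apply]
    ring
  · simp only [Pi.mul_apply]
    ring

/-- Smooth test functions separate the real `H¹`. -/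
theorem eq_zero_of_test (u : H1 L ℝ)
    (h : ∀ φ : Torus L → ℝ, IsSmooth φ → ∫ y, fn u y * φ y = 0) : u = 0 := by
  have h1 : ofRealH1 L u = 0 := by
    refine eq_zero_of_inner_mode _ fun k => ?_
    have hre : IsSmooth fun y : Torus L => (fourier (-k) y).re :=
      Complex.reCLM.contDiff.comp (isSmooth_fourier (-k))
    have him : IsSmooth fun y : Torus L => (fourier (-k) y).im :=
      Complex.imCLM.contDiff.comp (isSmooth_fourier (-k))
    have e1 : ∫ y, fn (ofRealH1 L u) y * fourier (-k) y =
        ((∫ y, fn u y * (fourier (-k) y).re : ℝ) : ℂ) +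
          ((∫ y, fn u y * (fourier (-k) y).im : ℝ) : ℂ) * Complex.I := by
      rw [← integral_complex_ofReal, ← integral_complex_ofReal, ← integral_mul_const,
        ← integral_add]
      · refine integral_congr_ae ?_
        filter_upwards [fn_mapH1 Complex.ofRealCLM u] with y hy
        have hy' : fn (ofRealH1 L u) y = ((fn u y : ℝ) : ℂ) := hy
        rw [hy']
        conv_lhs => rw [← Complex.re_add_im (fourier (-k) y)]
        push_cast
        ring
      · exact (integrable_mul_smooth (fstL L ℝ u) hre).ofReal
      · exact (integrable_mul_smooth (fstL L ℝ u) him).ofReal.mul_const _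
    rw [inner_mode_eq_integral, e1, h _ hre, h _ him]
    simp
  have h2 : reH1 L (ofRealH1 L u) = u := by
    refine H1_ext_fn ?_ ?_
    · filter_upwards [fn_mapH1 Complex.reCLM (ofRealH1 L u), fn_mapH1 Complex.ofRealCLM u]
        with y h3 h4
      exact h3.trans (congrArg Complex.re h4)
    · filter_upwards [weakDx_mapH1 Complex.reCLM (ofRealH1 L u),
        weakDx_mapH1 Complex.ofRealCLM u] with y h3 h4
      exact h3.trans (congrArg Complex.re h4)
  rw [← h2, h1, map_zero]

theorem continuousOn_schrod_neg {w : ℝ → H1 L ℂ} {s : Set ℝ} (hw : ContinuousOn w s) :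
    ContinuousOn (fun t => schrod (-t) (w t)) s :=
  continuousOn_isometry_neg continuous_schrod hw

theorem continuousOn_waveForce (p : Params) {ψ : ℝ → H1 L ℂ} {n : ℝ → H1 L ℝ}
    (hψ : ContinuousOn ψ (Ici 0)) (hn : ContinuousOn n (Ici 0)) :
    ContinuousOn (fun t => waveForce p (ψ t, n t)) (Ici 0) :=
  (lipBdd_waveForce p).continuous.comp_continuousOn (hψ.prodMk hn)

theorem continuousOn_reservoirForce (p : Params) {ψ : ℝ → H1 L ℂ} {n : ℝ → H1 L ℝ}
    (hψ : ContinuousOn ψ (Ici 0)) (hn : ContinuousOn n (Ici 0)) :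
    ContinuousOn (fun t => reservoirForce p (ψ t, n t)) (Ici 0) :=
  (lipBdd_reservoirForce p).continuous.comp_continuousOn (hψ.prodMk hn)

theorem IsGlobalSolution.hasDerivWithinAt_fst {p : Params} {ψ₀ : H1 L ℂ} {n₀ : H1 L ℝ}
    {ψ : ℝ → H1 L ℂ} {n : ℝ → H1 L ℝ} (h : IsGlobalSolution p ψ₀ n₀ ψ n) (t : ℝ) (ht : 0 ≤ t) :
    HasDerivWithinAt (fun r => schrod (-r) (ψ r)) (schrod (-t) (waveForce p (ψ t, n t)))
      (Ici 0) t :=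
  hasDerivWithinAt_of_functionals (fun k : ℤ => (innerSL ℂ (mode L k)).restrictScalars ℝ)
    eq_zero_of_inner_mode
    (continuousOn_schrod_neg (continuousOn_waveForce p h.continuousOn_ψ h.continuousOn_n))
    (fun k _ hr => hasDerivWithinAt_inner_mode h k hr) t ht

theorem IsGlobalSolution.hasDerivWithinAt_test {p : Params} {ψ₀ : H1 L ℂ} {n₀ : H1 L ℝ}
    {ψ : ℝ → H1 L ℂ} {n : ℝ → H1 L ℝ} (h : IsGlobalSolution p ψ₀ n₀ ψ n) {φ : Torus L → ℝ}
    (hφ : IsSmooth φ) (t : ℝ) (ht : 0 ≤ t) :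
    HasDerivWithinAt (fun r => testR hφ.continuous (n r))
      (testR hφ.continuous (reservoirForce p (ψ t, n t))) (Ici 0) t := by
  have h3 := (h.eq_n φ hφ t ht).const_mul p.ε⁻¹
  refine (h3.congr_deriv ?_).congr_of_eventuallyEq (Filter.Eventually.of_forall fun r => ?_) ?_
  · rw [testR_apply]
    refine (congrArg _ (integral_reservoirForce p (ψ t, n t) φ)).trans ?_
    exact inv_mul_cancel_left₀ p.ε_pos.ne' _
  · exact (testR_apply _ _).trans (inv_mul_cancel_left₀ p.ε_pos.ne' _).symm
  · exact (testR_apply _ _).trans (inv_mul_cancel_left₀ p.ε_pos.ne' _).symm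

theorem IsGlobalSolution.hasDerivWithinAt_snd {p : Params} {ψ₀ : H1 L ℂ} {n₀ : H1 L ℝ}
    {ψ : ℝ → H1 L ℂ} {n : ℝ → H1 L ℝ} (h : IsGlobalSolution p ψ₀ n₀ ψ n) (t : ℝ) (ht : 0 ≤ t) :
    HasDerivWithinAt n (reservoirForce p (ψ t, n t)) (Ici 0) t :=
  hasDerivWithinAt_of_functionals
    (fun φ : {φ : Torus L → ℝ // IsSmooth φ} => testR φ.2.continuous)
    (fun u hu => eq_zero_of_test u fun φ hφ => (testR_apply _ u).symm.trans (hu ⟨φ, hφ⟩))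
    (continuousOn_reservoirForce p h.continuousOn_ψ h.continuousOn_n)
    (fun φ r hr => h.hasDerivWithinAt_test φ.2 r hr) t ht

theorem field_schrod_neg (p : Params) (t : ℝ) (u : H1 L ℂ) (w : H1 L ℝ) :
    field p t (schrod (-t) u, w) = (schrod (-t) (waveForce p (u, w)), reservoirForce p (u, w)) := by
  unfold field
  rw [schrod_schrod_neg]

/-- Distributional solutions are solutions in the interaction picture. -/
theorem solvesOn_of_isGlobalSolution {p : Params} {ψ₀ : H1 L ℂ} {n₀ : H1 L ℝ} {ψ : ℝ → H1 L ℂ}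
    {n : ℝ → H1 L ℝ} (h : IsGlobalSolution p ψ₀ n₀ ψ n) :
    SolvesOn (field p) (Ici 0) (fun t => (schrod (-t) (ψ t), n t)) := fun t ht =>
  ((h.hasDerivWithinAt_fst t ht).prodMk (h.hasDerivWithinAt_snd t ht)).congr_deriv
    (field_schrod_neg p t (ψ t) (n t)).symm

/-- A continuous representative that is positive almost everywhere is nonnegative at every point. -/
theorem repR_nonneg_of_ae {u : H1 L ℝ} (h : ∀ᵐ y : Torus L, 0 < fn u y) (y : Torus L) :
    0 ≤ repR L u y := by
  let f : C(Torus L, ℝ) := ⟨_, continuous_repR u⟩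
  let g : C(Torus L, ℝ) := ⟨fun y => max (repR L u y) 0, (continuous_repR u).max continuous_const⟩
  have hfg : f = g := by
    refine eq_of_ae_eq_continuous ?_
    filter_upwards [h, repR_ae u] with y h1 h2
    rw [h2] at h1
    exact (max_eq_left h1.le).symm
  have := DFunLike.congr_fun hfg y
  exact (le_max_right (repR L u y) 0).trans_eq this.symm

/-- A distributional solution is determined by its initial data. -/
theorem IsGlobalSolution.eq_physical {p : Params} {ψ₀ : H1 L ℂ} {n₀ : H1 L ℝ} {ψ : ℝ → H1 L ℂ}
    {n : ℝ → H1 L ℝ} (h : IsGlobalSolution p ψ₀ n₀ ψ n) {x : ℝ → Phase L}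
    (hx : SolvesOn (field p) (Ici 0) x) (hx0 : x 0 = (ψ₀, n₀)) {t : ℝ} (ht : 0 ≤ t) :
    ψ t = (physical x t).1 ∧ n t = (physical x t).2 := by
  have h0 : (schrod (-0 : ℝ) (ψ 0), n 0) = x 0 := by
    rw [hx0, neg_zero, schrod_zero, h.initial_ψ, h.initial_n]
  have hs : Icc (0 : ℝ) t ⊆ Ici 0 := Icc_subset_Ici_self
  have h1 : (schrod (-t) (ψ t), n t) = x t :=
    SolvesOn.eqOn (field_lipschitz p) (SolvesOn.mono (solvesOn_of_isGlobalSolution h) hs)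
      (hx.mono hs) h0 ⟨ht, le_rfl⟩
  have h2 : schrod (-t) (ψ t) = (x t).1 := congrArg Prod.fst h1
  refine ⟨?_, congrArg Prod.snd h1⟩
  exact (schrod_schrod_neg t (ψ t)).symm.trans (congrArg (schrod t) h2)

theorem continuous_field_left (p : Params) (x : Phase L) : Continuous fun t => field p t x :=
  Continuous.uncurry_right (f := field p) x (continuous_field p)

theorem exists_solvesOn_field (p : Params) (x₀ : Phase L) (h0 : ∀ y, 0 ≤ repR L x₀.2 y) :
    ∃ x : ℝ → Phase L, x 0 = x₀ ∧ SolvesOn (field p) (Ici 0) x :=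
  exists_solvesOn_Ici (field_lipschitz p)
    (fun x => continuous_field_left p x) x₀ (exists_bound p h0)

theorem exists_totalMass_le {p : Params} {x : ℝ → Phase L} (hx : SolvesOn (field p) (Ici 0) x)
    (h0 : ∀ y, 0 ≤ repR L (x 0).2 y) :
    ∃ C : ℝ, ∀ t, 0 ≤ t → |totalMass p (physical x t).1 (physical x t).2| ≤ C := by
  obtain ⟨N₀, hN₀⟩ := (isCompact_range (continuous_repR (x 0).2)).isBounded.exists_norm_le
  refine ⟨max (totalMass p (physical x 0).1 (physical x 0).2)
    (p.P * L / min p.α (p.β / p.ε)), fun t ht => ?_⟩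
  have hs : SolvesOn (field p) (Icc 0 t) x := hx.mono Icc_subset_Ici_self
  have hb := reservoir_bounds hs (le_max_right N₀ (p.P / p.β)) fun y =>
    ⟨h0 y, (le_abs_self _).trans ((hN₀ _ ⟨y, rfl⟩).trans (le_max_left _ _))⟩
  have h1 := totalMass_bounds hs (fun r hr y => (hb r hr y).1) t ⟨ht, le_rfl⟩
  rw [abs_of_nonneg h1.1]
  exact h1.2

/-- Well-posedness, with the initial reservoir nonnegative at every point. -/
theorem exists_unique_isGlobalSolution (p : Params) (ψ₀ : H1 L ℂ) (n₀ : H1 L ℝ)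
    (h0 : ∀ y, 0 ≤ repR L n₀ y) :
    ∃ (ψ : ℝ → H1 L ℂ) (n : ℝ → H1 L ℝ), IsGlobalSolution p ψ₀ n₀ ψ n ∧
      (∀ (ψ' : ℝ → H1 L ℂ) (n' : ℝ → H1 L ℝ), IsGlobalSolution p ψ₀ n₀ ψ' n' →
        ∀ t : ℝ, 0 ≤ t → ψ' t = ψ t ∧ n' t = n t) ∧
      ∃ C : ℝ, ∀ t : ℝ, 0 ≤ t → |totalMass p (ψ t) (n t)| ≤ C := by
  obtain ⟨x, hx0, hx⟩ := exists_solvesOn_field p (ψ₀, n₀) h0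
  have h1 : IsGlobalSolution p ψ₀ n₀ (fun t => (physical x t).1) fun t => (physical x t).2 := by
    have h2 := isGlobalSolution_of_solvesOn hx
    rwa [hx0] at h2
  have h2 : ∀ y, 0 ≤ repR L (x 0).2 y := by rwa [hx0]
  exact ⟨_, _, h1, fun ψ' n' h' t ht => h'.eq_physical hx hx0 ht, exists_totalMass_le hx h2⟩

end Polariton

end

theorem theorem2p5 (L : ℝ) [Fact (0 < L)] (p : Polariton.Params)
    (ψ₀ : Polariton.H1 L ℂ) (n₀ : Polariton.H1 L ℝ)
    (hn₀ : ∀ᵐ x : Polariton.Torus L, 0 < Polariton.fn n₀ x) :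
    ∃ (ψ : ℝ → Polariton.H1 L ℂ) (n : ℝ → Polariton.H1 L ℝ),
      Polariton.IsGlobalSolution p ψ₀ n₀ ψ n ∧
      (∀ (ψ' : ℝ → Polariton.H1 L ℂ) (n' : ℝ → Polariton.H1 L ℝ),
        Polariton.IsGlobalSolution p ψ₀ n₀ ψ' n' →
          ∀ t : ℝ, 0 ≤ t → ψ' t = ψ t ∧ n' t = n t) ∧
      ∃ C : ℝ, ∀ t : ℝ, 0 ≤ t → |Polariton.totalMass p (ψ t) (n t)| ≤ C :=
  Polariton.exists_unique_isGlobalSolution p ψ₀ n₀ (Polariton.repR_nonneg_of_ae hn₀)
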